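/- Let $d,m\in\mathbb N$, $T>0$, let $\ell\in C^2(\mathbb R^{2d})$, and let $F:[0,T]\times\mathbb R^d\times\mathbb R^m\to\mathbb R^d$ satisfy, with $B(R)$ the closed ball of radius $R$: * for each $\theta$, $(t,x)\mapsto F(t,x,\theta)$ is continuous; there are constants $C_F,L_F>0$ such that for every $\theta$, a.e. $t\in[0,T]$ and all $x,x_1,x_2$: $|F(t,x,\theta)|\le C_F(1+|x|)$ and $|F(t,x_1,\theta)-F(t,x_2,\theta)|\le L_F(1+|\theta|)|x_1-x_2|$; $\theta\mapsto F(t,x,\theta)$ is twice differentiable and for each $R>0$ the maps $\nabla_\theta F,\nabla^2_\theta F$ are continuous and bounded on $[0,T]\times B(R)\times\mathbb R^m$; * $x\mapsto F(t,x,\theta)$ is $C^2$, $x\mapsto\nabla_\theta F(t,x,\theta)$ is differentiable, and for all $R,M>0$ there is a constant $C$ such that for all $t,s\in[0,T]$, $x,y\in B(R)$ and $|\theta|\le M$: $|\nabla_x\cdot\nabla_\theta F(t,x,\theta)|+|\nabla_xF(t,x,\theta)|+|\nabla_x^2F(t,x,\theta)|\le C$ and $|\nabla_\theta F(t,x,\theta)-\nabla_\theta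 F(t,y,\theta)|\le C|x-y|$; moreover for all $R>0$ there is $C$ such that $|F(t,x,\theta_1)-F(s,x,\theta_2)|\le C(|t-s|+|\theta_1-\theta_2|)$ for all $t,s\in[0,T]$, $x\in B(R)$, $\theta_1,\theta_2\in\mathbb R^m$. For a compactly supported Borel probability measure $\mu_0$ on $\mathbb R^{2d}$ and $\lambda>0$ consider the problem of minimizing $$\int_{\mathbb R^{2d}}\ell(x,y)\,d\mu_T(x,y)+\lambda\int_0^T|\theta_t|^2\,dt$$ over all $\theta\in L^2([0,T];\mathbb R^m)$ and all $W_1$-continuous curves $\mu$ of compactly supported probability measures solving, in the sense of distributions, $$\partial_t\mu_t+\nabla_x\cdot(F(t,x,\theta_t)\mu_t)=0,\qquad \mu_t|_{t=0}=\mu_0 .\tag{1}$$ A control $\theta\in L^2([0,T];\mathbb R^m)$ is said to fulfill the mean-field Pontryagin maximum principle (PMP) if there are $\mu$ and $\psi$ such that $\mu$ solves (1), $\psi$ is the characteristic solution, $\psi(t,x,y)=\ell(\Phi^\theta_{(t,T)}(x),y)$ with $\Phi^\theta_{(t,T)}$ the flow of $\dot X=F(t,X,\theta_t)$ from time $t$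 to time $T$, of $$\partial_t\psi+\nabla_x\psi\cdot F(t,x,\theta_t)=0,\qquad \psi|_{t=T}=\ell ,\tag{2}$$ and, for a.e. $t\in[0,T]$, $$\theta_t^\top=-\frac1{2\lambda}\int_{\mathbb R^{2d}}\nabla_x\psi(t,x,y)\cdot\nabla_\theta F(t,x,\theta_t)\,d\mu_t(x,y).\tag{3}$$ **Theorem.** For every compact $K\subset\mathbb R^{2d}$ there is $\lambda_0>0$ such that for every $\lambda\ge\lambda_0$ and every probability measure $\mu_0$ supported in $K$: the minimization problem has a solution; a control $\theta^*\in L^2([0,T];\mathbb R^m)$ fulfills the PMP if and only if it is optimal; and the optimal control $\theta^*$ is unique (up to a.e. equality). If moreover $\nabla_\theta F$ is Lipschitz in time locally uniformly in $(x,\theta)$ (for instance if $F$ does not depend on $t$), then $\theta^*$ has a Lipschitz continuous representative on $[0,T]$. Finally, for each $\lambda\ge\lambda_0$ the optimal control depends continuously on $\mu_0$: there is $C\ge0$ with $\|\theta^*-\theta^{*\prime}\|_{L^\infty(0,T)}\le C\,W_1(\mu_0,\mu_0')$ whenever $\theta^*,\theta^{*\prime}$ are optimal for $\mu_0,\mu_0'$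 supported in $K$. -/

import Mathlib

open MeasureTheory Set Filter Topology
open scoped ENNReal NNReal

noncomputable section

namespace NeurODE

/-- The Euclidean space `ℝⁿ`. -/
abbrev E (n : ℕ) : Type := EuclideanSpace ℝ (Fin n)

variable {d m : ℕ}

/-! ### Derivatives of the forward map `F(t, x, θ)` -/

/-- `∇_θ F(t, x, θ)`, as a linear map `ℝᵐ → ℝᵈ`. -/
def gradTheta (F : ℝ → E d → E m → E d) (t : ℝ) (x : E d) (θ : E m) : E m →L[ℝ] E d :=
  fderiv ℝ (fun ϑ => F t x ϑ) θ

/-- `∇_θ² F(t, x, θ)`. -/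
def gradTheta2 (F : ℝ → E d → E m → E d) (t : ℝ) (x : E d) (θ : E m) :
    E m →L[ℝ] E m →L[ℝ] E d :=
  fderiv ℝ (fun ϑ => gradTheta F t x ϑ) θ

/-- `∇_x F(t, x, θ)`. -/
def gradX (F : ℝ → E d → E m → E d) (t : ℝ) (x : E d) (θ : E m) : E d →L[ℝ] E d :=
  fderiv ℝ (fun ξ => F t ξ θ) x

/-- `∇_x² F(t, x, θ)`. -/
def gradX2 (F : ℝ → E d → E m → E d) (t : ℝ) (x : E d) (θ : E m) :
    E d →L[ℝ] E d →L[ℝ] E d :=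
  fderiv ℝ (fun ξ => gradX F t ξ θ) x

/-- The divergence `∇_x · ∇_θ F(t, x, θ)`, a covector on `ℝᵐ`, evaluated at `η`: the trace of
the differential of `ξ ↦ ∇_θ F(t, ξ, θ) η` at `x`. -/
def divGradTheta (F : ℝ → E d → E m → E d) (t : ℝ) (x : E d) (θ : E m) (η : E m) : ℝ :=
  LinearMap.trace ℝ (E d) (fderiv ℝ (fun ξ => gradTheta F t ξ θ η) x : E d →ₗ[ℝ] E d)

/-! ### The two sets of hypotheses on `F`, for a given horizon `T` -/

/-- Cauchy-Lipschitz type hypotheses. -/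
structure Assumption1 (F : ℝ → E d → E m → E d) (T : ℝ) : Prop where
  continuousOn : ∀ θ : E m,
    ContinuousOn (fun p : ℝ × E d => F p.1 p.2 θ) (Icc 0 T ×ˢ univ)
  growth : ∃ C : ℝ, 0 < C ∧ ∀ θ : E m, ∀ᵐ t ∂(volume.restrict (Icc (0 : ℝ) T)), ∀ x : E d,
    ‖F t x θ‖ ≤ C * (1 + ‖x‖)
  lipschitz : ∃ L : ℝ, 0 < L ∧ ∀ θ : E m, ∀ᵐ t ∂(volume.restrict (Icc (0 : ℝ) T)),
    ∀ x₁ x₂ : E d, ‖F t x₁ θ - F t x₂ θ‖ ≤ L * (1 + ‖θ‖) * ‖x₁ - x₂‖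
  differentiable : ∀ t ∈ Icc 0 T, ∀ x : E d,
    Differentiable ℝ (fun θ => F t x θ) ∧ Differentiable ℝ (fun θ => gradTheta F t x θ)
  gradTheta_continuousOn : ∀ R : ℝ, 0 < R →
    ContinuousOn (fun p : ℝ × E d × E m => gradTheta F p.1 p.2.1 p.2.2)
      (Icc 0 T ×ˢ Metric.closedBall 0 R ×ˢ univ)
  gradTheta2_continuousOn : ∀ R : ℝ, 0 < R →
    ContinuousOn (fun p : ℝ × E d × E m => gradTheta2 F p.1 p.2.1 p.2.2)
      (Icc 0 T ×ˢ Metric.closedBall 0 R ×ˢ univ)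
  gradTheta_bound : ∀ R : ℝ, 0 < R → ∃ C : ℝ, ∀ t ∈ Icc 0 T,
    ∀ x ∈ Metric.closedBall (0 : E d) R, ∀ θ : E m,
      ‖gradTheta F t x θ‖ + ‖gradTheta2 F t x θ‖ ≤ C

/-- Additional regularity hypotheses. A constant `C(R, |θ|)` is a constant that can be chosen
uniformly for `|θ| ≤ M`, for every `M`. -/
structure Assumption2 (F : ℝ → E d → E m → E d) (T : ℝ) : Prop where
  contDiff_x : ∀ t ∈ Icc 0 T, ∀ θ : E m, ContDiff ℝ 2 (fun x => F t x θ)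
  differentiable_gradTheta : ∀ t ∈ Icc 0 T, ∀ θ : E m,
    Differentiable ℝ (fun x => gradTheta F t x θ)
  x_bound : ∀ R M : ℝ, 0 < R → ∃ C : ℝ, ∀ t ∈ Icc 0 T,
    ∀ x ∈ Metric.closedBall (0 : E d) R, ∀ θ : E m, ‖θ‖ ≤ M → ∀ η : E m, ‖η‖ ≤ 1 →
      |divGradTheta F t x θ η| + ‖gradX F t x θ‖ + ‖gradX2 F t x θ‖ ≤ C
  lipschitz_time_theta : ∀ R : ℝ, 0 < R → ∃ C : ℝ, ∀ t ∈ Icc 0 T, ∀ s ∈ Icc 0 T,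
    ∀ x ∈ Metric.closedBall (0 : E d) R, ∀ θ₁ θ₂ : E m,
      ‖F t x θ₁ - F s x θ₂‖ ≤ C * (|t - s| + ‖θ₁ - θ₂‖)
  lipschitz_gradTheta : ∀ R M : ℝ, 0 < R → ∃ C : ℝ, ∀ t ∈ Icc 0 T,
    ∀ x ∈ Metric.closedBall (0 : E d) R, ∀ y ∈ Metric.closedBall (0 : E d) R,
    ∀ θ : E m, ‖θ‖ ≤ M →
      ‖gradTheta F t x θ - gradTheta F t y θ‖ ≤ C * ‖x - y‖

/-- `∇_θ F` is Lipschitz in time, locally uniformly in `(x, θ)`. -/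
def GradThetaTimeLipschitz (F : ℝ → E d → E m → E d) (T : ℝ) : Prop :=
  ∀ R M : ℝ, 0 < R → ∃ C : ℝ, ∀ t ∈ Icc 0 T, ∀ s ∈ Icc 0 T,
    ∀ x ∈ Metric.closedBall (0 : E d) R, ∀ θ : E m, ‖θ‖ ≤ M →
      ‖gradTheta F t x θ - gradTheta F s x θ‖ ≤ C * |t - s|

/-! ### Measures on `ℝ²ᵈ` and the continuity equation -/

/-- Borel probability measures on `ℝ²ᵈ` with compact support. -/
def IsCompactlySupportedProb (μ : Measure (E d × E d)) : Prop :=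
  IsProbabilityMeasure μ ∧ ∃ K : Set (E d × E d), IsCompact K ∧ μ Kᶜ = 0

/-- The `1`-Wasserstein distance on `ℝ²ᵈ`, for the Euclidean distance of `ℝ²ᵈ`. -/
def W1 (μ ν : Measure (E d × E d)) : ℝ≥0∞ :=
  ⨅ (π : Measure ((E d × E d) × (E d × E d))) (_ : π.map Prod.fst = μ) (_ : π.map Prod.snd = ν),
    ∫⁻ p, ENNReal.ofReal (Real.sqrt (‖p.1.1 - p.2.1‖ ^ 2 + ‖p.1.2 - p.2.2‖ ^ 2)) ∂π

/-- `μ ∈ C([0,T]; P_c(ℝ²ᵈ))` is a weak solution of `∂ₜμ + ∇ₓ·(F(t,x,θₜ)μ) = 0`, `μ|ₜ₌₀ = μ₀`.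
For a test function `φ(t, x, y)`, the number `fderiv ℝ φ (t, z) (1, v, 0)` is
`∂ₜφ(t,z) + ∇ₓφ(t,z)·v`. -/
structure IsWeakSolution (F : ℝ → E d → E m → E d) (T : ℝ) (θ : ℝ → E m)
    (μ₀ : Measure (E d × E d)) (μ : ℝ → Measure (E d × E d)) : Prop where
  prob : ∀ t ∈ Icc 0 T, IsCompactlySupportedProb (μ t)
  continuous : ∀ t ∈ Icc 0 T, Tendsto (fun s => W1 (μ s) (μ t)) (𝓝[Icc 0 T] t) (𝓝 0)
  initial : μ 0 = μ₀
  weak : ∀ φ : ℝ × (E d × E d) → ℝ, ContDiff ℝ 1 φ → HasCompactSupport φ →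
    tsupport φ ⊆ Ioo 0 T ×ˢ univ →
    ∫ t in (0 : ℝ)..T, ∫ z, fderiv ℝ φ (t, z) (1, F t z.1 (θ t), 0) ∂(μ t) = 0

/-! ### The optimal control problem -/

/-- Controls in `L²([0,T]; ℝᵐ)`. -/
def IsControl (T : ℝ) (θ : ℝ → E m) : Prop :=
  MemLp θ 2 (volume.restrict (Icc 0 T))

/-- `∫ ℓ dμ_T + λ ∫₀ᵀ |θₜ|² dt`. -/
def cost (ℓ : E d × E d → ℝ) (T lam : ℝ) (θ : ℝ → E m) (μ : ℝ → Measure (E d × E d)) : ℝ :=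
  ∫ z, ℓ z ∂(μ T) + lam * ∫ t in (0 : ℝ)..T, ‖θ t‖ ^ 2

/-- `θ` is an optimal control: together with a solution of the continuity equation it minimizes
the cost among all pairs of an `L²` control and a corresponding solution. -/
def IsOptimal (F : ℝ → E d → E m → E d) (ℓ : E d × E d → ℝ) (T lam : ℝ)
    (μ₀ : Measure (E d × E d)) (θ : ℝ → E m) : Prop :=
  IsControl T θ ∧ ∃ μ, IsWeakSolution F T θ μ₀ μ ∧
    ∀ θ' μ', IsControl T θ' → IsWeakSolution F T θ' μ₀ μ' →
      cost ℓ T lam θ μ ≤ cost ℓ T lam θ' μ'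

/-! ### The mean-field Pontryagin maximum principle -/

/-- `Φ τ t x` is the value at time `t` of the solution of `Ẋ = F(t, X, θₜ)` that equals `x` at
time `τ` (in the sense of Carathéodory). -/
def IsFlow (F : ℝ → E d → E m → E d) (T : ℝ) (θ : ℝ → E m) (Φ : ℝ → ℝ → E d → E d) : Prop :=
  ∀ τ ∈ Icc 0 T, ∀ x : E d, ContinuousOn (fun t => Φ τ t x) (Icc 0 T) ∧
    ∀ t ∈ Icc 0 T, Φ τ t x = x + ∫ s in τ..t, F s (Φ τ s x) (θ s)

/-- `∇ₓψ(t, x, y)`. -/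
def gradPsi (ψ : ℝ → E d × E d → ℝ) (t : ℝ) (z : E d × E d) : E d :=
  gradient (fun x => ψ t (x, z.2)) z.1

/-- `ψ` is the characteristic solution of the backward transport equation
`∂ₜψ + ∇ₓψ · F(t, x, θₜ) = 0`, `ψ|ₜ₌T = ℓ`: it is of class `C¹` in space, solves the equation
(integrated in time, as `θ` is only measurable), and has the form
`ψ(t, x, y) = ℓ(Φ_{(t,T)}(x), y)`. -/
structure IsAdjointState (F : ℝ → E d → E m → E d) (ℓ : E d × E d → ℝ) (T : ℝ) (θ : ℝ → E m)
    (ψ : ℝ → E d × E d → ℝ) : Prop where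
  contDiff : ∀ t ∈ Icc 0 T, ContDiff ℝ 1 (ψ t)
  equation : ∀ t ∈ Icc 0 T, ∀ z : E d × E d,
    ψ t z = ℓ z + ∫ s in t..T, inner ℝ (gradPsi ψ s z) (F s z.1 (θ s))
  characteristic : ∃ Φ, IsFlow F T θ Φ ∧
    ∀ t ∈ Icc 0 T, ∀ x y : E d, ψ t (x, y) = ℓ (Φ t T x, y)

/-- `θ` fulfills the mean-field Pontryagin maximum principle. -/
def SatisfiesPMP (F : ℝ → E d → E m → E d) (ℓ : E d × E d → ℝ) (T lam : ℝ)
    (μ₀ : Measure (E d × E d)) (θ : ℝ → E m) : Prop :=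
  ∃ (μ : ℝ → Measure (E d × E d)) (ψ : ℝ → E d × E d → ℝ),
    IsWeakSolution F T θ μ₀ μ ∧ IsAdjointState F ℓ T θ ψ ∧
    ∀ᵐ t ∂(volume.restrict (Icc (0 : ℝ) T)),
      θ t = -(1 / (2 * lam)) •
        ∫ z, ContinuousLinearMap.adjoint (gradTheta F t z.1 (θ t)) (gradPsi ψ t z) ∂(μ t)

end NeurODE

end

open NeurODE

namespace NeurODE

variable {d m : ℕ}

/-! ### Grönwall inequalities -/

/-! For large λ the quadratic penalty dominates every nonlinearity of the problem. Let G(θ)_t be the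
average of (∇_θ F)ᵀ ∇ₓψ over the trajectories of θ issued from μ₀ (`meanControlGrad`). Along its own
flow, a control satisfies the maximum principle when θ = -(1/2λ) G(θ). On continuous controls with
values in the unit ball G is bounded and Lipschitz, uniformly over the initial measures supported in
a fixed ball, so for large λ the right-hand side is a contraction of the unit ball of C([0,T]). Its
fixed point θ (`exists_fixedPoint`) is a continuous solution of the maximum principle, and
everything else is a comparison with this θ.

Let (θ', μ') be any competitor and μ the push-forward of μ₀ by the flow of θ. The pullback ψ of ℓ
along that flow is C¹ in time and space (`contDiff_pullback`), hence an admissible test function in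
the equation for μ', which gives ∫ ℓ dμ'_T - ∫ ℓ dμ_T = ∫∫ ∇ₓψ · (F(θ') - F(θ)) dμ'_s ds
(`integral_pullback`). Linearizing in θ' - θ costs |θ' - θ|²; replacing μ'_s by μ_s costs ‖θ' -
θ‖_{L¹} (`norm_integral_sub_le`). The fixed-point equation turns the remaining linear term into
-2λ⟨θ' - θ, θ⟩, which together with λ(|θ'|² - |θ|²) is λ|θ' - θ|². Hence `le_cost`: J(θ', μ') ≥ J(θ,
μ) + (λ - c)‖θ' - θ‖²_{L²} with c independent of λ. This yields existence, uniqueness, and the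
maximum principle for every optimal control.

Conversely, a control θ' fulfilling the maximum principle is a priori only in L². A bootstrap
argument shows |θ'| ≤ 1 a.e. (`norm_le_one_of_satisfiesPMP`); subtracting the two equations and
integrating in time then gives θ' = θ (`ae_eq_of_satisfiesPMP`). Lipschitz regularity in time and
Lipschitz dependence on μ₀ are read off the fixed-point equation, where the terms in θ on the right
are absorbed by the left-hand side.

No well-posedness theory for measurable controls is needed. The flow of the continuous θ is
classical; weak solutions for other controls are compared with it by duality only; flows of
measurable controls occur only as data of the maximum principle. The gradient of ψ comes from the
costate equation along characteristics (`hasFDerivAt_pullback`) instead of the variational equation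
of the flow. Supports stay in a fixed ball because the growth of F is uniform in θ
(`IsWeakSolution.support`). -/

theorem le_mul_exp_of_sub_le_mul_sub {D I : ℝ → ℝ} {a b : ℝ} (hab : a ≤ b)
    (hD : ContinuousOn D (Icc a b)) (hI : ContinuousOn I (Icc a b))
    (hIm : MonotoneOn I (Icc a b)) (hD0 : ∀ t ∈ Icc a b, 0 ≤ D t)
    (h : ∀ s ∈ Icc a b, ∀ t ∈ Icc a b, s ≤ t → D t - D s ≤ D t * (I t - I s)) :
    D b ≤ D a * Real.exp (2 * (I b - I a)) := by
  set S : Set ℝ := {t | D t ≤ D a * Real.exp (2 * (I t - I a))}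
  have hcl : IsClosed (S ∩ Icc a b) := by
    have : S ∩ Icc a b = {t ∈ Icc a b | D t ≤ D a * Real.exp (2 * (I t - I a))} := by
      ext t; simp [S, and_comm]
    rw [this]
    exact isClosed_Icc.isClosed_le hD (by fun_prop)
  have ha : a ∈ S := by simp [S]
  -- Continuous induction on the set where the bound holds: it is closed, and from each of its
  -- points a short step on which `I` grows by at most 1/2 stays in it.
  have := hcl.Icc_subset_of_forall_exists_gt ha ?_
  · exact this ⟨hab, le_rfl⟩
  rintro s ⟨hs, hsab⟩ y hy
  have hsI : s ∈ Icc a b := ⟨hsab.1, hsab.2.le⟩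
  have hev : ∀ᶠ t in 𝓝[Icc a b] s, I t < I s + 1 / 2 :=
    (hI s hsI).eventually (eventually_lt_nhds (by linarith))
  have hev2 : ∀ᶠ t in 𝓝[>] s, I t < I s + 1 / 2 := by
    have : 𝓝[Ioc s b] s ≤ 𝓝[Icc a b] s :=
      nhdsWithin_mono _ fun t ht => ⟨hsab.1.trans ht.1.le, ht.2⟩
    rw [nhdsWithin_Ioc_eq_nhdsGT hsab.2] at this
    exact this hev
  have hev3 : ∀ᶠ t in 𝓝[>] s, t ∈ Ioc s (min y b) := Ioc_mem_nhdsGT (lt_min hy hsab.2)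
  obtain ⟨t, ht1, ht2⟩ := (hev2.and hev3).exists
  have htI : t ∈ Icc a b := ⟨hsab.1.trans ht2.1.le, ht2.2.trans (min_le_right _ _)⟩
  refine ⟨t, ?_, ht2.1, ht2.2.trans (min_le_left _ _)⟩
  have hst := h s hsI t htI ht2.1.le
  have hm := hIm hsI htI ht2.1.le
  set x := I t - I s with hx
  have hx0 : 0 ≤ x := by linarith
  have hx1 : x ≤ 1 / 2 := by linarith
  -- By `e^{2x} ≥ 1 + 2x` and `(1 - x)(1 + 2x) = 1 + x(1 - 2x) ≥ 1` for `0 ≤ x ≤ 1/2`. This is the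
  -- origin of the factor 2 in all the exponents below.
  have he : 1 ≤ (1 - x) * Real.exp (2 * x) := by
    have := Real.add_one_le_exp (2 * x)
    nlinarith
  have hs' : D s ≤ D a * Real.exp (2 * (I s - I a)) := hs
  show D t ≤ D a * Real.exp (2 * (I t - I a))
  have e1 : Real.exp (2 * (I t - I a)) = Real.exp (2 * (I s - I a)) * Real.exp (2 * x) := by
    rw [← Real.exp_add]; congr 1; rw [hx]; ring
  rw [e1, ← mul_assoc]
  calc D t ≤ D t * ((1 - x) * Real.exp (2 * x)) := le_mul_of_one_le_right (hD0 t htI) he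
    _ = (D t - D t * x) * Real.exp (2 * x) := by ring
    _ ≤ D s * Real.exp (2 * x) := by gcongr; linarith
    _ ≤ _ := by gcongr

/-- The majorant `D t = c + ∫ κ u` dominates `u` and is nondecreasing, so `κ u ≤ κ (D t)` on `[s,
t]` and the previous lemma applies. The rate `κ` is merely integrable because it will be `L (1 +
|θ|)` for an `L²` control. -/
theorem gronwall_Icc {u κ : ℝ → ℝ} {a b c : ℝ} (hab : a ≤ b) (hu : ContinuousOn u (Icc a b))
    (hu0 : ∀ t ∈ Icc a b, 0 ≤ u t) (hκ : IntervalIntegrable κ volume a b) (hκ0 : ∀ t, 0 ≤ κ t)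
    (hc : 0 ≤ c) (h : ∀ t ∈ Icc a b, u t ≤ c + ∫ s in a..t, κ s * u s) :
    u b ≤ c * Real.exp (2 * ∫ s in a..b, κ s) := by
  have huab : uIcc a b = Icc a b := uIcc_of_le hab
  have hκu : IntervalIntegrable (fun s => κ s * u s) volume a b :=
    hκ.mul_continuousOn (by rwa [huab])
  have hsub : ∀ {g : ℝ → ℝ}, IntervalIntegrable g volume a b → ∀ s ∈ Icc a b, ∀ t ∈ Icc a b,
      IntervalIntegrable g volume s t := fun hg s hs t ht =>
    hg.mono_set (uIcc_subset_uIcc (by rwa [huab]) (by rwa [huab]))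
  have haI : a ∈ Icc a b := ⟨le_rfl, hab⟩
  have hdiff : ∀ {g : ℝ → ℝ}, IntervalIntegrable g volume a b → ∀ s ∈ Icc a b, ∀ t ∈ Icc a b,
      (∫ r in a..t, g r) - ∫ r in a..s, g r = ∫ r in s..t, g r := fun hg s hs t ht =>
    intervalIntegral.integral_interval_sub_left (hsub hg a haI t ht) (hsub hg a haI s hs)
  have hcontI : ∀ {g : ℝ → ℝ}, IntervalIntegrable g volume a b →
      ContinuousOn (fun t => ∫ r in a..t, g r) (Icc a b) := fun hg => by
    have := intervalIntegral.continuousOn_primitive_interval' hg left_mem_uIcc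
    rwa [huab] at this
  have hmono : ∀ s ∈ Icc a b, ∀ t ∈ Icc a b, s ≤ t →
      ∫ r in a..s, κ r * u r ≤ ∫ r in a..t, κ r * u r := by
    intro s hs t ht hst
    rw [← sub_nonneg, hdiff hκu s hs t ht]
    exact intervalIntegral.integral_nonneg hst fun r hr =>
      mul_nonneg (hκ0 r) (hu0 r ⟨hs.1.trans hr.1, hr.2.trans ht.2⟩)
  have key := le_mul_exp_of_sub_le_mul_sub (D := fun t => c + ∫ s in a..t, κ s * u s)
    (I := fun t => ∫ s in a..t, κ s) hab (continuousOn_const.add (hcontI hκu)) (hcontI hκ) ?_ ?_ ?_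
  · simp only [intervalIntegral.integral_same, add_zero, sub_zero] at key
    exact (h b ⟨hab, le_rfl⟩).trans key
  · intro s hs t ht hst
    simp only
    rw [← sub_nonneg, hdiff hκ s hs t ht]
    exact intervalIntegral.integral_nonneg hst fun r _ => hκ0 r
  · intro t ht
    have := hmono a haI t ht ht.1
    simp only [intervalIntegral.integral_same] at this
    simpa using add_nonneg hc this
  · intro s hs t ht hst
    rw [add_sub_add_left_eq_sub, hdiff hκu s hs t ht, hdiff hκ s hs t ht,
      ← intervalIntegral.integral_const_mul]
    refine intervalIntegral.integral_mono_on hst (hsub hκu s hs t ht)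
      ((hsub hκ s hs t ht).const_mul _) fun r hr => ?_
    have hr' : r ∈ Icc a b := ⟨hs.1.trans hr.1, hr.2.trans ht.2⟩
    rw [mul_comm]
    have := hmono r hr' t ht hr.2
    have := h r hr'
    gcongr
    · exact hκ0 r
    · linarith

/-- The backward case follows by the reflection `t ↦ -t`; it is needed since costates are integrated
from the final time. -/
theorem gronwall_uIcc {u κ : ℝ → ℝ} {a b c : ℝ} (hu : ContinuousOn u (uIcc a b))
    (hu0 : ∀ t ∈ uIcc a b, 0 ≤ u t) (hκ : IntervalIntegrable κ volume a b) (hκ0 : ∀ t, 0 ≤ κ t)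
    (hc : 0 ≤ c) (h : ∀ t ∈ uIcc a b, u t ≤ c + |∫ s in a..t, κ s * u s|) :
    u b ≤ c * Real.exp (2 * |∫ s in a..b, κ s|) := by
  rcases le_total a b with hab | hab
  · rw [uIcc_of_le hab] at *
    rw [abs_of_nonneg (intervalIntegral.integral_nonneg hab fun r _ => hκ0 r)]
    refine gronwall_Icc hab hu hu0 hκ hκ0 hc fun t ht => ?_
    have := h t ht
    rwa [abs_of_nonneg (intervalIntegral.integral_nonneg ht.1 fun r hr =>
      mul_nonneg (hκ0 r) (hu0 r ⟨hr.1, hr.2.trans ht.2⟩))] at this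
  · rw [uIcc_of_ge hab] at *
    have hmem : ∀ t ∈ Icc (-a) (-b), -t ∈ Icc b a := fun t ht =>
      ⟨by linarith [ht.2], by linarith [ht.1]⟩
    have e1 : |∫ s in a..b, κ s| = ∫ s in (-a)..(-b), κ (-s) := by
      rw [intervalIntegral.integral_comp_neg, neg_neg, neg_neg, intervalIntegral.integral_symm,
        abs_neg, abs_of_nonneg (intervalIntegral.integral_nonneg hab fun r _ => hκ0 r)]
    rw [e1]
    have key := gronwall_Icc (u := fun t => u (-t)) (κ := fun t => κ (-t)) (a := -a) (b := -b)
      (c := c) (by linarith) (hu.comp continuousOn_neg hmem)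
      (fun t ht => hu0 _ (hmem t ht)) ?_ (fun t => hκ0 _) hc ?_
    · simpa using key
    · have := hκ.comp_sub_left 0
      simpa using this
    · intro t ht
      have h1 := h (-t) (hmem t ht)
      rw [intervalIntegral.integral_comp_neg (fun s => κ s * u s), neg_neg]
      rwa [intervalIntegral.integral_symm, abs_neg,
        abs_of_nonneg (intervalIntegral.integral_nonneg (hmem t ht).2 fun r hr =>
          mul_nonneg (hκ0 r) (hu0 r ⟨(hmem t ht).1.trans hr.1, hr.2⟩))] at h1

theorem gronwall_const {u : ℝ → ℝ} {a b c L : ℝ} (hu : ContinuousOn u (uIcc a b))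
    (hu0 : ∀ t ∈ uIcc a b, 0 ≤ u t) (hL : 0 ≤ L) (hc : 0 ≤ c)
    (h : ∀ t ∈ uIcc a b, u t ≤ c + |∫ s in a..t, L * u s|) :
    u b ≤ c * Real.exp (2 * (L * |b - a|)) := by
  have := gronwall_uIcc (κ := fun _ => L) hu hu0 intervalIntegrable_const (fun _ => hL) hc h
  rwa [intervalIntegral.integral_const, smul_eq_mul, mul_comm (b - a), abs_mul,
    abs_of_nonneg hL] at this

/-! ### Global solutions of ordinary differential equations -/

section ODE

variable {V : Type*} [NormedAddCommGroup V] [NormedSpace ℝ V]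

theorem abs_integral_exp_abs_le {K : ℝ} (hK : 0 < K) (τ t : ℝ) :
    |∫ s in τ..t, Real.exp (2 * K * |s - τ|)| ≤ Real.exp (2 * K * |t - τ|) / (2 * K) := by
  rcases le_total τ t with h | h
  · have e : ∫ s in τ..t, Real.exp (2 * K * |s - τ|) =
        Real.exp (2 * K * (t - τ)) / (2 * K) - Real.exp (2 * K * (τ - τ)) / (2 * K) := by
      rw [intervalIntegral.integral_congr (g := fun s => Real.exp (2 * K * (s - τ)))]
      · refine intervalIntegral.integral_eq_sub_of_hasDerivAt
          (f := fun s => Real.exp (2 * K * (s - τ)) / (2 * K)) (fun s _ => ?_)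
          (by apply Continuous.intervalIntegrable; fun_prop)
        have := ((((hasDerivAt_id s).sub_const τ).const_mul (2 * K)).exp).div_const (2 * K)
        exact this.congr_deriv (by simp only [id]; field_simp)
      · intro s hs
        rw [uIcc_of_le h] at hs
        simp only [abs_of_nonneg (sub_nonneg.2 hs.1)]
    rw [e, abs_of_nonneg (sub_nonneg.2 h), sub_self, mul_zero, Real.exp_zero, abs_of_nonneg]
    · have : 0 < 1 / (2 * K) := by positivity
      linarith
    · rw [← sub_div]
      have := Real.one_le_exp (x := 2 * K * (t - τ)) (by have := sub_nonneg.2 h; positivity)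
      exact div_nonneg (by linarith) (by positivity)
  · have e : ∫ s in τ..t, Real.exp (2 * K * |s - τ|) =
        -Real.exp (2 * K * (τ - t)) / (2 * K) - -Real.exp (2 * K * (τ - τ)) / (2 * K) := by
      rw [intervalIntegral.integral_congr (g := fun s => Real.exp (2 * K * (τ - s)))]
      · refine intervalIntegral.integral_eq_sub_of_hasDerivAt
          (f := fun s => -Real.exp (2 * K * (τ - s)) / (2 * K)) (fun s _ => ?_)
          (by apply Continuous.intervalIntegrable; fun_prop)
        have := ((((hasDerivAt_id s).const_sub τ).const_mul (2 * K)).exp).neg.div_const (2 * K)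
        exact this.congr_deriv (by simp only [id]; field_simp)
      · intro s hs
        rw [uIcc_of_ge h] at hs
        simp only [abs_sub_comm s τ, abs_of_nonneg (sub_nonneg.2 hs.2)]
    rw [e, abs_sub_comm t τ, abs_of_nonneg (sub_nonneg.2 h), sub_self, mul_zero, Real.exp_zero,
      abs_of_nonpos]
    · have : 0 < 1 / (2 * K) := by positivity
      rw [neg_div, neg_div]
      linarith
    · rw [neg_div, neg_div, sub_neg_eq_add, neg_add_eq_sub, ← sub_div]
      have := Real.one_le_exp (x := 2 * K * (τ - t)) (by have := sub_nonneg.2 h; positivity)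
      exact div_nonpos_of_nonpos_of_nonneg (by linarith) (by positivity)

theorem norm_integral_le_of_le_exp {K A : ℝ} (hK : 0 < K) {τ t : ℝ} {g : ℝ → V}
    (hg : ∀ s, ‖g s‖ ≤ A * Real.exp (2 * K * |s - τ|)) (hA : 0 ≤ A) :
    ‖∫ s in τ..t, g s‖ ≤ A * (Real.exp (2 * K * |t - τ|) / (2 * K)) := by
  have h1 := intervalIntegral.norm_integral_le_abs_of_norm_le (a := τ) (b := t) (f := g)
    (g := fun s => A * Real.exp (2 * K * |s - τ|)) (μ := volume)
    (Eventually.of_forall fun s => hg s) (by apply Continuous.intervalIntegrable; fun_prop)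
  rw [intervalIntegral.integral_const_mul, abs_mul, abs_of_nonneg hA] at h1
  exact h1.trans (by gcongr; exact abs_integral_exp_abs_le hK τ t)

/-- The Picard operator is conjugated by the weight `w t = exp (2K|t - τ|)`, that is, the unknown is
`u = X / w`. As the integral of `w` from `τ` to `t` is at most `w t / (2K)`, the conjugated operator
contracts bounded continuous functions on the whole line by 1/2, so no gluing of local solutions is
required. -/
theorem exists_global_solution [CompleteSpace V] {f : ℝ → V → V}
    (hf : Continuous (Function.uncurry f)) {L C : ℝ}
    (hL : ∀ t x y, ‖f t x - f t y‖ ≤ L * ‖x - y‖) (hC : ∀ t, ‖f t 0‖ ≤ C) (τ : ℝ) (x : V) :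
    ∃ X : ℝ → V, X τ = x ∧ ∀ t, HasDerivAt X (f t (X t)) t := by
  set K : ℝ := |L| + 1 with hKdef
  have hK : 0 < K := by positivity
  have hLK : ∀ t x y, ‖f t x - f t y‖ ≤ K * ‖x - y‖ := fun t x y =>
    (hL t x y).trans (by gcongr; rw [hKdef]; linarith [le_abs_self L])
  have hC0 : 0 ≤ C := (norm_nonneg _).trans (hC 0)
  let w : ℝ → ℝ := fun t => Real.exp (2 * K * |t - τ|)
  have hw : Continuous w := by fun_prop
  have hw1 : ∀ t, 1 ≤ w t := fun t => Real.one_le_exp (by positivity)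
  have hwp : ∀ t, 0 < w t := fun t => Real.exp_pos _
  have hcont : ∀ u : BoundedContinuousFunction ℝ V, Continuous fun s => f s (w s • u s) :=
    fun u => hf.comp (continuous_id.prodMk (hw.smul u.continuous))
  have hbd : ∀ (u : BoundedContinuousFunction ℝ V) s, ‖f s (w s • u s)‖ ≤ (C + K * ‖u‖) * w s := by
    intro u s
    have h1 := hLK s (w s • u s) 0
    have h2 := norm_sub_norm_le (f s (w s • u s)) (f s 0)
    rw [sub_zero, norm_smul, Real.norm_of_nonneg (hwp s).le] at h1
    have h3 := u.norm_coe_le_norm s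
    have h4 : K * (w s * ‖u s‖) ≤ K * (w s * ‖u‖) := by have := hwp s; gcongr
    have h5 : C ≤ C * w s := le_mul_of_one_le_right hC0 (hw1 s)
    nlinarith [hC s]
  let G : BoundedContinuousFunction ℝ V → BoundedContinuousFunction ℝ V := fun u =>
    BoundedContinuousFunction.ofNormedAddCommGroup
      (fun t => (w t)⁻¹ • (x + ∫ s in τ..t, f s (w s • u s)))
      ((hw.inv₀ fun t => (hwp t).ne').smul (continuous_const.add
        (intervalIntegral.continuous_primitive
          (fun a b => (hcont u).intervalIntegrable a b) τ)))
      (‖x‖ + (C + K * ‖u‖) / (2 * K)) (fun t => by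
        rw [norm_smul, norm_inv, Real.norm_of_nonneg (hwp t).le, inv_mul_le_iff₀ (hwp t)]
        have h1 := norm_integral_le_of_le_exp hK (t := t) (hbd u) (by positivity)
        have h2 := norm_add_le x (∫ s in τ..t, f s (w s • u s))
        have h3 : ‖x‖ ≤ w t * ‖x‖ := le_mul_of_one_le_left (norm_nonneg _) (hw1 t)
        have h4 : (C + K * ‖u‖) * (Real.exp (2 * K * |t - τ|) / (2 * K)) =
          w t * ((C + K * ‖u‖) / (2 * K)) := by simp only [w]; ring
        rw [mul_add]; linarith)
  have hG : ContractingWith (1 / 2) G := by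
    refine ⟨by norm_num, LipschitzWith.of_dist_le_mul fun u v => ?_⟩
    refine (BoundedContinuousFunction.dist_le (by positivity)).2 fun t => ?_
    rw [dist_eq_norm]
    show ‖(w t)⁻¹ • (x + ∫ s in τ..t, f s (w s • u s)) -
      (w t)⁻¹ • (x + ∫ s in τ..t, f s (w s • v s))‖ ≤ _
    rw [← smul_sub, add_sub_add_left_eq_sub, ← intervalIntegral.integral_sub
      ((hcont u).intervalIntegrable _ _) ((hcont v).intervalIntegrable _ _), norm_smul, norm_inv,
      Real.norm_of_nonneg (hwp t).le, inv_mul_le_iff₀ (hwp t)]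
    have h1 := norm_integral_le_of_le_exp hK (t := t) (τ := τ) (A := K * dist u v)
      (g := fun s => f s (w s • u s) - f s (w s • v s)) (fun s => by
        refine (hLK s _ _).trans ?_
        rw [← smul_sub, norm_smul, Real.norm_of_nonneg (hwp s).le, ← dist_eq_norm]
        have h3 := BoundedContinuousFunction.dist_coe_le_dist (f := u) (g := v) s
        have h4 := hwp s
        calc K * (w s * dist (u s) (v s)) ≤ K * (w s * dist u v) := by gcongr
          _ = _ := by simp only [w]; ring) (by positivity)
    refine h1.trans (le_of_eq ?_)
    simp only [w, NNReal.coe_div, NNReal.coe_one, NNReal.coe_ofNat]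
    field_simp
  obtain ⟨u, hu⟩ : ∃ u, G u = u := ⟨_, hG.fixedPoint_isFixedPt⟩
  have hX : ∀ t, w t • u t = x + ∫ s in τ..t, f s (w s • u s) := by
    intro t
    have : u t = (w t)⁻¹ • (x + ∫ s in τ..t, f s (w s • u s)) := by
      conv_lhs => rw [← hu]
      rfl
    rw [this, smul_inv_smul₀ (hwp t).ne']
  refine ⟨fun t => w t • u t, (hX τ).trans (by simp), fun t => ?_⟩
  have h1 := (intervalIntegral.integral_hasDerivAt_right ((hcont u).intervalIntegrable τ t)
    (hcont u).stronglyMeasurable.stronglyMeasurableAtFilter (hcont u).continuousAt).const_add x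
  exact h1.congr_of_eventuallyEq (Eventually.of_forall hX)

/-- The flow of `Ẋ = f(t, X)`: `flow f τ x t` is the value at time `t` of the solution that equals
`x` at time `τ`. -/
noncomputable def flow (f : ℝ → V → V) (τ : ℝ) (x : V) : ℝ → V :=
  Classical.epsilon fun X => X τ = x ∧ ∀ t, HasDerivAt X (f t (X t)) t

/-- Continuous vector fields that are globally Lipschitz in space and bounded at the origin. -/
structure IsLipField (f : ℝ → V → V) (L C : ℝ) : Prop where
  continuous : Continuous (Function.uncurry f)
  lipschitz : ∀ t x y, ‖f t x - f t y‖ ≤ L * ‖x - y‖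
  bound : ∀ t, ‖f t 0‖ ≤ C
  nonneg : 0 ≤ L

namespace IsLipField

variable {f g : ℝ → V → V} {L C : ℝ}

theorem integral_eq [CompleteSpace V] (hf : IsLipField f L C) {X : ℝ → V}
    (hX : ∀ t, HasDerivAt X (f t (X t)) t) (s t : ℝ) : X t = X s + ∫ r in s..t, f r (X r) := by
  have hXc : Continuous X := continuous_iff_continuousAt.2 fun t => (hX t).continuousAt
  have : Continuous fun r => f r (X r) := hf.continuous.comp (continuous_id.prodMk hXc)
  rw [intervalIntegral.integral_eq_sub_of_hasDerivAt (fun r _ => hX r)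
    (this.intervalIntegrable _ _)]
  abel

/-- Stability of integral curves: `Y` is any continuous curve whose velocity `v` differs from the
field `f` along `Y` by an integrable error. -/
theorem dist_le [CompleteSpace V] (hf : IsLipField f L C) {X Y v : ℝ → V}
    {e : ℝ → ℝ} {τ t c : ℝ} {y : V}
    (hX : ∀ t, HasDerivAt X (f t (X t)) t) (hY : ContinuousOn Y (uIcc τ t))
    (hvi : IntervalIntegrable v volume τ t)
    (hYv : ∀ s ∈ uIcc τ t, Y s = y + ∫ r in τ..s, v r)
    (he : ∀ᵐ s ∂(volume.restrict (uIcc τ t)), ‖f s (Y s) - v s‖ ≤ e s)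
    (hei : IntervalIntegrable e volume τ t)
    (hc : |∫ s in τ..t, ‖e s‖| ≤ c) :
    ‖X t - Y t‖ ≤ (‖X τ - y‖ + c) * Real.exp (2 * (L * |t - τ|)) := by
  have hXc : Continuous X := continuous_iff_continuousAt.2 fun t => (hX t).continuousAt
  have hfX : Continuous fun r => f r (X r) := hf.continuous.comp (continuous_id.prodMk hXc)
  have hc0 : 0 ≤ c := (abs_nonneg _).trans hc
  refine gronwall_const (u := fun s => ‖X s - Y s‖) ((hXc.continuousOn.sub hY).norm)
    (fun _ _ => norm_nonneg _) hf.nonneg (by positivity) fun s hs => ?_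
  have hsub : uIcc τ s ⊆ uIcc τ t := uIcc_subset_uIcc_left hs
  have hvi' : IntervalIntegrable v volume τ s := hvi.mono_set hsub
  have hei' : IntervalIntegrable e volume τ s := hei.mono_set hsub
  have e1 : X s - Y s = (X τ - y) + ∫ r in τ..s, (f r (X r) - v r) := by
    rw [intervalIntegral.integral_sub (hfX.intervalIntegrable _ _) hvi', hYv s hs,
      hf.integral_eq hX τ s]
    abel
  have hgi : IntervalIntegrable (fun r => L * ‖X r - Y r‖) volume τ s :=
    (continuousOn_const.mul ((hXc.continuousOn.sub (hY.mono hsub)).norm)).intervalIntegrable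
  have h2 : ‖∫ r in τ..s, (f r (X r) - v r)‖ ≤ |∫ r in τ..s, (‖e r‖ + L * ‖X r - Y r‖)| := by
    refine intervalIntegral.norm_integral_le_abs_of_norm_le ?_ (hei'.norm.add hgi)
    filter_upwards [ae_restrict_of_ae_restrict_of_subset (uIoc_subset_uIcc.trans hsub) he]
      with r h3
    have h4 := hf.lipschitz r (X r) (Y r)
    calc ‖f r (X r) - v r‖ = ‖(f r (Y r) - v r) + (f r (X r) - f r (Y r))‖ := by congr 1; abel
      _ ≤ ‖f r (Y r) - v r‖ + ‖f r (X r) - f r (Y r)‖ := norm_add_le _ _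
      _ ≤ ‖e r‖ + L * ‖X r - Y r‖ := add_le_add (h3.trans (Real.le_norm_self _)) h4
  rw [intervalIntegral.integral_add hei'.norm hgi] at h2
  have h5 : |∫ r in τ..s, ‖e r‖| ≤ c := by
    refine le_trans ?_ hc
    exact intervalIntegral.abs_integral_mono_interval (uIoc_subset_uIoc_of_uIcc_subset_uIcc hsub)
      (Eventually.of_forall fun _ => norm_nonneg _) hei.norm
  calc ‖X s - Y s‖ ≤ ‖X τ - y‖ + ‖∫ r in τ..s, (f r (X r) - v r)‖ := by
        rw [e1]; exact norm_add_le _ _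
    _ ≤ ‖X τ - y‖ + (|∫ r in τ..s, ‖e r‖| + |∫ r in τ..s, L * ‖X r - Y r‖|) := by
        gcongr; exact h2.trans (abs_add_le _ _)
    _ ≤ _ := by linarith

variable [CompleteSpace V] (hf : IsLipField f L C)
include hf

theorem flow_spec (τ : ℝ) (x : V) :
    flow f τ x τ = x ∧ ∀ t, HasDerivAt (flow f τ x) (f t (flow f τ x t)) t :=
  Classical.epsilon_spec (exists_global_solution hf.continuous hf.lipschitz hf.bound τ x)

theorem flow_self (τ : ℝ) (x : V) : flow f τ x τ = x := (hf.flow_spec τ x).1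

theorem hasDerivAt_flow (τ : ℝ) (x : V) (t : ℝ) :
    HasDerivAt (flow f τ x) (f t (flow f τ x t)) t := (hf.flow_spec τ x).2 t

theorem continuous_flow (τ : ℝ) (x : V) : Continuous (flow f τ x) :=
  continuous_iff_continuousAt.2 fun t => (hf.hasDerivAt_flow τ x t).continuousAt

theorem continuous_velocity (τ : ℝ) (x : V) : Continuous fun t => f t (flow f τ x t) :=
  hf.continuous.comp (continuous_id.prodMk (hf.continuous_flow τ x))

theorem flow_eq_integral (τ : ℝ) (x : V) (s t : ℝ) :
    flow f τ x t = flow f τ x s + ∫ r in s..t, f r (flow f τ x r) :=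
  hf.integral_eq (hf.hasDerivAt_flow τ x) s t

theorem dist_curve_le {X Y : ℝ → V} (hX : ∀ t, HasDerivAt X (f t (X t)) t)
    (hY : ∀ t, HasDerivAt Y (f t (Y t)) t) (τ t : ℝ) :
    ‖X t - Y t‖ ≤ ‖X τ - Y τ‖ * Real.exp (2 * (L * |t - τ|)) := by
  have hYc : Continuous Y := continuous_iff_continuousAt.2 fun t => (hY t).continuousAt
  have := hf.dist_le (X := X) (Y := Y) (v := fun s => f s (Y s)) (e := fun _ => 0) (τ := τ) (t := t)
    (c := 0) (y := Y τ) hX hYc.continuousOn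
    ((hf.continuous.comp (continuous_id.prodMk hYc)).intervalIntegrable _ _)
    (fun s _ => hf.integral_eq hY τ s) (by simp) (by simp) (by simp)
  simpa using this

theorem curve_eq {X Y : ℝ → V} (hX : ∀ t, HasDerivAt X (f t (X t)) t)
    (hY : ∀ t, HasDerivAt Y (f t (Y t)) t) {τ : ℝ} (h : X τ = Y τ) (t : ℝ) : X t = Y t := by
  have := hf.dist_curve_le hX hY τ t
  rw [h, sub_self, norm_zero, zero_mul] at this
  exact sub_eq_zero.1 (norm_le_zero_iff.1 this)

theorem flow_flow (τ s t : ℝ) (x : V) : flow f s (flow f τ x s) t = flow f τ x t :=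
  hf.curve_eq (hf.hasDerivAt_flow _ _) (hf.hasDerivAt_flow _ _) (τ := s) (hf.flow_self _ _) t

theorem dist_flow_le (τ t : ℝ) (x y : V) :
    ‖flow f τ x t - flow f τ y t‖ ≤ ‖x - y‖ * Real.exp (2 * (L * |t - τ|)) := by
  have := hf.dist_curve_le (hf.hasDerivAt_flow τ x) (hf.hasDerivAt_flow τ y) τ t
  rwa [hf.flow_self, hf.flow_self] at this

theorem norm_flow_le (τ t : ℝ) (x : V) :
    ‖flow f τ x t‖ ≤ (‖x‖ + C * |t - τ|) * Real.exp (2 * (L * |t - τ|)) := by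
  have h0 : 0 ≤ C := (norm_nonneg _).trans (hf.bound 0)
  have := hf.dist_le (X := flow f τ x) (Y := fun _ => 0) (v := fun s => 0) (e := fun _ => C)
    (τ := τ) (t := t) (c := C * |t - τ|) (y := 0) (hf.hasDerivAt_flow τ x) continuousOn_const
    (by simp) (by simp) (Eventually.of_forall fun s => by simpa using hf.bound s) (by simp)
    (by simp [abs_mul, abs_of_nonneg h0, mul_comm])
  simpa [hf.flow_self] using this

end IsLipField

end ODE

/-! ### Differentiability of the flow and the adjoint equation -/

section Adjoint

variable {V W : Type*} [NormedAddCommGroup V] [NormedSpace ℝ V]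
  [NormedAddCommGroup W] [NormedSpace ℝ W]

theorem norm_sub_sub_le_of_lipschitz_fderiv {g : V → W} {g' : V → V →L[ℝ] W} {s : Set V}
    (hs : Convex ℝ s) {K : ℝ} (hg : ∀ x ∈ s, HasFDerivAt g (g' x) x)
    (hK : ∀ x ∈ s, ∀ y ∈ s, ‖g' x - g' y‖ ≤ K * ‖x - y‖) {x y : V} (hx : x ∈ s) (hy : y ∈ s) :
    ‖g y - g x - g' x (y - x)‖ ≤ K * ‖y - x‖ ^ 2 := by
  rcases eq_or_ne x y with rfl | hne
  · simp
  have hK0 : 0 ≤ K := by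
    have := (norm_nonneg _).trans (hK x hx y hy)
    exact nonneg_of_mul_nonneg_left this (norm_pos_iff.2 (sub_ne_zero.2 hne))
  have hsub : segment ℝ x y ⊆ s := hs.segment_subset hx hy
  have := (convex_segment x y).norm_image_sub_le_of_norm_hasFDerivWithin_le' (f := g) (f' := g')
    (φ := g' x) (C := K * ‖y - x‖) (fun z hz => (hg z (hsub hz)).hasFDerivWithinAt)
    (fun z hz => (hK z (hsub hz) x hx).trans (by
      gcongr
      exact norm_sub_le_of_mem_segment hz))
    (left_mem_segment ℝ x y) (right_mem_segment ℝ x y)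
  calc _ ≤ K * ‖y - x‖ * ‖y - x‖ := this
    _ = _ := by ring

theorem hasFDerivAt_of_norm_le_sq {g : V → W} {g' : V →L[ℝ] W} {x : V} {K : ℝ}
    (h : ∀ᶠ y in 𝓝 x, ‖g y - g x - g' (y - x)‖ ≤ K * ‖y - x‖ ^ 2) : HasFDerivAt g g' x := by
  have h1 : (fun y => g y - g x - g' (y - x)) =O[𝓝 x] fun y => ‖y - x‖ ^ 2 :=
    Asymptotics.IsBigO.of_bound K (h.mono fun y hy => by simpa using hy)
  have h2 := h1.hasFDerivAt (𝕜 := ℝ) one_lt_two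
  have h3 : HasFDerivAt (fun y => g x + g' (y - x)) g' x :=
    ((g'.hasFDerivAt.comp x ((hasFDerivAt_id x).sub_const x))).const_add _
  have h4 := h2.add h3
  rw [zero_add] at h4
  refine h4.congr_of_eventuallyEq (Eventually.of_forall fun y => ?_)
  simp only [Pi.add_apply]
  abel

/-- Vector fields of class `C¹` in space, with locally Lipschitz differential. -/
structure IsC2Field (f : ℝ → V → V) (Df : ℝ → V → V →L[ℝ] V) (L C : ℝ) (B : ℝ → ℝ) : Prop
    extends IsLipField f L C where
  hasFDerivAt : ∀ t x, HasFDerivAt (f t) (Df t x) x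
  continuous_fderiv : Continuous (Function.uncurry Df)
  lipschitz_fderiv : ∀ R t x y, ‖x‖ ≤ R → ‖y‖ ≤ R → ‖Df t x - Df t y‖ ≤ B R * ‖x - y‖

/-- Functions of class `C¹` with locally Lipschitz and locally bounded differential. -/
structure IsC2Cost (ℓ : V → ℝ) (Λ : ℝ → ℝ) : Prop where
  differentiable : Differentiable ℝ ℓ
  lipschitz_fderiv : ∀ R x y, ‖x‖ ≤ R → ‖y‖ ≤ R → ‖fderiv ℝ ℓ x - fderiv ℝ ℓ y‖ ≤ Λ R * ‖x - y‖
  bound : ∀ R x, ‖x‖ ≤ R → ‖fderiv ℝ ℓ x‖ ≤ Λ R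
  nonneg : ∀ R, 0 ≤ Λ R

/-- A bound for the flow on time intervals of length at most `T`, starting in a ball of radius
`r`. -/
noncomputable def flowRadius (L C T r : ℝ) : ℝ := (r + C * T) * Real.exp (2 * (L * T))

theorem IsLipField.norm_flow_le_radius [CompleteSpace V] {f : ℝ → V → V} {L C : ℝ}
    (hf : IsLipField f L C) {T r t s : ℝ} {x : V} (hx : ‖x‖ ≤ r) (hs : |s - t| ≤ T) :
    ‖flow f t x s‖ ≤ flowRadius L C T r := by
  have h0 : 0 ≤ C := (norm_nonneg _).trans (hf.bound 0)
  have hL := hf.nonneg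
  have hr : 0 ≤ r := (norm_nonneg _).trans hx
  have hT : 0 ≤ T := (abs_nonneg _).trans hs
  refine (hf.norm_flow_le t s x).trans ?_
  unfold flowRadius
  gcongr

theorem abs_sub_le_of_mem_uIcc {t τ s : ℝ} (hs : s ∈ uIcc t τ) : |s - t| ≤ |τ - t| :=
  abs_sub_left_of_mem_uIcc hs

/-- The linear equation satisfied by the costate along the trajectory through `(τ, z)`. -/
noncomputable def costateField (f : ℝ → V → V) (Df : ℝ → V → V →L[ℝ] V) (τ : ℝ) (z : V) :
    ℝ → (V →L[ℝ] ℝ) → (V →L[ℝ] ℝ) := fun s p => -(p.comp (Df s (flow f τ z s)))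

/-- The costate along the trajectory through `(τ, z)`, equal to `∇ℓ(z)` at time `τ`. -/
noncomputable def costate (f : ℝ → V → V) (Df : ℝ → V → V →L[ℝ] V) (ℓ : V → ℝ) (τ : ℝ) (z : V) :
    ℝ → V →L[ℝ] ℝ := flow (costateField f Df τ z) τ (fderiv ℝ ℓ z)

/-- The differential of `w ↦ ℓ(Φ_{(t,τ)}(w))`. -/
noncomputable def adjointGrad (f : ℝ → V → V) (Df : ℝ → V → V →L[ℝ] V) (ℓ : V → ℝ) (τ t : ℝ)
    (w : V) : V →L[ℝ] ℝ := costate f Df ℓ τ (flow f t w τ) t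

namespace IsC2Field

variable {f : ℝ → V → V} {Df : ℝ → V → V →L[ℝ] V} {L C : ℝ} {B : ℝ → ℝ}

theorem norm_fderiv_le (hf : IsC2Field f Df L C B) (t : ℝ) (x : V) : ‖Df t x‖ ≤ L :=
  (hf.hasFDerivAt t x).le_of_lip' hf.nonneg (Eventually.of_forall fun y => hf.lipschitz t y x)

variable [CompleteSpace V] (hf : IsC2Field f Df L C B)
include hf

theorem isLipField_costateField (τ : ℝ) (z : V) :
    IsLipField (costateField f Df τ z) L 0 where
  continuous := by
    have h1 : Continuous fun q : ℝ × (V →L[ℝ] ℝ) => Df q.1 (flow f τ z q.1) :=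
      hf.continuous_fderiv.comp (continuous_fst.prodMk ((hf.continuous_flow τ z).comp
        continuous_fst))
    exact (continuous_snd.clm_comp h1).neg
  lipschitz t p q := by
    have e : costateField f Df τ z t p - costateField f Df τ z t q =
        -((p - q).comp (Df t (flow f τ z t))) := by
      simp only [costateField, ContinuousLinearMap.sub_comp]; abel
    rw [e, norm_neg, mul_comm]
    refine (ContinuousLinearMap.opNorm_comp_le _ _).trans ?_
    gcongr
    exact hf.norm_fderiv_le _ _
  bound t := by simp [costateField]
  nonneg := hf.nonneg

theorem hasDerivAt_costate (ℓ : V → ℝ) (τ : ℝ) (z : V) (s : ℝ) :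
    HasDerivAt (costate f Df ℓ τ z)
      (-((costate f Df ℓ τ z s).comp (Df s (flow f τ z s)))) s :=
  (hf.isLipField_costateField τ z).hasDerivAt_flow _ _ _

theorem costate_self (ℓ : V → ℝ) (τ : ℝ) (z : V) : costate f Df ℓ τ z τ = fderiv ℝ ℓ z :=
  (hf.isLipField_costateField τ z).flow_self _ _

theorem norm_costate_le (ℓ : V → ℝ) (τ : ℝ) (z : V) (s : ℝ) :
    ‖costate f Df ℓ τ z s‖ ≤ ‖fderiv ℝ ℓ z‖ * Real.exp (2 * (L * |s - τ|)) := by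
  have := (hf.isLipField_costateField τ z).norm_flow_le τ s (fderiv ℝ ℓ z)
  rwa [zero_mul, add_zero] at this

/-- The costate is labelled by the terminal point of the characteristic, so along one characteristic
`adjointGrad` is a single solution of a linear equation. This gives its regularity in time along
trajectories. -/
theorem adjointGrad_flow (ℓ : V → ℝ) (τ t s : ℝ) (w : V) :
    adjointGrad f Df ℓ τ s (flow f t w s) = costate f Df ℓ τ (flow f t w τ) s := by
  rw [adjointGrad, hf.flow_flow]

theorem norm_adjointGrad_le {ℓ : V → ℝ} {Λ : ℝ → ℝ} (hℓ : IsC2Cost ℓ Λ) {T r t τ : ℝ} {w : V}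
    (hw : ‖w‖ ≤ r) (hT : |τ - t| ≤ T) :
    ‖adjointGrad f Df ℓ τ t w‖ ≤ Λ (flowRadius L C T r) * Real.exp (2 * (L * T)) := by
  refine (hf.norm_costate_le _ _ _ _).trans ?_
  have := hℓ.bound _ _ (hf.norm_flow_le_radius hw hT)
  have hL := hf.nonneg
  rw [abs_sub_comm]
  have := hℓ.nonneg (flowRadius L C T r)
  gcongr

/-- The differential of the flow is bypassed. With `p` the costate along the trajectory `X` from `w`
and `X'` a nearby trajectory, `p (X' - X)` is constant in time up to a quadratic error, so its value
`p t (w' - w)` at the initial time agrees with its value at `τ`, where `p τ` is the differential of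
`ℓ`. A quadratic remainder estimate identifies the derivative. -/
theorem hasFDerivAt_pullback {ℓ : V → ℝ} {Λ : ℝ → ℝ} (hℓ : IsC2Cost ℓ Λ) (τ t : ℝ) (w : V) :
    HasFDerivAt (fun w => ℓ (flow f t w τ)) (adjointGrad f Df ℓ τ t w) w := by
  set T := |τ - t| with hT
  set r := ‖w‖ + 1 with hr
  set R := flowRadius L C T r with hR
  set X := flow f t w with hX
  set p := costate f Df ℓ τ (X τ) with hp
  set P := Λ R * Real.exp (2 * (L * T)) with hP
  set e := Real.exp (2 * (L * T)) with he
  have hL := hf.nonneg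
  have hXb : ∀ w', ‖w'‖ ≤ r → ∀ s ∈ uIcc t τ, ‖flow f t w' s‖ ≤ R := fun w' hw' s hs =>
    hf.norm_flow_le_radius hw' (abs_sub_le_of_mem_uIcc hs)
  have hB0 : 0 ≤ P := mul_nonneg (hℓ.nonneg _) (Real.exp_pos _).le
  have hw : ‖w‖ ≤ r := by rw [hr]; linarith
  have hpb : ∀ s ∈ uIcc t τ, ‖p s‖ ≤ P := fun s hs => by
    refine (hf.norm_costate_le _ _ _ _).trans ?_
    have h1 := hℓ.bound _ _ (hXb w hw τ right_mem_uIcc)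
    have h2 : |s - τ| ≤ T := by
      rw [hT, abs_sub_comm s]; exact abs_sub_right_of_mem_uIcc hs
    have := hℓ.nonneg R
    rw [hP, he]
    gcongr
  refine hasFDerivAt_of_norm_le_sq (K := Λ R * e ^ 2 + P * (|B R| * e ^ 2) * T) ?_
  have hball : ∀ᶠ w' in 𝓝 w, ‖w'‖ ≤ r := by
    have : ∀ᶠ w' in 𝓝 w, ‖w'‖ < r :=
      continuous_norm.continuousAt.eventually_lt continuousAt_const (by rw [hr]; linarith)
    exact this.mono fun _ h => h.le
  filter_upwards [hball] with w' hw'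
  set X' := flow f t w' with hX'
  have hd : ∀ s ∈ uIcc t τ, ‖X' s - X s‖ ≤ ‖w' - w‖ * e := fun s hs => by
    refine (hf.dist_flow_le t s w' w).trans ?_
    have := abs_sub_le_of_mem_uIcc hs
    rw [he]; gcongr
  -- The terms linear in `X' - X` cancel between the costate equation and the flow; only the Taylor
  -- remainder of `f s` is left.
  have hq : ∀ s, HasDerivAt (fun s => p s (X' s - X s))
      (p s (f s (X' s) - f s (X s) - Df s (X s) (X' s - X s))) s := by
    intro s
    have h1 := (hf.hasDerivAt_costate ℓ τ (X τ) s).clm_apply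
      ((hf.hasDerivAt_flow t w' s).sub (hf.hasDerivAt_flow t w s))
    refine h1.congr_deriv ?_
    simp only [neg_apply, ContinuousLinearMap.comp_apply, map_sub, Pi.sub_apply]
    rw [hf.flow_flow t τ s w]
    ring
  have hqb : ∀ s ∈ uIcc t τ, ‖p s (f s (X' s) - f s (X s) - Df s (X s) (X' s - X s))‖ ≤
      P * (|B R| * (‖w' - w‖ * e) ^ 2) := by
    intro s hs
    refine ((p s).le_opNorm _).trans ?_
    have h1 := norm_sub_sub_le_of_lipschitz_fderiv (convex_closedBall (0 : V) R)
      (g := f s) (g' := Df s) (K := |B R|) (fun x _ => hf.hasFDerivAt s x)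
      (fun x hx y hy => (hf.lipschitz_fderiv R s x y (by simpa using hx) (by simpa using hy)).trans
        (by gcongr; exact le_abs_self _))
      (x := X s) (y := X' s) (by simpa using hXb w hw s hs) (by simpa using hXb w' hw' s hs)
    have h2 := hpb s hs
    have h3 := hd s hs
    calc _ ≤ P * (|B R| * ‖X' s - X s‖ ^ 2) := by gcongr
      _ ≤ _ := by gcongr
  have h1 := (convex_uIcc t τ).norm_image_sub_le_of_norm_hasDerivWithin_le
    (f := fun s => p s (X' s - X s)) (fun s _ => (hq s).hasDerivWithinAt) hqb
    (left_mem_uIcc) (right_mem_uIcc)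
  have h2 := norm_sub_sub_le_of_lipschitz_fderiv (convex_closedBall (0 : V) R)
      (g := ℓ) (g' := fderiv ℝ ℓ) (K := Λ R) (fun x _ => (hℓ.differentiable x).hasFDerivAt)
      (fun x hx y hy => hℓ.lipschitz_fderiv R x y (by simpa using hx) (by simpa using hy))
      (x := X τ) (y := X' τ) (by simpa using hXb w hw τ right_mem_uIcc)
      (by simpa using hXb w' hw' τ right_mem_uIcc)
  have h3 : p τ = fderiv ℝ ℓ (X τ) := hf.costate_self _ _ _
  have h4 : X t = w := hf.flow_self _ _
  have h5 : X' t = w' := hf.flow_self _ _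
  have h6 : adjointGrad f Df ℓ τ t w = p t := rfl
  have h7 := hd τ right_mem_uIcc
  have hΛ := hℓ.nonneg R
  rw [← h3] at h2
  simp only [h4, h5] at h1
  rw [h6]
  calc ‖ℓ (X' τ) - ℓ (X τ) - p t (w' - w)‖
      = ‖(ℓ (X' τ) - ℓ (X τ) - p τ (X' τ - X τ)) + (p τ (X' τ - X τ) - p t (w' - w))‖ := by
        congr 1; ring
    _ ≤ Λ R * ‖X' τ - X τ‖ ^ 2 + P * (|B R| * (‖w' - w‖ * e) ^ 2) * ‖τ - t‖ :=
        (norm_add_le _ _).trans (add_le_add h2 h1)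
    _ ≤ Λ R * (‖w' - w‖ * e) ^ 2 + P * (|B R| * (‖w' - w‖ * e) ^ 2) * ‖τ - t‖ := by gcongr
    _ = _ := by rw [Real.norm_eq_abs, ← hT]; ring

end IsC2Field

/-- Stability of trajectories and costates with respect to the initial point and the field. -/
theorem exists_stability [CompleteSpace V] {ℓ : V → ℝ} {Λ : ℝ → ℝ} (hℓ : IsC2Cost ℓ Λ)
    (L C : ℝ) (B : ℝ → ℝ) (T r : ℝ) : ∃ K, 0 ≤ K ∧
    ∀ (f g : ℝ → V → V) (Df Dg : ℝ → V → V →L[ℝ] V), IsC2Field f Df L C B →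
    IsC2Field g Dg L C B → ∀ (e : ℝ → ℝ) (c t τ : ℝ), |τ - t| ≤ T →
    (∀ s ∈ uIcc t τ, ∀ x, ‖x‖ ≤ flowRadius L C T r →
      ‖f s x - g s x‖ ≤ e s ∧ ‖Df s x - Dg s x‖ ≤ e s) →
    IntervalIntegrable e volume t τ → |∫ s in t..τ, ‖e s‖| ≤ c → ∀ w w' : V, ‖w‖ ≤ r → ‖w'‖ ≤ r →
    (∀ s ∈ uIcc t τ, ‖flow f t w s - flow g t w' s‖ ≤ K * (‖w - w'‖ + c)) ∧
    ‖adjointGrad f Df ℓ τ t w - adjointGrad g Dg ℓ τ t w'‖ ≤ K * (‖w - w'‖ + c) := by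
  set R := flowRadius L C T r with hR
  set E := Real.exp (2 * (L * T)) with hE
  have hE0 : 0 < E := Real.exp_pos _
  have hΛ := hℓ.nonneg R
  set P := Λ R * E with hP
  have hP0 : 0 ≤ P := by positivity
  -- The summands are the mismatch of the terminal values of the costates, the mismatch of `Df`
  -- between the two trajectories, and the difference of the fields. The absolute value of `T`
  -- appears because its nonnegativity is known only once times with `|τ - t| ≤ T` are given.
  set K2 := (Λ R * E + (P * (|B R| * E * |T|) + P)) * E with hK2
  have hK20 : 0 ≤ K2 := by positivity
  refine ⟨E + K2, by positivity, ?_⟩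
  intro f g Df Dg hf hg e c t τ hT he hei hec w w' hw hw'
  have hL := hf.nonneg
  have hc0 : 0 ≤ c := (abs_nonneg _).trans hec
  have hTT : |T| = T := abs_of_nonneg ((abs_nonneg _).trans hT)
  set X := flow f t w with hX
  set Y := flow g t w' with hY
  have hXb : ∀ s ∈ uIcc t τ, ‖X s‖ ≤ R := fun s hs =>
    hf.norm_flow_le_radius hw ((abs_sub_le_of_mem_uIcc hs).trans hT)
  have hYb : ∀ s ∈ uIcc t τ, ‖Y s‖ ≤ R := fun s hs =>
    hg.norm_flow_le_radius hw' ((abs_sub_le_of_mem_uIcc hs).trans hT)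
  have hd : ∀ s ∈ uIcc t τ, ‖X s - Y s‖ ≤ (‖w - w'‖ + c) * E := by
    intro s hs
    have hsub : uIcc t s ⊆ uIcc t τ := uIcc_subset_uIcc_left hs
    have h1 := hf.dist_le (X := X) (Y := Y) (v := fun s => g s (Y s)) (e := e) (τ := t) (t := s)
      (c := c) (y := w') (hf.hasDerivAt_flow t w) (hg.continuous_flow t w').continuousOn
      ((hg.continuous_velocity t w').intervalIntegrable _ _)
      (fun s _ => by
        have := hg.flow_eq_integral t w' t s
        rwa [hg.flow_self] at this)
      ((ae_restrict_iff' measurableSet_uIcc).2 (Eventually.of_forall fun r hr =>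
        (he r (hsub hr) _ (hYb r (hsub hr))).1))
      (hei.mono_set hsub)
      ((intervalIntegral.abs_integral_mono_interval (uIoc_subset_uIoc_of_uIcc_subset_uIcc hsub)
        (Eventually.of_forall fun _ => norm_nonneg _) hei.norm).trans hec)
    have h0 : X t = w := hf.flow_self _ _
    rw [h0] at h1
    refine h1.trans ?_
    have := (abs_sub_le_of_mem_uIcc hs).trans hT
    rw [hE]; gcongr
  constructor
  · intro s hs
    refine (hd s hs).trans ?_
    have : 0 ≤ ‖w - w'‖ + c := by positivity
    nlinarith
  set δ := (‖w - w'‖ + c) * E with hδ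
  have hδ0 : 0 ≤ δ := by positivity
  set p := costate f Df ℓ τ (X τ) with hp
  set q := costate g Dg ℓ τ (Y τ) with hq
  have hqb : ∀ s ∈ uIcc t τ, ‖q s‖ ≤ P := fun s hs => by
    refine (hg.norm_costate_le _ _ _ _).trans ?_
    have h1 := hℓ.bound _ _ (hYb τ right_mem_uIcc)
    have h2 : |s - τ| ≤ T := by
      rw [abs_sub_comm s]; exact (abs_sub_right_of_mem_uIcc hs).trans hT
    rw [hP, hE]
    gcongr
  have hlip := hf.isLipField_costateField τ (X τ)
  have hlipg := hg.isLipField_costateField τ (Y τ)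
  have hsym : uIcc τ t = uIcc t τ := uIcc_comm _ _
  -- The second costate is treated as an approximate solution of the first costate equation. The
  -- error is `q` composed with `Df (X) - Dg (Y)`, which splits into the variation of `Df` from `X`
  -- to `Y`, at most `|B R| δ`, and the difference of the fields along `Y`.
  have h1 := hlip.dist_le (X := p) (Y := q) (v := fun s => costateField g Dg τ (Y τ) s (q s))
    (e := fun s => P * (|B R| * δ + ‖e s‖)) (τ := τ) (t := t)
    (c := P * (|B R| * δ * T + c)) (y := q τ) (hlip.hasDerivAt_flow τ _)
    (hlipg.continuous_flow τ _).continuousOn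
    ((hlipg.continuous_velocity τ _).intervalIntegrable _ _)
    (fun s _ => hlipg.flow_eq_integral τ _ τ s)
    ((ae_restrict_iff' measurableSet_uIcc).2 (Eventually.of_forall fun s hs => by
      rw [hsym] at hs
      simp only [costateField]
      rw [show flow f τ (X τ) s = X s from hf.flow_flow _ _ _ _,
        show flow g τ (Y τ) s = Y s from hg.flow_flow _ _ _ _, ← neg_sub', norm_neg,
        ← ContinuousLinearMap.comp_sub]
      refine (ContinuousLinearMap.opNorm_comp_le _ _).trans ?_
      have h2 := hqb s hs
      have h3 : ‖Df s (X s) - Dg s (Y s)‖ ≤ |B R| * δ + ‖e s‖ := by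
        have h4 := hf.lipschitz_fderiv R s _ _ (hXb s hs) (hYb s hs)
        have h5 := (he s hs _ (hYb s hs)).2
        have h6 := hd s hs
        calc ‖Df s (X s) - Dg s (Y s)‖
            = ‖(Df s (X s) - Df s (Y s)) + (Df s (Y s) - Dg s (Y s))‖ := by congr 1; abel
          _ ≤ B R * ‖X s - Y s‖ + e s := (norm_add_le _ _).trans (add_le_add h4 h5)
          _ ≤ |B R| * δ + ‖e s‖ := by gcongr; exacts [le_abs_self _, Real.le_norm_self _]
      gcongr))
    ((intervalIntegrable_const.add hei.norm.symm).const_mul _) (by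
      have h2 : ∀ s, ‖P * (|B R| * δ + ‖e s‖)‖ = P * (|B R| * δ + ‖e s‖) := fun s =>
        Real.norm_of_nonneg (by positivity)
      simp only [h2]
      rw [intervalIntegral.integral_const_mul, abs_mul, abs_of_nonneg hP0,
        intervalIntegral.integral_add intervalIntegrable_const hei.norm.symm,
        intervalIntegral.integral_const, smul_eq_mul]
      gcongr
      refine (abs_add_le _ _).trans (add_le_add ?_ ?_)
      · rw [abs_mul, abs_of_nonneg (by positivity : 0 ≤ |B R| * δ), mul_comm, abs_sub_comm]
        gcongr
      · rwa [intervalIntegral.integral_symm, abs_neg])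
  have h2 : ‖p τ - q τ‖ ≤ Λ R * δ := by
    rw [hp, hq, hf.costate_self, hg.costate_self]
    refine (hℓ.lipschitz_fderiv R _ _ (hXb τ right_mem_uIcc) (hYb τ right_mem_uIcc)).trans ?_
    gcongr
    exact hd τ right_mem_uIcc
  have h3 : Real.exp (2 * (L * |t - τ|)) ≤ E := by
    rw [hE, abs_sub_comm]; gcongr
  have hT0 : 0 ≤ T := (abs_nonneg _).trans hT
  calc ‖adjointGrad f Df ℓ τ t w - adjointGrad g Dg ℓ τ t w'‖ = ‖p t - q t‖ := rfl
    _ ≤ (‖p τ - q τ‖ + P * (|B R| * δ * T + c)) * Real.exp (2 * (L * |t - τ|)) := h1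
    _ ≤ (Λ R * δ + P * (|B R| * δ * T + c)) * E := by gcongr
    _ ≤ (Λ R * δ + P * (|B R| * δ * T + (‖w - w'‖ + c))) * E := by
        gcongr; linarith [norm_nonneg (w - w')]
    _ = K2 * (‖w - w'‖ + c) := by rw [hK2, hTT, hδ]; ring
    _ ≤ _ := by
        gcongr; linarith

/-! ### Joint regularity in time and space of the pulled-back cost -/

namespace IsC2Field

variable {f : ℝ → V → V} {Df : ℝ → V → V →L[ℝ] V} {L C : ℝ} {B : ℝ → ℝ}
variable [CompleteSpace V] (hf : IsC2Field f Df L C B)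
include hf

/-- At a point `(s, y)` near `(t, w)` the value is compared with that at `(s, X s)`, where `X` is
the trajectory through `(t, w)`. The stability estimate controls the difference by `|y - X s|`, and
on the trajectory the value is one costate, continuous in `s`. -/
theorem continuous_adjointGrad {ℓ : V → ℝ} {Λ : ℝ → ℝ} (hℓ : IsC2Cost ℓ Λ) (τ : ℝ) :
    Continuous fun q : ℝ × V => adjointGrad f Df ℓ τ q.1 q.2 := by
  refine continuous_iff_continuousAt.2 fun ⟨t, w⟩ => ?_
  obtain ⟨K, hK0, hK⟩ := exists_stability hℓ L C B (|τ - t| + 1) (‖w‖ + 1)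
  set X := flow f t w with hX
  have hXc : Continuous X := hf.continuous_flow t w
  have hXt : X t = w := hf.flow_self _ _
  have h1 : Tendsto (fun q : ℝ × V => costate f Df ℓ τ (X τ) q.1) (𝓝 (t, w))
      (𝓝 (adjointGrad f Df ℓ τ t w)) := by
    have : Continuous fun q : ℝ × V => costate f Df ℓ τ (X τ) q.1 :=
      ((hf.isLipField_costateField τ (X τ)).continuous_flow _ _).comp continuous_fst
    exact this.continuousAt
  have h2 : Tendsto (fun q : ℝ × V => K * ‖q.2 - X q.1‖) (𝓝 (t, w)) (𝓝 0) := by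
    have : Continuous fun q : ℝ × V => K * ‖q.2 - X q.1‖ := by fun_prop
    have h := this.tendsto (t, w)
    simpa [hXt] using h
  have hn1 : ∀ᶠ q : ℝ × V in 𝓝 (t, w), ‖q.2‖ < ‖w‖ + 1 :=
    ContinuousAt.eventually_lt (by fun_prop) continuousAt_const (by simp)
  have hn2 : ∀ᶠ q : ℝ × V in 𝓝 (t, w), ‖X q.1‖ < ‖w‖ + 1 :=
    ContinuousAt.eventually_lt (by fun_prop) continuousAt_const (by simp [hXt])
  have hn3 : ∀ᶠ q : ℝ × V in 𝓝 (t, w), |τ - q.1| < |τ - t| + 1 :=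
    ContinuousAt.eventually_lt (by fun_prop) continuousAt_const (by simp)
  have h3 : Tendsto (fun q : ℝ × V => adjointGrad f Df ℓ τ q.1 q.2 -
      costate f Df ℓ τ (X τ) q.1) (𝓝 (t, w)) (𝓝 0) := by
    refine squeeze_zero_norm' ?_ h2
    filter_upwards [hn1, hn2, hn3] with q hq1 hq2 hq3
    have := (hK f f Df Df hf hf (fun _ => 0) 0 q.1 τ hq3.le (by simp) (by simp) (by simp) q.2
      (X q.1) hq1.le hq2.le).2
    rwa [hf.adjointGrad_flow, add_zero] at this
  have := h3.add h1
  simpa [ContinuousAt] using this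

/-- At the base time itself no regularity of the flow is needed: the flow from `(s, y)` to `t` is
`y` plus the integral of the velocity from `s` to `t`, and continuity of `f` makes this `y + (t - s)
f(t, w)` up to a small error. -/
theorem hasFDerivAt_flow_initial (t : ℝ) (w : V) :
    HasFDerivAt (fun q : ℝ × V => flow f q.1 q.2 t)
      (ContinuousLinearMap.snd ℝ ℝ V - (ContinuousLinearMap.fst ℝ ℝ V).smulRight (f t w))
      (t, w) := by
  rw [hasFDerivAt_iff_isLittleO, Asymptotics.isLittleO_iff]
  intro ε hε
  have hfc : ContinuousAt (Function.uncurry f) (t, w) := hf.continuous.continuousAt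
  obtain ⟨δ, hδ, hδf⟩ := Metric.continuousAt_iff.1 hfc ε hε
  set R := flowRadius L C 1 (‖w‖ + 1) with hR
  have hC0 : 0 ≤ C := (norm_nonneg _).trans (hf.bound 0)
  have hL := hf.nonneg
  have hR0 : 0 ≤ R := by unfold R flowRadius; positivity
  set M := C + L * R with hM
  have hM0 : 0 ≤ M := by positivity
  have hn1 : ∀ᶠ q : ℝ × V in 𝓝 (t, w), ‖q.2‖ < ‖w‖ + 1 :=
    ContinuousAt.eventually_lt (by fun_prop) continuousAt_const (by simp)
  have hn2 : ∀ᶠ q : ℝ × V in 𝓝 (t, w), |q.1 - t| < min δ 1 :=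
    ContinuousAt.eventually_lt (by fun_prop) continuousAt_const (by simp [hδ])
  have hn3 : ∀ᶠ q : ℝ × V in 𝓝 (t, w), M * |q.1 - t| + ‖q.2 - w‖ < δ :=
    ContinuousAt.eventually_lt (by fun_prop) continuousAt_const (by simp [hδ])
  filter_upwards [hn1, hn2, hn3] with q hq1 hq2 hq3
  have hsym : uIcc q.1 t = uIcc t q.1 := uIcc_comm _ _
  have hfl : ∀ r ∈ uIcc q.1 t, ‖flow f q.1 q.2 r‖ ≤ R := fun r hr =>
    hf.norm_flow_le_radius hq1.le ((abs_sub_le_of_mem_uIcc hr).trans (by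
      rw [abs_sub_comm]; exact (hq2.trans_le (min_le_right _ _)).le))
  have hv : ∀ r ∈ uIcc q.1 t, ‖f r (flow f q.1 q.2 r)‖ ≤ M := fun r hr => by
    have h1 := hf.lipschitz r (flow f q.1 q.2 r) 0
    have h2 := norm_le_norm_add_norm_sub' (f r (flow f q.1 q.2 r)) (f r 0)
    rw [sub_zero] at h1
    have h3 : L * ‖flow f q.1 q.2 r‖ ≤ L * R := by gcongr; exact hfl r hr
    linarith [hf.bound r]
  have hnear : ∀ r ∈ uIcc q.1 t, ‖flow f q.1 q.2 r - q.2‖ ≤ M * |q.1 - t| := fun r hr => by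
    have h1 := hf.flow_eq_integral q.1 q.2 q.1 r
    rw [hf.flow_self] at h1
    rw [h1, add_sub_cancel_left]
    refine (intervalIntegral.norm_integral_le_of_norm_le_const fun s hs =>
      hv s (uIcc_subset_uIcc_left hr (uIoc_subset_uIcc hs))).trans
        (mul_le_mul_of_nonneg_left ?_ hM0)
    rw [abs_sub_comm q.1]
    exact abs_sub_le_of_mem_uIcc hr
  have hcl : ∀ r ∈ uIcc q.1 t, ‖f r (flow f q.1 q.2 r) - f t w‖ ≤ ε := fun r hr => by
    have h1 : dist (r, flow f q.1 q.2 r) (t, w) < δ := by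
      rw [Prod.dist_eq]
      refine max_lt ?_ ?_
      · rw [Real.dist_eq]
        rw [hsym] at hr
        exact (abs_sub_le_of_mem_uIcc hr).trans_lt (hq2.trans_le (min_le_left _ _))
      · rw [dist_eq_norm]
        calc ‖flow f q.1 q.2 r - w‖ ≤ ‖flow f q.1 q.2 r - q.2‖ + ‖q.2 - w‖ :=
              norm_sub_le_norm_sub_add_norm_sub _ _ _
          _ < δ := by linarith [hnear r hr]
    have := (hδf h1).le
    rwa [dist_eq_norm] at this
  have h1 := hf.flow_eq_integral q.1 q.2 q.1 t
  rw [hf.flow_self] at h1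
  have h2 : flow f q.1 q.2 t - flow f t w t - (ContinuousLinearMap.snd ℝ ℝ V -
      (ContinuousLinearMap.fst ℝ ℝ V).smulRight (f t w)) (q - (t, w)) =
      ∫ r in q.1..t, (f r (flow f q.1 q.2 r) - f t w) := by
    rw [intervalIntegral.integral_sub ((hf.continuous_velocity _ _).intervalIntegrable _ _)
      intervalIntegrable_const, intervalIntegral.integral_const, h1, hf.flow_self]
    simp only [sub_apply, ContinuousLinearMap.coe_snd', Prod.snd_sub,
      ContinuousLinearMap.smulRight_apply, ContinuousLinearMap.coe_fst', Prod.fst_sub, sub_smul]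
    abel
  rw [h2]
  refine (intervalIntegral.norm_integral_le_of_norm_le_const fun r hr =>
    hcl r (uIoc_subset_uIcc hr)).trans ?_
  gcongr
  rw [abs_sub_comm, ← Real.norm_eq_abs]
  exact norm_fst_le (q - (t, w))

/-- Passing through time `t` first, the flow property factors the map as the spatial pullback after
the short flow to `t`, and the chain rule combines the two differentials already known. The
composition with `dx - f dt` is exactly the transport equation. -/
theorem hasFDerivAt_pullback_uncurry {ℓ : V → ℝ} {Λ : ℝ → ℝ} (hℓ : IsC2Cost ℓ Λ) (τ t : ℝ)
    (w : V) : HasFDerivAt (fun q : ℝ × V => ℓ (flow f q.1 q.2 τ))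
      ((adjointGrad f Df ℓ τ t w).comp
        (ContinuousLinearMap.snd ℝ ℝ V - (ContinuousLinearMap.fst ℝ ℝ V).smulRight (f t w)))
      (t, w) := by
  have h1 := hf.hasFDerivAt_pullback hℓ τ t w
  rw [← hf.flow_self t w] at h1
  have h2 := HasFDerivAt.comp (t, w) (g := fun w => ℓ (flow f t w τ)) (by exact h1)
    (hf.hasFDerivAt_flow_initial t w)
  rw [hf.flow_self] at h2
  refine h2.congr_of_eventuallyEq (Eventually.of_forall fun q => ?_)
  simp only [Function.comp, hf.flow_flow]

theorem contDiff_pullback {ℓ : V → ℝ} {Λ : ℝ → ℝ} (hℓ : IsC2Cost ℓ Λ) (τ : ℝ) :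
    ContDiff ℝ 1 (fun q : ℝ × V => ℓ (flow f q.1 q.2 τ)) := by
  refine contDiff_one_iff_hasFDerivAt.2 ⟨_, ?_, fun q =>
    hf.hasFDerivAt_pullback_uncurry hℓ τ q.1 q.2⟩
  refine (hf.continuous_adjointGrad hℓ τ).clm_comp (continuous_const.sub ?_)
  have : Continuous fun q : ℝ × V => f q.1 q.2 := hf.continuous
  exact ((ContinuousLinearMap.smulRightL ℝ (ℝ × V) V
    (ContinuousLinearMap.fst ℝ ℝ V)).continuous.comp this)

theorem pullback_eq_integral {ℓ : V → ℝ} {Λ : ℝ → ℝ} (hℓ : IsC2Cost ℓ Λ) (τ t : ℝ) (w : V) :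
    ℓ (flow f t w τ) = ℓ w + ∫ s in t..τ, adjointGrad f Df ℓ τ s w (f s w) := by
  have h1 : ∀ s, HasDerivAt (fun s => ℓ (flow f s w τ)) (-adjointGrad f Df ℓ τ s w (f s w)) s := by
    intro s
    have h2 := (hf.hasFDerivAt_pullback_uncurry hℓ τ s w).comp_hasDerivAt s
      ((hasDerivAt_id s).prodMk (hasDerivAt_const s w))
    refine h2.congr_deriv ?_
    simp
  have hc : Continuous fun s => adjointGrad f Df ℓ τ s w (f s w) :=
    ((hf.continuous_adjointGrad hℓ τ).comp (continuous_id.prodMk continuous_const)).clm_apply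
      (hf.continuous.comp (continuous_id.prodMk continuous_const))
  have h3 := intervalIntegral.integral_eq_sub_of_hasDerivAt (a := t) (b := τ) (fun s _ => h1 s)
    (hc.neg.intervalIntegrable _ _)
  rw [intervalIntegral.integral_neg, hf.flow_self] at h3
  linarith

end IsC2Field

end Adjoint

/-! ### The Wasserstein distance and integrals -/

theorem norm_sub_le_sqrt (p q : E d × E d) :
    ‖p - q‖ ≤ Real.sqrt (‖p.1 - q.1‖ ^ 2 + ‖p.2 - q.2‖ ^ 2) := by
  rw [Prod.norm_def]
  refine max_le ?_ ?_
  · exact Real.le_sqrt_of_sq_le (by simp)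
  · exact Real.le_sqrt_of_sq_le (by simp)

/-- Each coupling gives the bound; then the infimum is taken. The slack `ε` lets one statement serve
Lipschitz integrands (`ε = 0`) and uniformly continuous bounded ones. -/
theorem norm_integral_sub_le_W1 {H : Type*} [NormedAddCommGroup H] [NormedSpace ℝ H]
    {μ ν : Measure (E d × E d)} [IsProbabilityMeasure μ]
    {g : E d × E d → H} {A : Set (E d × E d)} (hμA : μ Aᶜ = 0)
    (hνA : ν Aᶜ = 0) (hgμ : Integrable g μ) (hgν : Integrable g ν) {ε κ : ℝ}
    (hκ : 0 < κ) (hg : ∀ p ∈ A, ∀ q ∈ A, ‖g p - g q‖ ≤ ε + κ * ‖p - q‖) :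
    ENNReal.ofReal ‖∫ z, g z ∂μ - ∫ z, g z ∂ν‖ ≤
      ENNReal.ofReal ε + ENNReal.ofReal κ * W1 μ ν := by
  unfold W1
  -- Positivity of `κ` matters: an infimum over an empty family of couplings is `∞`, and `0 * ∞ = 0`
  -- would break the exchange of product and infimum.
  have hκ0 : ENNReal.ofReal κ ≠ 0 := by simpa using hκ
  rw [ENNReal.mul_iInf_of_ne hκ0 ENNReal.ofReal_ne_top, ENNReal.add_iInf]
  refine le_iInf fun π => ?_
  rw [ENNReal.mul_iInf_of_ne hκ0 ENNReal.ofReal_ne_top, ENNReal.add_iInf]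
  refine le_iInf fun h1 => ?_
  rw [ENNReal.mul_iInf_of_ne hκ0 ENNReal.ofReal_ne_top, ENNReal.add_iInf]
  refine le_iInf fun h2 => ?_
  -- The definition of `W1` does not ask `π` to be a probability measure; its mass is that of its
  -- marginal.
  have hπ : π univ = 1 := by
    have := congrArg (fun ρ => ρ univ) h1
    simpa [Measure.map_apply measurable_fst MeasurableSet.univ] using this
  have i1 : Integrable (fun p : (E d × E d) × (E d × E d) => g p.1) π := by
    rw [← h1] at hgμ
    exact (integrable_map_measure hgμ.aestronglyMeasurable measurable_fst.aemeasurable).1 hgμ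
  have i2 : Integrable (fun p : (E d × E d) × (E d × E d) => g p.2) π := by
    rw [← h2] at hgν
    exact (integrable_map_measure hgν.aestronglyMeasurable measurable_snd.aemeasurable).1 hgν
  have e1 : ∫ z, g z ∂μ = ∫ p, g p.1 ∂π := by
    rw [← h1] at hgμ ⊢
    exact integral_map measurable_fst.aemeasurable hgμ.aestronglyMeasurable
  have e2 : ∫ z, g z ∂ν = ∫ p, g p.2 ∂π := by
    rw [← h2] at hgν ⊢
    exact integral_map measurable_snd.aemeasurable hgν.aestronglyMeasurable
  have a1 : ∀ᵐ p ∂π, p.1 ∈ A := by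
    have : ∀ᵐ z ∂(π.map Prod.fst), z ∈ A := by rw [h1]; exact hμA
    exact ae_of_ae_map measurable_fst.aemeasurable this
  have a2 : ∀ᵐ p ∂π, p.2 ∈ A := by
    have : ∀ᵐ z ∂(π.map Prod.snd), z ∈ A := by rw [h2]; exact hνA
    exact ae_of_ae_map measurable_snd.aemeasurable this
  rw [e1, e2, ← integral_sub i1 i2]
  calc ENNReal.ofReal ‖∫ p, (g p.1 - g p.2) ∂π‖ ≤ ∫⁻ p, ENNReal.ofReal ‖g p.1 - g p.2‖ ∂π := by
        simpa only [ofReal_norm] using enorm_integral_le_lintegral_enorm _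
    _ ≤ ∫⁻ p, (ENNReal.ofReal ε + ENNReal.ofReal κ *
          ENNReal.ofReal (Real.sqrt (‖p.1.1 - p.2.1‖ ^ 2 + ‖p.1.2 - p.2.2‖ ^ 2))) ∂π := by
        refine lintegral_mono_ae ?_
        filter_upwards [a1, a2] with p hp1 hp2
        rw [← ENNReal.ofReal_mul hκ.le]
        refine le_trans (ENNReal.ofReal_le_ofReal ?_) ENNReal.ofReal_add_le
        refine (hg _ hp1 _ hp2).trans ?_
        gcongr
        exact norm_sub_le_sqrt _ _
    _ = _ := by
        rw [lintegral_add_left measurable_const, lintegral_const, hπ, mul_one,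
          lintegral_const_mul _ (by fun_prop)]

/-- The image of `μ` under `(φ, χ)` is a coupling. The product carries the maximum norm whereas `W1`
uses the Euclidean one, and the factor 2 covers the ratio `√2`. -/
theorem W1_map_le {X : Type*} [MeasurableSpace X] (μ : Measure X) [IsProbabilityMeasure μ]
    {φ χ : X → E d × E d} (hφ : Measurable φ) (hχ : Measurable χ) {δ : ℝ}
    (h : ∀ᵐ x ∂μ, ‖φ x - χ x‖ ≤ δ) : W1 (μ.map φ) (μ.map χ) ≤ ENNReal.ofReal (2 * δ) := by
  unfold W1
  refine (iInf_le _ (μ.map fun x => (φ x, χ x))).trans ?_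
  refine (iInf_le _ (by rw [Measure.map_map measurable_fst (hφ.prodMk hχ)]; rfl)).trans ?_
  refine (iInf_le _ (by rw [Measure.map_map measurable_snd (hφ.prodMk hχ)]; rfl)).trans ?_
  rw [lintegral_map (by fun_prop) (hφ.prodMk hχ)]
  calc _ ≤ ∫⁻ _, ENNReal.ofReal (2 * δ) ∂μ := by
        refine lintegral_mono_ae ?_
        filter_upwards [h] with x hx
        refine ENNReal.ofReal_le_ofReal ?_
        have h0 : 0 ≤ δ := (norm_nonneg _).trans hx
        have h1 : ‖(φ x).1 - (χ x).1‖ ≤ δ := (norm_fst_le (φ x - χ x)).trans hx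
        have h2 : ‖(φ x).2 - (χ x).2‖ ≤ δ := (norm_snd_le (φ x - χ x)).trans hx
        refine Real.sqrt_le_iff.2 ⟨by positivity, ?_⟩
        nlinarith [norm_nonneg ((φ x).1 - (χ x).1), norm_nonneg ((φ x).2 - (χ x).2)]
    _ = _ := by simp

theorem tendsto_integral_of_tendsto_W1 {ι : Type*} {l : Filter ι} {μ : ι → Measure (E d × E d)}
    {ν : Measure (E d × E d)} [IsProbabilityMeasure ν] (hμ : ∀ᶠ i in l, IsProbabilityMeasure (μ i))
    (h : Tendsto (fun i => W1 (μ i) ν) l (𝓝 0)) {g : E d × E d → ℝ}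
    (hg : UniformContinuous g) {M : ℝ} (hM : ∀ z, |g z| ≤ M) :
    Tendsto (fun i => ∫ z, g z ∂(μ i)) l (𝓝 (∫ z, g z ∂ν)) := by
  have hM0 : 0 ≤ M := (abs_nonneg _).trans (hM 0)
  have hint : ∀ ρ : Measure (E d × E d), IsProbabilityMeasure ρ → Integrable g ρ := fun ρ _ =>
    Integrable.of_bound hg.continuous.aestronglyMeasurable M (Eventually.of_forall hM)
  rw [Metric.tendsto_nhds]
  intro ε hε
  obtain ⟨δ, hδ, hδg⟩ := Metric.uniformContinuous_iff.1 hg (ε / 3) (by positivity)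
  -- At distance at least `δ` the oscillation `2M` is below `κ δ`; at smaller distance it is below
  -- `ε / 3`. The extra 1 keeps `κ` positive.
  set κ := (2 * M + 1) / δ with hκ
  have hκ0 : 0 < κ := by positivity
  have hosc : ∀ p ∈ univ, ∀ q ∈ univ, ‖g p - g q‖ ≤ ε / 3 + κ * ‖p - q‖ := by
    intro p _ q _
    rcases lt_or_ge (dist p q) δ with hpq | hpq
    · have := (hδg hpq).le
      rw [dist_eq_norm] at this
      have h2 : 0 ≤ κ * ‖p - q‖ := by positivity
      linarith
    · rw [dist_eq_norm] at hpq
      have h1 : κ * δ ≤ κ * ‖p - q‖ := by gcongr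
      have h2 : κ * δ = 2 * M + 1 := by rw [hκ]; field_simp
      have h3 := abs_sub (g p) (g q)
      have := hM p
      have := hM q
      rw [Real.norm_eq_abs]
      linarith
  have hev : ∀ᶠ i in l, W1 (μ i) ν < ENNReal.ofReal (ε / (3 * κ)) :=
    h.eventually_lt_const (by simpa using by positivity)
  filter_upwards [hμ, hev] with i hi hi2
  have h1 := norm_integral_sub_le_W1 (μ := μ i) (ν := ν) (A := univ) (by simp) (by simp)
    (hint _ hi) (hint _ inferInstance) hκ0 hosc
  have h2 : ENNReal.ofReal ‖∫ z, g z ∂(μ i) - ∫ z, g z ∂ν‖ ≤ ENNReal.ofReal (2 * ε / 3) := by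
    refine h1.trans ?_
    calc _ ≤ ENNReal.ofReal (ε / 3) + ENNReal.ofReal κ * ENNReal.ofReal (ε / (3 * κ)) := by
          gcongr
      _ = _ := by
          rw [← ENNReal.ofReal_mul hκ0.le, ← ENNReal.ofReal_add (by positivity) (by positivity)]
          congr 1; field_simp; ring
  rw [ENNReal.ofReal_le_ofReal_iff (by positivity)] at h2
  rw [dist_eq_norm]
  linarith

/-- Continuity of `(t, ϑ) ↦ ∫ g(t, ϑ, z) dμ_t(z)` for a `W₁`-continuous curve. -/
theorem continuousOn_integral_curve {T : ℝ} {μ : ℝ → Measure (E d × E d)}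
    (hμ : ∀ t ∈ Icc 0 T, IsProbabilityMeasure (μ t))
    (hc : ∀ t ∈ Icc 0 T, Tendsto (fun s => W1 (μ s) (μ t)) (𝓝[Icc 0 T] t) (𝓝 0))
    {P : Type*} [TopologicalSpace P] {g : ℝ × P → E d × E d → ℝ}
    (hg : Continuous (Function.uncurry g)) {Q : Set (E d × E d)} (hQ : IsCompact Q)
    (hgQ : ∀ t ∈ Icc 0 T, ∀ ϑ, ∀ z ∉ Q, g (t, ϑ) z = 0) :
    ContinuousOn (fun q : ℝ × P => ∫ z, g q z ∂(μ q.1)) (Icc 0 T ×ˢ univ) := by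
  rintro ⟨t, ϑ⟩ ⟨ht, -⟩
  simp only at ht
  have hsec : ∀ q, Continuous (g q) := fun q => hg.comp (continuous_const.prodMk continuous_id)
  have hcomp : ∀ s ∈ Icc 0 T, ∀ ϑ, HasCompactSupport (g (s, ϑ)) := fun s hs ϑ =>
    HasCompactSupport.intro hQ fun z hz => hgQ s hs ϑ z hz
  have hint : ∀ s ∈ Icc 0 T, ∀ s' ∈ Icc 0 T, ∀ ϑ, Integrable (g (s, ϑ)) (μ s') :=
    fun s hs s' hs' ϑ => by
      have := hμ s' hs'
      exact (hsec _).integrable_of_hasCompactSupport (hcomp s hs ϑ)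
  have hprob := hμ t ht
  obtain ⟨M, hM⟩ := (hsec (t, ϑ)).bounded_above_of_compact_support (hcomp t ht ϑ)
  have hfst : Tendsto (fun q : ℝ × P => q.1) (𝓝[Icc 0 T ×ˢ univ] (t, ϑ)) (𝓝[Icc 0 T] t) :=
    tendsto_nhdsWithin_iff.2 ⟨continuous_fst.continuousAt.mono_left nhdsWithin_le_nhds,
      eventually_mem_nhdsWithin.mono fun q hq => hq.1⟩
  have h1 : Tendsto (fun q : ℝ × P => ∫ z, g (t, ϑ) z ∂(μ q.1)) (𝓝[Icc 0 T ×ˢ univ] (t, ϑ))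
      (𝓝 (∫ z, g (t, ϑ) z ∂(μ t))) :=
    (tendsto_integral_of_tendsto_W1 (eventually_mem_nhdsWithin.mono fun s hs => hμ s hs)
      (hc t ht) ((hcomp t ht ϑ).uniformContinuous_of_continuous (hsec _)) hM).comp hfst
  have h2 : Tendsto (fun q : ℝ × P => ∫ z, g q z ∂(μ q.1) - ∫ z, g (t, ϑ) z ∂(μ q.1))
      (𝓝[Icc 0 T ×ˢ univ] (t, ϑ)) (𝓝 0) := by
    rw [Metric.tendsto_nhds]
    intro ε hε
    -- Compactness of `Q` makes the convergence uniform in `z`, so it survives integration against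
    -- the moving measure; the motion of the measure under a frozen integrand was treated in `h1`.
    have hev : ∀ᶠ q in 𝓝 (t, ϑ), ∀ z ∈ Q, |g q z - g (t, ϑ) z| < ε / 2 := by
      refine hQ.eventually_forall_of_forall_eventually fun z _ => ?_
      have : Continuous fun p : (ℝ × P) × (E d × E d) => |g p.1 p.2 - g (t, ϑ) p.2| :=
        (hg.sub ((hsec _).comp continuous_snd)).abs
      exact this.continuousAt.eventually_lt continuousAt_const (by simpa using by positivity)
    filter_upwards [nhdsWithin_le_nhds hev, eventually_mem_nhdsWithin] with q hq hqT
    have hp := hμ q.1 hqT.1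
    rw [dist_zero_right, ← integral_sub (hint q.1 hqT.1 q.1 hqT.1 q.2) (hint t ht q.1 hqT.1 ϑ)]
    refine (norm_integral_le_of_norm_le_const (C := ε / 2)
      (Eventually.of_forall fun z => ?_)).trans_lt ?_
    · by_cases hz : z ∈ Q
      · exact (hq z hz).le
      · rw [hgQ q.1 hqT.1 q.2 z hz, hgQ t ht ϑ z hz]; simpa using by positivity
    · simp; linarith
  have := h2.add h1
  simpa [ContinuousWithinAt] using this

/-! ### The fundamental lemma of the calculus of variations in one variable -/

theorem deriv_smoothTransition_nonneg (x : ℝ) : 0 ≤ deriv Real.smoothTransition x :=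
  Real.smoothTransition.monotone.deriv_nonneg

theorem deriv_smoothTransition_eq_zero {x : ℝ} (hx : x < 0 ∨ 1 < x) :
    deriv Real.smoothTransition x = 0 := by
  rcases hx with hx | hx
  · have : Real.smoothTransition =ᶠ[𝓝 x] fun _ => 0 := by
      filter_upwards [eventually_lt_nhds hx] with y hy
      exact Real.smoothTransition.zero_of_nonpos hy.le
    rw [this.deriv_eq, deriv_const]
  · have : Real.smoothTransition =ᶠ[𝓝 x] fun _ => 1 := by
      filter_upwards [eventually_gt_nhds hx] with y hy
      exact Real.smoothTransition.one_of_one_le hy.le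
    rw [this.deriv_eq, deriv_const]

theorem continuous_deriv_smoothTransition : Continuous (deriv Real.smoothTransition) :=
  (Real.smoothTransition.contDiff (n := 1)).continuous_deriv (by norm_num)

theorem hasDerivAt_smoothTransition_div (a ε t : ℝ) :
    HasDerivAt (fun t => Real.smoothTransition ((t - a) / ε))
      (deriv Real.smoothTransition ((t - a) / ε) / ε) t := by
  have h1 : DifferentiableAt ℝ Real.smoothTransition ((t - a) / ε) :=
    (Real.smoothTransition.contDiff (n := 1)).differentiable (by norm_num) _
  have h2 := h1.hasDerivAt.comp t (((hasDerivAt_id t).sub_const a).div_const ε)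
  exact h2.congr_deriv (by ring)

/-- The rescaled derivative is nonnegative, has mass one and vanishes outside `[a, a + ε]`: it is a
one-sided approximation of the Dirac mass at `a`. -/
theorem tendsto_integral_deriv_smoothTransition {h : ℝ → ℝ} {T a : ℝ} (ha : a ∈ Ioo 0 T)
    (hh : ContinuousOn h (Icc 0 T)) :
    Tendsto (fun ε => ∫ t in (0 : ℝ)..T, deriv Real.smoothTransition ((t - a) / ε) / ε * h t)
      (𝓝[>] 0) (𝓝 (h a)) := by
  rw [Metric.tendsto_nhds]
  intro δ hδ
  have hat : ContinuousAt h a := hh.continuousAt (Icc_mem_nhds ha.1 ha.2)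
  obtain ⟨r, hr, hrh⟩ := Metric.continuousAt_iff.1 hat (δ / 2) (by positivity)
  have hT : 0 < T := ha.1.trans ha.2
  filter_upwards [Ioo_mem_nhdsGT (lt_min hr (sub_pos.2 ha.2))] with ε hε
  have hε0 := hε.1
  have hε1 : ε < r := hε.2.trans_le (min_le_left _ _)
  have hε2 : ε < T - a := hε.2.trans_le (min_le_right _ _)
  set ρ : ℝ → ℝ := fun t => deriv Real.smoothTransition ((t - a) / ε) / ε with hρ
  have hρc : Continuous ρ :=
    (continuous_deriv_smoothTransition.comp (by fun_prop)).div_const ε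
  have hρ0 : ∀ t, 0 ≤ ρ t := fun t => div_nonneg (deriv_smoothTransition_nonneg _) hε0.le
  have hρ1 : ∫ t in (0 : ℝ)..T, ρ t = 1 := by
    rw [intervalIntegral.integral_eq_sub_of_hasDerivAt
      (fun t _ => hasDerivAt_smoothTransition_div a ε t) (hρc.intervalIntegrable _ _),
      Real.smoothTransition.one_of_one_le, Real.smoothTransition.zero_of_nonpos, sub_zero]
    · exact div_nonpos_of_nonpos_of_nonneg (by linarith [ha.1]) hε0.le
    · rw [le_div_iff₀ hε0]; linarith
  have hi : IntervalIntegrable (fun t => ρ t * h t) volume 0 T := by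
    refine (hρc.continuousOn.mul ?_).intervalIntegrable
    rwa [uIcc_of_le hT.le]
  have e : (∫ t in (0 : ℝ)..T, ρ t * h t) - h a = ∫ t in (0 : ℝ)..T, (ρ t * h t - ρ t * h a) := by
    have hi2 : IntervalIntegrable (fun t => ρ t * h a) volume 0 T :=
      (hρc.mul continuous_const).intervalIntegrable _ _
    rw [intervalIntegral.integral_sub hi hi2, intervalIntegral.integral_mul_const, hρ1, one_mul]
  rw [Real.dist_eq, e, ← Real.norm_eq_abs]
  have h1 := intervalIntegral.norm_integral_le_of_norm_le (a := 0) (b := T) (μ := volume)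
    (f := fun t => ρ t * h t - ρ t * h a) (g := fun t => ρ t * (δ / 2)) hT.le
    (Eventually.of_forall fun t _ => ?_) ((hρc.mul continuous_const).intervalIntegrable _ _)
  · rw [intervalIntegral.integral_mul_const, hρ1, one_mul] at h1
    exact h1.trans_lt (by linarith)
  · rw [← mul_sub, norm_mul, Real.norm_of_nonneg (hρ0 t)]
    by_cases htr : dist t a < r
    · have := (hrh htr).le
      rw [dist_eq_norm] at this
      have := hρ0 t
      gcongr
    · have : ρ t = 0 := by
        rw [hρ]; simp only
        rw [deriv_smoothTransition_eq_zero, zero_div]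
        rw [not_lt, Real.dist_eq] at htr
        rcases le_abs.1 htr with h2 | h2
        · right; rw [lt_div_iff₀ hε0]; linarith
        · left; exact div_neg_of_neg_of_pos (by linarith) hε0
      simp [this]

theorem tendsto_integral_smoothTransition {k : ℝ → ℝ} {T a : ℝ} (ha : a ∈ Ioo 0 T)
    (hk : IntervalIntegrable k volume 0 T) :
    Tendsto (fun ε => ∫ t in (0 : ℝ)..T, Real.smoothTransition ((t - a) / ε) * k t)
      (𝓝[>] 0) (𝓝 (∫ t in a..T, k t)) := by
  have hT : 0 < T := ha.1.trans ha.2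
  have haI : a ∈ uIcc 0 T := by rw [uIcc_of_le hT.le]; exact ⟨ha.1.le, ha.2.le⟩
  have hcont : ∀ ε : ℝ, Continuous fun t => Real.smoothTransition ((t - a) / ε) := fun ε =>
    Real.smoothTransition.continuous.comp (by fun_prop)
  have hi : ∀ ε : ℝ, IntervalIntegrable (fun t => Real.smoothTransition ((t - a) / ε) * k t)
      volume 0 T := fun ε => hk.continuousOn_mul (hcont ε).continuousOn
  have h1 : Tendsto (fun ε => ∫ t in a..T, Real.smoothTransition ((t - a) / ε) * k t)
      (𝓝[>] 0) (𝓝 (∫ t in a..T, k t)) := by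
    have hka : IntervalIntegrable k volume a T := hk.mono_set (uIcc_subset_uIcc_right haI)
    refine intervalIntegral.tendsto_integral_filter_of_dominated_convergence (fun t => ‖k t‖)
      (Eventually.of_forall fun ε => ?_) (Eventually.of_forall fun ε => ?_) hka.norm ?_
    · exact (((hi ε).mono_set (uIcc_subset_uIcc_right haI)).aestronglyMeasurable_restrict_uIoc)
    · refine Eventually.of_forall fun t _ => ?_
      rw [norm_mul, Real.norm_of_nonneg (Real.smoothTransition.nonneg _)]
      exact mul_le_of_le_one_left (norm_nonneg _) (Real.smoothTransition.le_one _)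
    · refine Eventually.of_forall fun t ht => ?_
      rw [uIoc_of_le ha.2.le] at ht
      refine tendsto_const_nhds.congr' ?_
      filter_upwards [Ioo_mem_nhdsGT (sub_pos.2 ht.1)] with ε hε
      rw [Real.smoothTransition.one_of_one_le, one_mul]
      rw [le_div_iff₀ hε.1]; linarith [hε.2]
  refine h1.congr' ?_
  filter_upwards [self_mem_nhdsWithin] with ε hε
  rw [← intervalIntegral.integral_add_adjacent_intervals
    ((hi ε).mono_set (uIcc_subset_uIcc_left haI)) ((hi ε).mono_set (uIcc_subset_uIcc_right haI)),
    intervalIntegral.integral_congr (g := fun _ => (0 : ℝ)) (a := 0) (b := a)]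
  · simp
  · intro t ht
    rw [uIcc_of_le ha.1.le] at ht
    simp only
    rw [Real.smoothTransition.zero_of_nonpos, zero_mul]
    exact div_nonpos_of_nonpos_of_nonneg (by linarith [ht.2]) (le_of_lt hε)

/-- The test functions are smoothed indicators of `[a, b]`, differences of two rescaled transitions;
as `ε → 0` their derivatives tend to the difference of the Dirac masses at `a` and `b`. Continuity
of `h` turns the result into an identity at every interior time and then extends it to the end
points. -/
theorem sub_eq_integral_of_weak {h k : ℝ → ℝ} {T : ℝ} (hT : 0 < T)
    (hh : ContinuousOn h (Icc 0 T)) (hk : IntervalIntegrable k volume 0 T)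
    (hw : ∀ η : ℝ → ℝ, ContDiff ℝ 1 η → (∃ a b, 0 < a ∧ b < T ∧ ∀ t ∉ Icc a b, η t = 0) →
      ∫ t in (0 : ℝ)..T, (deriv η t * h t + η t * k t) = 0) :
    ∀ s ∈ Icc 0 T, ∀ t ∈ Icc 0 T, h t - h s = ∫ r in s..t, k r := by
  have huI : uIcc 0 T = Icc 0 T := uIcc_of_le hT.le
  have hsub : ∀ s ∈ Icc 0 T, ∀ t ∈ Icc 0 T, IntervalIntegrable k volume s t := fun s hs t ht =>
    hk.mono_set (uIcc_subset_uIcc (by rwa [huI]) (by rwa [huI]))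
  have h0I : (0 : ℝ) ∈ Icc 0 T := ⟨le_rfl, hT.le⟩
  have hTI : T ∈ Icc 0 T := ⟨hT.le, le_rfl⟩
  have hin : ∀ a b, a ∈ Ioo 0 T → b ∈ Ioo 0 T → a ≤ b → h b - h a = ∫ r in a..b, k r := by
    intro a b ha hb hab
    have haI := Ioo_subset_Icc_self ha
    have hbI := Ioo_subset_Icc_self hb
    have hlim := ((tendsto_integral_deriv_smoothTransition ha hh).sub
      (tendsto_integral_deriv_smoothTransition hb hh)).add
      ((tendsto_integral_smoothTransition ha hk).sub (tendsto_integral_smoothTransition hb hk))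
    have hzero : (h a - h b) + ((∫ t in a..T, k t) - ∫ t in b..T, k t) = 0 := by
      refine tendsto_nhds_unique hlim (tendsto_const_nhds.congr' ?_)
      filter_upwards [Ioo_mem_nhdsGT (sub_pos.2 hb.2)] with ε hε
      have hε0 := hε.1
      have hd : ∀ t, HasDerivAt (fun t => Real.smoothTransition ((t - a) / ε) -
          Real.smoothTransition ((t - b) / ε)) (deriv Real.smoothTransition ((t - a) / ε) / ε -
          deriv Real.smoothTransition ((t - b) / ε) / ε) t := fun t =>
        (hasDerivAt_smoothTransition_div a ε t).sub (hasDerivAt_smoothTransition_div b ε t)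
      have := hw (fun t => Real.smoothTransition ((t - a) / ε) -
          Real.smoothTransition ((t - b) / ε)) ?_ ⟨a, b + ε, ha.1, by linarith [hε.2], ?_⟩
      · refine this.symm.trans ?_
        have hc : ∀ a, Continuous fun t => deriv Real.smoothTransition ((t - a) / ε) / ε := fun a =>
          (continuous_deriv_smoothTransition.comp (by fun_prop)).div_const ε
        have hc' : ∀ a, Continuous fun t => Real.smoothTransition ((t - a) / ε) := fun a =>
          Real.smoothTransition.continuous.comp (by fun_prop)
        have i1 : ∀ a, IntervalIntegrable
            (fun t => deriv Real.smoothTransition ((t - a) / ε) / ε * h t) volume 0 T := fun a => by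
          refine ((hc a).continuousOn.mul ?_).intervalIntegrable
          rwa [uIcc_of_le hT.le]
        have i2 : ∀ a, IntervalIntegrable
            (fun t => Real.smoothTransition ((t - a) / ε) * k t) volume 0 T := fun a =>
          hk.continuousOn_mul (hc' a).continuousOn
        rw [← intervalIntegral.integral_sub (i1 a) (i1 b),
          ← intervalIntegral.integral_sub (i2 a) (i2 b),
          ← intervalIntegral.integral_add ((i1 a).sub (i1 b)) ((i2 a).sub (i2 b))]
        refine intervalIntegral.integral_congr fun t _ => ?_
        rw [(hd t).deriv]
        ring
      · have hS : ContDiff ℝ 1 Real.smoothTransition := Real.smoothTransition.contDiff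
        exact (hS.comp (by fun_prop)).sub (hS.comp (by fun_prop))
      · intro t ht
        rw [mem_Icc, not_and_or, not_le, not_le] at ht
        rcases ht with ht | ht
        · rw [Real.smoothTransition.zero_of_nonpos, Real.smoothTransition.zero_of_nonpos, sub_zero]
          · exact div_nonpos_of_nonpos_of_nonneg (by linarith) hε0.le
          · exact div_nonpos_of_nonpos_of_nonneg (by linarith) hε0.le
        · rw [Real.smoothTransition.one_of_one_le, Real.smoothTransition.one_of_one_le, sub_self]
          · rw [le_div_iff₀ hε0]; linarith
          · rw [le_div_iff₀ hε0]; linarith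
    have := intervalIntegral.integral_add_adjacent_intervals (hsub a haI b hbI) (hsub b hbI T hTI)
    linarith
  have hprim : ContinuousOn (fun t => ∫ r in (0 : ℝ)..t, k r) (Icc 0 T) := by
    have := intervalIntegral.continuousOn_primitive_interval' hk left_mem_uIcc
    rwa [huI] at this
  have hDc : ContinuousOn (fun t => h t - ∫ r in (0 : ℝ)..t, k r) (Icc 0 T) := hh.sub hprim
  set c := h (T / 2) - ∫ r in (0 : ℝ)..(T / 2), k r with hcdef
  have hmid : T / 2 ∈ Ioo 0 T := ⟨by linarith, by linarith⟩
  have hconst : EqOn (fun t => h t - ∫ r in (0 : ℝ)..t, k r) (fun _ => c) (Ioo 0 T) := by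
    intro t ht
    have h1 := intervalIntegral.integral_interval_sub_left
      (hsub 0 h0I t (Ioo_subset_Icc_self ht)) (hsub 0 h0I _ (Ioo_subset_Icc_self hmid))
    simp only [hcdef]
    rcases le_total t (T / 2) with hle | hle
    · have := hin _ _ ht hmid hle
      rw [intervalIntegral.integral_symm] at this
      linarith
    · have := hin _ _ hmid ht hle
      linarith
  have hall : EqOn (fun t => h t - ∫ r in (0 : ℝ)..t, k r) (fun _ => c) (Icc 0 T) :=
    hconst.of_subset_closure hDc continuousOn_const Ioo_subset_Icc_self
      (by rw [closure_Ioo hT.ne])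
  intro s hs t ht
  have h1 := hall hs
  have h2 := hall ht
  have h3 := intervalIntegral.integral_interval_sub_left (hsub 0 h0I t ht) (hsub 0 h0I s hs)
  simp only at h1 h2
  linarith

/-! ### The continuity equation -/

/-- Jointly continuous controlled fields with linear growth, uniformly in the control. -/
structure IsControlField (F : ℝ → E d → E m → E d) (C : ℝ) : Prop where
  continuous : Continuous fun q : ℝ × E d × E m => F q.1 q.2.1 q.2.2
  growth : ∀ t x θ, ‖F t x θ‖ ≤ C * (1 + ‖x‖)
  nonneg : 0 ≤ C

section WeakSolution

variable {F : ℝ → E d → E m → E d} {C T : ℝ} {θ : ℝ → E m} {μ₀ : Measure (E d × E d)}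
  {μ : ℝ → Measure (E d × E d)}

theorem IsControlField.continuous_fderiv_apply (hF : IsControlField F C)
    {φ : ℝ × (E d × E d) → ℝ} (hφ : ContDiff ℝ 1 φ) :
    Continuous fun q : (ℝ × E m) × (E d × E d) =>
      fderiv ℝ φ (q.1.1, q.2) (1, F q.1.1 q.2.1 q.1.2, 0) := by
  have h1 : Continuous fun q : (ℝ × E m) × (E d × E d) => fderiv ℝ φ (q.1.1, q.2) :=
    (hφ.continuous_fderiv (by norm_num)).comp (by fun_prop)
  have h2 : Continuous fun q : (ℝ × E m) × (E d × E d) => F q.1.1 q.2.1 q.1.2 :=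
    hF.continuous.comp (f := fun q : (ℝ × E m) × (E d × E d) => (q.1.1, q.2.1, q.1.2))
      (by fun_prop)
  exact h1.clm_apply (continuous_const.prodMk (h2.prodMk continuous_const))

/-- The weak formulation tested with functions that do not vanish at the initial and final time. -/
theorem IsWeakSolution.integral_sub (hμ : IsWeakSolution F T θ μ₀ μ) (hF : IsControlField F C)
    (hT : 0 < T) (hθ : AEStronglyMeasurable θ (volume.restrict (Icc 0 T)))
    {φ : ℝ × (E d × E d) → ℝ} (hφ : ContDiff ℝ 1 φ) {Q : Set (E d × E d)} (hQ : IsCompact Q)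
    (hφQ : ∀ t ∈ Ioo (-1) (T + 1), ∀ z ∉ Q, φ (t, z) = 0) :
    IntervalIntegrable (fun t => ∫ z, fderiv ℝ φ (t, z) (1, F t z.1 (θ t), 0) ∂(μ t)) volume 0 T ∧
    ∀ s ∈ Icc 0 T, ∀ t ∈ Icc 0 T, ∫ z, φ (t, z) ∂(μ t) - ∫ z, φ (s, z) ∂(μ s) =
      ∫ r in s..t, ∫ z, fderiv ℝ φ (r, z) (1, F r z.1 (θ r), 0) ∂(μ r) := by
  have hprob : ∀ t ∈ Icc 0 T, IsProbabilityMeasure (μ t) := fun t ht => (hμ.prob t ht).1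
  have hI : ∀ t ∈ Icc 0 T, t ∈ Ioo (-1) (T + 1) := fun t ht =>
    ⟨by linarith [ht.1], by linarith [ht.2]⟩
  set g : ℝ × E m → E d × E d → ℝ := fun q z => fderiv ℝ φ (q.1, z) (1, F q.1 z.1 q.2, 0) with hg
  have hgc : Continuous (Function.uncurry g) := hF.continuous_fderiv_apply hφ
  have hgQ : ∀ t ∈ Icc 0 T, ∀ ϑ, ∀ z ∉ Q, g (t, ϑ) z = 0 := by
    intro t ht ϑ z hz
    have : φ =ᶠ[𝓝 (t, z)] fun _ => 0 := by
      have h1 : Ioo (-1) (T + 1) ×ˢ Qᶜ ∈ 𝓝 (t, z) :=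
        (isOpen_Ioo.prod hQ.isClosed.isOpen_compl).mem_nhds ⟨hI t ht, hz⟩
      filter_upwards [h1] with q hq
      exact hφQ q.1 hq.1 q.2 hq.2
    simp only [hg]
    rw [this.fderiv_eq]
    simp
  have hφc : Continuous φ := hφ.continuous
  have hK := continuousOn_integral_curve hprob hμ.continuous hgc hQ hgQ
  have hh : ContinuousOn (fun t => ∫ z, φ (t, z) ∂(μ t)) (Icc 0 T) := by
    have := continuousOn_integral_curve (P := Unit) (g := fun q z => φ (q.1, z)) hprob
      hμ.continuous (hφc.comp (by fun_prop)) hQ (fun t ht _ z hz => hφQ t (hI t ht) z hz)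
    exact this.comp (f := fun t => (t, ())) (by fun_prop) fun t ht => ⟨ht, mem_univ _⟩
  have hmeas : AEStronglyMeasurable (fun t => ∫ z, g (t, θ t) z ∂(μ t))
      (volume.restrict (Icc 0 T)) := by
    -- The control is only measurable. Joint continuity in time and control value, made global by
    -- clamping time to `[0, T]`, transfers measurability to the composition.
    have h1 : Continuous fun q : ℝ × E m =>
        ∫ z, g ((projIcc 0 T hT.le q.1 : ℝ), q.2) z ∂(μ (projIcc 0 T hT.le q.1 : ℝ)) :=
      hK.comp_continuous (f := fun q : ℝ × E m => ((projIcc 0 T hT.le q.1 : ℝ), q.2))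
        ((continuous_subtype_val.comp (continuous_projIcc.comp continuous_fst)).prodMk
          continuous_snd) fun q => ⟨Subtype.coe_prop _, mem_univ _⟩
    have h2 := h1.comp_aestronglyMeasurable (aestronglyMeasurable_id.prodMk hθ)
    refine h2.congr ?_
    filter_upwards [ae_restrict_mem measurableSet_Icc] with t ht
    simp [projIcc_of_mem hT.le ht]
  obtain ⟨M, hM⟩ : ∃ M, ∀ t ∈ Icc 0 T, ∀ ϑ z, ‖g (t, ϑ) z‖ ≤ M := by
    have hcomp : IsCompact (Icc 0 T ×ˢ Q) := isCompact_Icc.prod hQ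
    obtain ⟨M₁, hM₁⟩ := hcomp.exists_bound_of_continuousOn
      ((hφ.continuous_fderiv (by norm_num)).continuousOn)
    obtain ⟨r, hr⟩ := hQ.isBounded.exists_norm_le
    -- The bound does not involve `ϑ` because the growth condition is uniform in the control; hence
    -- integrability in time for every measurable control.
    refine ⟨|M₁| * (1 + C * (1 + |r|)), fun t ht ϑ z => ?_⟩
    have hC := hF.nonneg
    by_cases hz : z ∈ Q
    · refine ((fderiv ℝ φ (t, z)).le_opNorm _).trans ?_
      have h1 := (hM₁ (t, z) ⟨ht, hz⟩).trans (le_abs_self _)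
      have h2 : ‖((1 : ℝ), F t z.1 ϑ, (0 : E d))‖ ≤ 1 + C * (1 + |r|) := by
        have h3 := hF.growth t z.1 ϑ
        have h4 : ‖z.1‖ ≤ |r| := (norm_fst_le z).trans ((hr z hz).trans (le_abs_self _))
        have h5 : C * (1 + ‖z.1‖) ≤ C * (1 + |r|) := by gcongr
        have h6 : 0 ≤ C * (1 + |r|) := by positivity
        refine norm_prod_le_iff.2 ⟨?_, norm_prod_le_iff.2 ⟨?_, ?_⟩⟩
        · simp only [norm_one]; linarith
        · simp only; linarith
        · simp only [norm_zero]; positivity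
      gcongr
    · rw [hgQ t ht ϑ z hz, norm_zero]; positivity
  have hk : IntervalIntegrable (fun t => ∫ z, g (t, θ t) z ∂(μ t)) volume 0 T := by
    rw [intervalIntegrable_iff_integrableOn_Icc_of_le hT.le]
    refine Integrable.of_bound hmeas M ?_
    filter_upwards [ae_restrict_mem measurableSet_Icc] with t ht
    have := hprob t ht
    refine (norm_integral_le_of_norm_le_const (Eventually.of_forall (hM t ht _))).trans ?_
    simp
  refine ⟨hk, sub_eq_integral_of_weak hT hh hk fun η hη ⟨a, b, ha, hb, hab⟩ => ?_⟩
  -- Multiplication by a cut-off in time makes `φ` admissible and reduces the claim to the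
  -- one-dimensional weak formulation.
  have hηφ : ContDiff ℝ 1 fun q : ℝ × (E d × E d) => η q.1 * φ q := (hη.comp contDiff_fst).mul hφ
  have hsupp : ∀ q : ℝ × (E d × E d), q ∉ Icc a b ×ˢ Q → η q.1 * φ q = 0 := by
    intro q hq
    by_cases h1 : q.1 ∈ Icc a b
    · have h2 : q.2 ∉ Q := fun h => hq ⟨h1, h⟩
      rw [hφQ q.1 ⟨by linarith [h1.1], by linarith [h1.2]⟩ q.2 h2, mul_zero]
    · rw [hab _ h1, zero_mul]
  have hcK : IsCompact (Icc a b ×ˢ Q) := isCompact_Icc.prod hQ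
  have hts : tsupport (fun q : ℝ × (E d × E d) => η q.1 * φ q) ⊆ Icc a b ×ˢ Q := by
    refine closure_minimal (fun q hq => ?_) hcK.isClosed
    by_contra h
    exact hq (hsupp q h)
  have hw := hμ.weak _ hηφ (HasCompactSupport.intro hcK hsupp)
    (hts.trans (prod_mono (Icc_subset_Ioo ha hb) (subset_univ _)))
  refine Eq.trans ?_ hw
  refine intervalIntegral.integral_congr fun t ht => ?_
  rw [uIcc_of_le hT.le] at ht
  have := hprob t ht
  have i1 : Integrable (fun z => φ (t, z)) (μ t) :=
    (hφc.comp (by fun_prop)).integrable_of_hasCompactSupport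
      (HasCompactSupport.intro hQ fun z hz => hφQ t (hI t ht) z hz)
  have i2 : Integrable (fun z => g (t, θ t) z) (μ t) :=
    (hgc.comp (continuous_const.prodMk continuous_id)).integrable_of_hasCompactSupport
      (HasCompactSupport.intro hQ fun z hz => hgQ t ht _ z hz)
  rw [← integral_const_mul, ← integral_const_mul, ← integral_add (i1.const_mul _) (i2.const_mul _)]
  refine integral_congr_ae (Eventually.of_forall fun z => ?_)
  have hd1 : HasFDerivAt (fun q : ℝ × (E d × E d) => η q.1)
      (deriv η t • ContinuousLinearMap.fst ℝ ℝ (E d × E d)) (t, z) :=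
    ((hη.differentiable (by norm_num)) t).hasDerivAt.comp_hasFDerivAt (t, z) hasFDerivAt_fst
  have hd2 : HasFDerivAt φ (fderiv ℝ φ (t, z)) (t, z) :=
    ((hφ.differentiable (by norm_num)) _).hasFDerivAt
  have h3 : HasFDerivAt (fun q : ℝ × (E d × E d) => η q.1 * φ q) (η t • fderiv ℝ φ (t, z) +
      φ (t, z) • (deriv η t • ContinuousLinearMap.fst ℝ ℝ (E d × E d))) (t, z) := hd1.mul hd2
  simp only [hg]
  rw [h3.fderiv]
  simp
  ring

/-- Radius of a ball containing the support of the solutions of the continuity equation. -/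
noncomputable def supportRadius (C T r : ℝ) : ℝ := (r ^ 2 + 2) * Real.exp (4 * C * (T + 1))

/-- A Lyapunov argument replaces a representation of `μ` by trajectories. By linear growth
`exp(-4Ct)(1 + |x|²)` decreases along the field, so `φ`, a decreasing function of it times a cut-off
in `y`, has nonnegative derivative along the field. Its integral equals 1 at time 0, cannot
decrease, and is at most 1, so `φ = 1` almost everywhere for `μ t`, while `φ = 0` outside the ball.
-/
theorem IsWeakSolution.support (hμ : IsWeakSolution F T θ μ₀ μ) (hF : IsControlField F C)
    (hT : 0 < T) (hθ : AEStronglyMeasurable θ (volume.restrict (Icc 0 T))) {r : ℝ}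
    (hr : μ₀ (Metric.closedBall 0 r)ᶜ = 0) {t : ℝ} (ht : t ∈ Icc 0 T) :
    μ t (Metric.closedBall 0 (supportRadius C T r))ᶜ = 0 := by
  have hC := hF.nonneg
  set ρ := r ^ 2 + 2 with hρ
  set R := supportRadius C T r with hR
  have hρR : ρ ≤ R := by
    rw [hR, supportRadius]
    exact le_mul_of_one_le_right (by positivity) (Real.one_le_exp (by positivity))
  have hR1 : 1 ≤ R := le_trans (by nlinarith [sq_nonneg r]) hρR
  set φ : ℝ × (E d × E d) → ℝ := fun q =>
    Real.smoothTransition (ρ - Real.exp (-(4 * C * q.1)) * (1 + ‖q.2.1‖ ^ 2)) *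
      Real.smoothTransition (ρ - ‖q.2.2‖ ^ 2) with hφdef
  have hSd : ContDiff ℝ 1 Real.smoothTransition := Real.smoothTransition.contDiff
  have hφ : ContDiff ℝ 1 φ := by
    refine (hSd.comp ?_).mul (hSd.comp ?_)
    · refine contDiff_const.sub ((Real.contDiff_exp.comp ?_).mul (contDiff_const.add ?_))
      · fun_prop
      · exact (contDiff_norm_sq ℝ).comp (contDiff_fst.comp contDiff_snd)
    · exact contDiff_const.sub ((contDiff_norm_sq ℝ).comp (contDiff_snd.comp contDiff_snd))
  have hφ1 : ∀ q, φ q ≤ 1 := fun q => mul_le_one₀ (Real.smoothTransition.le_one _)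
    (Real.smoothTransition.nonneg _) (Real.smoothTransition.le_one _)
  have hφ0 : ∀ q, 0 ≤ φ q := fun q => mul_nonneg (Real.smoothTransition.nonneg _)
    (Real.smoothTransition.nonneg _)
  have hφQ : ∀ s ∈ Ioo (-1) (T + 1), ∀ z ∉ Metric.closedBall (0 : E d × E d) R,
      φ (s, z) = 0 := by
    intro s hs z hz
    have hz' : R < max ‖z.1‖ ‖z.2‖ := by
      rwa [mem_closedBall_zero_iff, not_le, Prod.norm_def] at hz
    rcases lt_max_iff.1 hz' with h | h
    · simp only [hφdef]
      rw [Real.smoothTransition.zero_of_nonpos, zero_mul]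
      have h1 : R ≤ ‖z.1‖ ^ 2 := by nlinarith
      have h2 : Real.exp (-(4 * C * (T + 1))) ≤ Real.exp (-(4 * C * s)) := by
        have := hs.2
        gcongr
      -- The exponent in `supportRadius` uses `T + 1` rather than `T` because `φ` must vanish off
      -- the ball on an open time interval containing `[0, T]`. The summand 2 in `ρ` makes `ρ - (1 +
      -- r²) = 1`, hence `φ = 1` on the initial support.
      have h3 : ρ = Real.exp (-(4 * C * (T + 1))) * R := by
        rw [hR, supportRadius, mul_comm, mul_assoc, ← Real.exp_add]; simp [hρ]
      have h4 : Real.exp (-(4 * C * (T + 1))) * R ≤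
          Real.exp (-(4 * C * s)) * (1 + ‖z.1‖ ^ 2) := by
        gcongr; linarith
      linarith
    · simp only [hφdef]
      rw [Real.smoothTransition.zero_of_nonpos (x := ρ - ‖z.2‖ ^ 2), mul_zero]
      nlinarith
  have hdn : ∀ s z, 0 ≤ fderiv ℝ φ (s, z) (1, F s z.1 (θ s), 0) := by
    intro s z
    set v := F s z.1 (θ s) with hv
    have h1 : HasDerivAt (fun ε : ℝ => ((s + ε, (z.1 + ε • v, z.2)) : ℝ × (E d × E d)))
        (1, v, 0) 0 := by
      have ha : HasDerivAt (fun ε : ℝ => s + ε) 1 0 := (hasDerivAt_id 0).const_add s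
      have hb : HasDerivAt (fun ε : ℝ => z.1 + ε • v) v 0 := by
        simpa using ((hasDerivAt_id (0 : ℝ)).smul_const v).const_add z.1
      exact ha.prodMk (hb.prodMk (hasDerivAt_const _ _))
    have h2 : HasFDerivAt φ (fderiv ℝ φ (s, z)) (s + 0, (z.1 + (0 : ℝ) • v, z.2)) := by
      simpa using ((hφ.differentiable (by norm_num)) (s, z)).hasFDerivAt
    have h3 := h2.comp_hasDerivAt 0 h1
    have hu : HasDerivAt (fun ε : ℝ => ρ - Real.exp (-(4 * C * (s + ε))) * (1 + ‖z.1 + ε • v‖ ^ 2))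
        (-(Real.exp (-(4 * C * s)) * (-(4 * C)) * (1 + ‖z.1‖ ^ 2) +
          Real.exp (-(4 * C * s)) * (2 * inner ℝ z.1 v))) 0 := by
      have ha : HasDerivAt (fun ε : ℝ => -(4 * C * (s + ε))) (-(4 * C)) 0 := by
        exact (((hasDerivAt_id (0 : ℝ)).const_add s).const_mul (4 * C)).neg.congr_deriv (by simp)
      have hb : HasDerivAt (fun ε : ℝ => z.1 + ε • v) v 0 := by
        simpa using ((hasDerivAt_id (0 : ℝ)).smul_const v).const_add z.1
      have := (ha.exp.mul (hb.norm_sq.const_add 1)).const_sub ρ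
      simpa using this
    have hSu := ((hSd.differentiable (by norm_num)) (ρ - Real.exp (-(4 * C * (s + 0))) *
      (1 + ‖z.1 + (0 : ℝ) • v‖ ^ 2))).hasDerivAt.comp 0 hu
    have h4 := hSu.mul_const (Real.smoothTransition (ρ - ‖z.2‖ ^ 2))
    rw [h3.unique h4]
    refine mul_nonneg (mul_nonneg (deriv_smoothTransition_nonneg _) ?_)
      (Real.smoothTransition.nonneg _)
    have h5 := hF.growth s z.1 (θ s)
    have h6 := real_inner_le_norm z.1 v
    have h7 : ‖z.1‖ * ‖v‖ ≤ ‖z.1‖ * (C * (1 + ‖z.1‖)) := by gcongr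
    have h8 : 2 * inner ℝ z.1 v ≤ 4 * C * (1 + ‖z.1‖ ^ 2) := by
      nlinarith [mul_nonneg hC (sq_nonneg (‖z.1‖ - 1)), sq_nonneg ‖z.1‖,
        mul_nonneg hC (sq_nonneg ‖z.1‖)]
    have h9 := Real.exp_pos (-(4 * C * s))
    nlinarith
  have hprob := (hμ.prob t ht).1
  have h0I : (0 : ℝ) ∈ Icc 0 T := ⟨le_rfl, hT.le⟩
  have hprob0 := (hμ.prob 0 h0I).1
  have key := (hμ.integral_sub hF hT hθ hφ (isCompact_closedBall 0 R) hφQ).2 0 h0I t ht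
  have hpos : 0 ≤ ∫ s in (0 : ℝ)..t, ∫ z, fderiv ℝ φ (s, z) (1, F s z.1 (θ s), 0) ∂(μ s) :=
    intervalIntegral.integral_nonneg ht.1 fun s _ => integral_nonneg fun z => hdn s z
  have hinit : ∫ z, φ (0, z) ∂(μ 0) = 1 := by
    have : (fun z => φ (0, z)) =ᵐ[μ 0] fun _ => 1 := by
      have h1 : ∀ᵐ z ∂(μ 0), z ∈ Metric.closedBall (0 : E d × E d) r := by
        rw [hμ.initial]; exact hr
      filter_upwards [h1] with z hz
      have hz' : max ‖z.1‖ ‖z.2‖ ≤ r := by simpa [Prod.norm_def] using hz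
      have h2 := (le_max_left _ _).trans hz'
      have h3 := (le_max_right _ _).trans hz'
      have h4 : ‖z.1‖ ^ 2 ≤ r ^ 2 := by gcongr
      have h5 : ‖z.2‖ ^ 2 ≤ r ^ 2 := by gcongr
      simp only [hφdef, mul_zero, neg_zero, Real.exp_zero, one_mul]
      rw [Real.smoothTransition.one_of_one_le (by linarith),
        Real.smoothTransition.one_of_one_le (by linarith), one_mul]
    rw [integral_congr_ae this]
    simp
  have hint : Integrable (fun z => φ (t, z)) (μ t) :=
    Integrable.of_bound (hφ.continuous.comp (by fun_prop)).aestronglyMeasurable 1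
      (Eventually.of_forall fun z => by rw [Real.norm_of_nonneg (hφ0 _)]; exact hφ1 _)
  have hz : ∫ z, (1 - φ (t, z)) ∂(μ t) = 0 := by
    refine le_antisymm ?_ (integral_nonneg fun z => sub_nonneg.2 (hφ1 _))
    rw [MeasureTheory.integral_sub (integrable_const _) hint]
    simp only [integral_const, probReal_univ, smul_eq_mul, mul_one]
    linarith
  rw [integral_eq_zero_iff_of_nonneg (fun z => sub_nonneg.2 (hφ1 _))
    ((integrable_const _).sub hint)] at hz
  have : ∀ᵐ z ∂(μ t), z ∈ Metric.closedBall (0 : E d × E d) R := by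
    filter_upwards [hz] with z hz
    by_contra h
    have h1 := hφQ t ⟨by linarith [ht.1], by linarith [ht.2]⟩ z h
    simp only [Pi.zero_apply, h1] at hz
    norm_num at hz
  exact this

/-- The weak formulation tested with arbitrary `C¹` functions, for solutions with uniformly
bounded support. -/
theorem IsWeakSolution.integral_sub_of_support (hμ : IsWeakSolution F T θ μ₀ μ)
    (hF : IsControlField F C) (hT : 0 < T)
    (hθ : AEStronglyMeasurable θ (volume.restrict (Icc 0 T))) {R : ℝ}
    (hR : ∀ t ∈ Icc 0 T, μ t (Metric.closedBall 0 R)ᶜ = 0)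
    {φ : ℝ × (E d × E d) → ℝ} (hφ : ContDiff ℝ 1 φ) :
    IntervalIntegrable (fun t => ∫ z, fderiv ℝ φ (t, z) (1, F t z.1 (θ t), 0) ∂(μ t)) volume 0 T ∧
    ∀ s ∈ Icc 0 T, ∀ t ∈ Icc 0 T, ∫ z, φ (t, z) ∂(μ t) - ∫ z, φ (s, z) ∂(μ s) =
      ∫ r in s..t, ∫ z, fderiv ℝ φ (r, z) (1, F r z.1 (θ r), 0) ∂(μ r) := by
  -- The cut-off equals 1 on a neighbourhood of all the supports, so it alters neither the integrals
  -- nor the derivatives there.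
  let χ : ContDiffBump (0 : E d × E d) := ⟨|R| + 1, |R| + 2, by positivity, by linarith⟩
  have hχ : ContDiff ℝ 1 fun q : ℝ × (E d × E d) => χ q.2 * φ q :=
    (χ.contDiff.comp contDiff_snd).mul hφ
  have key := hμ.integral_sub hF hT hθ hχ (isCompact_closedBall 0 (|R| + 2)) fun t _ z hz => by
    have : χ z = 0 := χ.zero_of_le_dist (by
      simp only [Metric.mem_closedBall, not_le] at hz
      exact hz.le)
    simp [this]
  have hae : ∀ t ∈ Icc 0 T, ∀ᵐ z ∂(μ t), z ∈ Metric.closedBall (0 : E d × E d) R := fun t ht =>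
    hR t ht
  have hball : ∀ z ∈ Metric.closedBall (0 : E d × E d) R, z ∈ Metric.ball 0 χ.rIn := by
    intro z hz
    rw [Metric.mem_closedBall] at hz
    rw [Metric.mem_ball]
    exact hz.trans_lt (by show R < |R| + 1; linarith [le_abs_self R])
  have e1 : ∀ t ∈ Icc 0 T, ∫ z, χ z * φ (t, z) ∂(μ t) = ∫ z, φ (t, z) ∂(μ t) := fun t ht => by
    refine integral_congr_ae ?_
    filter_upwards [hae t ht] with z hz
    rw [χ.one_of_mem_closedBall (Metric.ball_subset_closedBall (hball z hz)), one_mul]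
  have e2 : ∀ t ∈ Icc 0 T, ∫ z, fderiv ℝ (fun q : ℝ × (E d × E d) => χ q.2 * φ q) (t, z)
      (1, F t z.1 (θ t), 0) ∂(μ t) = ∫ z, fderiv ℝ φ (t, z) (1, F t z.1 (θ t), 0) ∂(μ t) :=
    fun t ht => by
    refine integral_congr_ae ?_
    filter_upwards [hae t ht] with z hz
    have h1 : (fun q : ℝ × (E d × E d) => χ q.2 * φ q) =ᶠ[𝓝 (t, z)] φ := by
      have h2 : ∀ᶠ q : ℝ × (E d × E d) in 𝓝 (t, z), q.2 ∈ Metric.ball (0 : E d × E d) χ.rIn :=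
        continuous_snd.continuousAt (Metric.isOpen_ball.mem_nhds (hball z hz))
      filter_upwards [h2] with q hq
      rw [χ.one_of_mem_closedBall (Metric.ball_subset_closedBall hq), one_mul]
    rw [h1.fderiv_eq]
  refine ⟨?_, fun s hs t ht => ?_⟩
  · have := key.1
    rw [intervalIntegrable_iff_integrableOn_Icc_of_le hT.le] at this ⊢
    exact this.congr_fun (fun t ht => e2 t ht) measurableSet_Icc
  · have h := key.2 s hs t ht
    simp only at h
    rw [e1 s hs, e1 t ht] at h
    rw [h]
    refine intervalIntegral.integral_congr fun r hr => ?_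
    have hr' : r ∈ Icc 0 T := by
      have := uIcc_subset_uIcc (a₁ := s) (b₁ := t) (a₂ := 0) (b₂ := T)
        (by rwa [uIcc_of_le hT.le]) (by rwa [uIcc_of_le hT.le]) hr
      rwa [uIcc_of_le hT.le] at this
    exact e2 r hr'

/-! ### Solutions given by the flow -/

theorem IsLipField.continuous_flow_uncurry {V : Type*} [NormedAddCommGroup V] [NormedSpace ℝ V]
    [CompleteSpace V] {f : ℝ → V → V} {L C : ℝ} (hf : IsLipField f L C) (τ : ℝ) :
    Continuous fun q : ℝ × V => flow f τ q.2 q.1 := by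
  refine continuous_iff_continuousAt.2 fun ⟨t, x⟩ => ?_
  have h1 : Tendsto (fun q : ℝ × V => flow f τ x q.1) (𝓝 (t, x)) (𝓝 (flow f τ x t)) :=
    ((hf.continuous_flow τ x).comp continuous_fst).continuousAt
  have h2 : Tendsto (fun q : ℝ × V => ‖q.2 - x‖ * Real.exp (2 * (L * |q.1 - τ|)))
      (𝓝 (t, x)) (𝓝 0) := by
    have : Continuous fun q : ℝ × V => ‖q.2 - x‖ * Real.exp (2 * (L * |q.1 - τ|)) := by fun_prop
    simpa using this.tendsto (t, x)
  have h3 : Tendsto (fun q : ℝ × V => flow f τ q.2 q.1 - flow f τ x q.1) (𝓝 (t, x)) (𝓝 0) :=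
    squeeze_zero_norm (fun q => hf.dist_flow_le τ q.1 q.2 x) h2
  simpa [ContinuousAt] using h3.add h1

/-- Along each trajectory the tested integrand is the time derivative of `φ(t, X_t)`, and `φ`
vanishes at both end times; Fubini then gives the weak equation. -/
theorem isWeakSolution_map_flow {f : ℝ → E d × E d → E d × E d} {L C₀ : ℝ}
    (hf : IsLipField f L C₀) (hfF : ∀ t ∈ Icc 0 T, ∀ z, f t z = (F t z.1 (θ t), 0)) (hT : 0 < T)
    [IsProbabilityMeasure μ₀] {K : Set (E d × E d)} (hK : IsCompact K) (hμK : μ₀ Kᶜ = 0) :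
    IsWeakSolution F T θ μ₀ fun t => μ₀.map fun z => flow f 0 z t := by
  have hjc := hf.continuous_flow_uncurry 0
  have hc : ∀ t, Continuous fun z => flow f 0 z t := fun t =>
    hjc.comp (f := fun z => (t, z)) (by fun_prop)
  obtain ⟨r, hr⟩ := hK.isBounded.exists_norm_le
  have hC0 : 0 ≤ C₀ := (norm_nonneg _).trans (hf.bound 0)
  have hL := hf.nonneg
  constructor
  · intro t _
    refine ⟨Measure.isProbabilityMeasure_map (hc t).aemeasurable,
      (fun z => flow f 0 z t) '' K, hK.image (hc t), ?_⟩
    rw [Measure.map_apply (hc t).measurable (hK.image (hc t)).isClosed.measurableSet.compl]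
    refine measure_mono_null (t := Kᶜ) (fun z hz hzK => ?_) hμK
    exact hz ⟨z, hzK, rfl⟩
  · intro t ht
    set R := flowRadius L C₀ T r
    have hle : ∀ s ∈ Icc 0 T, W1 (μ₀.map fun z => flow f 0 z s) (μ₀.map fun z => flow f 0 z t) ≤
        ENNReal.ofReal (2 * ((C₀ + L * R) * |s - t|)) := by
      intro s hs
      refine W1_map_le μ₀ (hc s).measurable (hc t).measurable ?_
      have : ∀ᵐ z ∂μ₀, z ∈ K := hμK
      filter_upwards [this] with z hz
      rw [hf.flow_eq_integral 0 z t s, add_sub_cancel_left, ← Real.norm_eq_abs]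
      refine intervalIntegral.norm_integral_le_of_norm_le_const fun q hq => ?_
      have hqI : q ∈ Icc 0 T := by
        have := uIcc_subset_uIcc (a₁ := t) (b₁ := s) (a₂ := 0) (b₂ := T)
          (by rwa [uIcc_of_le hT.le]) (by rwa [uIcc_of_le hT.le]) (uIoc_subset_uIcc hq)
        rwa [uIcc_of_le hT.le] at this
      have h1 := hf.lipschitz q (flow f 0 z q) 0
      have h2 := norm_le_norm_add_norm_sub' (f q (flow f 0 z q)) (f q 0)
      have h3 : ‖flow f 0 z q‖ ≤ R := hf.norm_flow_le_radius (hr z hz) (by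
        rw [sub_zero, abs_of_nonneg hqI.1]; exact hqI.2)
      rw [sub_zero] at h1
      have h4 : L * ‖flow f 0 z q‖ ≤ L * R := by gcongr
      linarith [hf.bound q]
    have hlim : Tendsto (fun s => ENNReal.ofReal (2 * ((C₀ + L * R) * |s - t|)))
        (𝓝[Icc 0 T] t) (𝓝 0) := by
      have : Continuous fun s => ENNReal.ofReal (2 * ((C₀ + L * R) * |s - t|)) :=
        ENNReal.continuous_ofReal.comp (by fun_prop)
      have := this.tendsto t
      simp only [sub_self, abs_zero, mul_zero, ENNReal.ofReal_zero] at this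
      exact this.mono_left nhdsWithin_le_nhds
    exact tendsto_of_tendsto_of_tendsto_of_le_of_le' tendsto_const_nhds hlim
      (Eventually.of_forall fun _ => bot_le)
      (eventually_mem_nhdsWithin.mono fun s hs => hle s hs)
  · simp only [hf.flow_self]
    exact Measure.map_id
  · intro φ hφ hφc hφs
    set H : ℝ × (E d × E d) → ℝ := fun q => fderiv ℝ φ q (1, f q.1 q.2) with hH
    have hHc : Continuous H := (hφ.continuous_fderiv (by norm_num)).clm_apply
      (continuous_const.prodMk hf.continuous)
    have hHs : HasCompactSupport H := (hφc.fderiv ℝ).mono fun q hq h => by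
      simp [hH, h] at hq
    obtain ⟨M, hM⟩ := hHc.bounded_above_of_compact_support hHs
    have hflowc : Continuous fun q : ℝ × (E d × E d) => H (q.1, flow f 0 q.2 q.1) :=
      hHc.comp (continuous_fst.prodMk hjc)
    have e1 : ∀ t ∈ uIcc 0 T, (∫ z, fderiv ℝ φ (t, z) (1, F t z.1 (θ t), 0)
        ∂(μ₀.map fun z => flow f 0 z t)) = ∫ z, H (t, flow f 0 z t) ∂μ₀ := fun t ht => by
      rw [uIcc_of_le hT.le] at ht
      rw [← integral_map (f := fun z => H (t, z)) (hc t).aemeasurable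
        (hHc.comp (by fun_prop)).aestronglyMeasurable]
      refine integral_congr_ae (Eventually.of_forall fun z => ?_)
      simp only [hH, hfF t ht z]
    rw [intervalIntegral.integral_congr e1, intervalIntegral_integral_swap]
    · have : ∀ z, ∫ t in (0 : ℝ)..T, H (t, flow f 0 z t) = 0 := by
        intro z
        have h1 : ∀ t ∈ uIcc 0 T, HasDerivAt (fun t => φ (t, flow f 0 z t))
            (H (t, flow f 0 z t)) t := fun t _ =>
          ((hφ.differentiable (by norm_num)) _).hasFDerivAt.comp_hasDerivAt t
            ((hasDerivAt_id t).prodMk (hf.hasDerivAt_flow 0 z t))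
        rw [intervalIntegral.integral_eq_sub_of_hasDerivAt h1
          ((hflowc.comp (f := fun t => (t, z)) (by fun_prop)).intervalIntegrable _ _),
          image_eq_zero_of_notMem_tsupport fun h => lt_irrefl _ (hφs h).1.2,
          image_eq_zero_of_notMem_tsupport fun h => lt_irrefl _ (hφs h).1.1, sub_zero]
      simp [this]
    · have : IsFiniteMeasure (volume.restrict (uIoc 0 T)) :=
        ⟨by rw [Measure.restrict_apply_univ, uIoc_of_le hT.le]; exact measure_Ioc_lt_top⟩
      refine Integrable.of_bound hflowc.aestronglyMeasurable M
        (Eventually.of_forall fun q => hM _)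

end WeakSolution

/-! ### Regularity of the controlled field -/

/-- An interpolation inequality of Landau type: a small function with Lipschitz derivative has a
small derivative, by a difference quotient at distance `r`. It serves to deduce continuity of `∇ₓF`
in time, which is not assumed, from that of `F`. -/
theorem norm_fderiv_le_of_norm_le {V W : Type*} [NormedAddCommGroup V] [NormedSpace ℝ V]
    [NormedAddCommGroup W] [NormedSpace ℝ W] {g : V → W} {g' : V → V →L[ℝ] W} {s : Set V}
    (hs : Convex ℝ s) {K δ r : ℝ} {x : V} (hg : ∀ y ∈ s, HasFDerivAt g (g' y) y)
    (hK : ∀ y ∈ s, ∀ z ∈ s, ‖g' y - g' z‖ ≤ K * ‖y - z‖) (hδ : ∀ y ∈ s, ‖g y‖ ≤ δ) (hr : 0 < r)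
    (hK0 : 0 ≤ K) (hrs : Metric.closedBall x r ⊆ s) : ‖g' x‖ ≤ 2 * δ / r + K * r := by
  have hxs : x ∈ s := hrs (Metric.mem_closedBall_self hr.le)
  have hδ0 : 0 ≤ δ := (norm_nonneg _).trans (hδ x hxs)
  refine ContinuousLinearMap.opNorm_le_bound _ (by positivity) fun h => ?_
  rcases eq_or_ne h 0 with rfl | hh
  · simp
  have hh0 : 0 < ‖h‖ := norm_pos_iff.2 hh
  set y := x + (r / ‖h‖) • h with hy
  have hyx : ‖y - x‖ = r := by
    rw [hy, add_sub_cancel_left, norm_smul, norm_div, norm_norm, Real.norm_of_nonneg hr.le]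
    field_simp
  have hys : y ∈ s := hrs (by rw [Metric.mem_closedBall, dist_eq_norm, hyx])
  have h1 := norm_sub_sub_le_of_lipschitz_fderiv hs hg hK hxs hys
  have h2 : g' x (y - x) = (r / ‖h‖) • g' x h := by rw [hy, add_sub_cancel_left, map_smul]
  have h3 : ‖g' x (y - x)‖ ≤ 2 * δ + K * r ^ 2 := by
    have e : g' x (y - x) = g y - g x - (g y - g x - g' x (y - x)) := by abel
    rw [e]
    rw [hyx] at h1
    have := norm_sub_le (g y) (g x)
    have := norm_sub_le (g y - g x) (g y - g x - g' x (y - x))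
    linarith [hδ x hxs, hδ y hys]
  rw [h2, norm_smul, norm_div, norm_norm, Real.norm_of_nonneg hr.le] at h3
  have h4 : ‖g' x h‖ = (r / ‖h‖ * ‖g' x h‖) * (‖h‖ / r) := by field_simp
  rw [h4]
  calc (r / ‖h‖ * ‖g' x h‖) * (‖h‖ / r) ≤ (2 * δ + K * r ^ 2) * (‖h‖ / r) := by gcongr
    _ = _ := by field_simp

/-- Quantitative regularity of the controlled field; controls are restricted to the unit ball
where the hypotheses are only local in the control. -/
structure IsRegular (F : ℝ → E d → E m → E d) (C L : ℝ) (A : ℝ → ℝ) : Prop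
    extends IsControlField F C where
  L_nonneg : 0 ≤ L
  A_nonneg : ∀ R, 0 ≤ A R
  lipschitz_x : ∀ t x y θ, ‖F t x θ - F t y θ‖ ≤ L * (1 + ‖θ‖) * ‖x - y‖
  hasFDerivAt_x : ∀ t x θ, HasFDerivAt (fun x => F t x θ) (gradX F t x θ) x
  continuousOn_gradX : ContinuousOn (fun q : ℝ × E d × E m => gradX F q.1 q.2.1 q.2.2)
    {q | ‖q.2.2‖ ≤ 1}
  hasFDerivAt_theta : ∀ t x θ, HasFDerivAt (fun θ => F t x θ) (gradTheta F t x θ) θ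
  continuous_gradTheta : Continuous fun q : ℝ × E d × E m => gradTheta F q.1 q.2.1 q.2.2
  norm_gradTheta_le : ∀ R t x θ, ‖x‖ ≤ R → ‖gradTheta F t x θ‖ ≤ A R
  gradTheta_lipschitz_theta : ∀ R t x θ₁ θ₂, ‖x‖ ≤ R →
    ‖gradTheta F t x θ₁ - gradTheta F t x θ₂‖ ≤ A R * ‖θ₁ - θ₂‖
  gradTheta_lipschitz_x : ∀ R t x y θ, ‖x‖ ≤ R → ‖y‖ ≤ R → ‖θ‖ ≤ 1 →
    ‖gradTheta F t x θ - gradTheta F t y θ‖ ≤ A R * ‖x - y‖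
  gradX_lipschitz_x : ∀ R t x y θ, ‖x‖ ≤ R → ‖y‖ ≤ R → ‖θ‖ ≤ 1 →
    ‖gradX F t x θ - gradX F t y θ‖ ≤ A R * ‖x - y‖
  gradX_lipschitz_theta : ∀ R t x θ₁ θ₂, ‖x‖ ≤ R → ‖θ₁‖ ≤ 1 → ‖θ₂‖ ≤ 1 →
    ‖gradX F t x θ₁ - gradX F t x θ₂‖ ≤ A R * ‖θ₁ - θ₂‖

namespace IsRegular

variable {F : ℝ → E d → E m → E d} {C L : ℝ} {A : ℝ → ℝ} (hF : IsRegular F C L A)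
include hF

theorem lipschitz_theta (R t : ℝ) (x : E d) (θ₁ θ₂ : E m) (hx : ‖x‖ ≤ R) :
    ‖F t x θ₁ - F t x θ₂‖ ≤ A R * ‖θ₁ - θ₂‖ :=
  convex_univ.norm_image_sub_le_of_norm_hasFDerivWithin_le
    (f := fun θ => F t x θ) (fun θ _ => (hF.hasFDerivAt_theta t x θ).hasFDerivWithinAt)
    (fun θ _ => hF.norm_gradTheta_le R t x θ hx) (mem_univ θ₂) (mem_univ θ₁)

theorem remainder_theta (R t : ℝ) (x : E d) (θ₁ θ₂ : E m) (hx : ‖x‖ ≤ R) :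
    ‖F t x θ₂ - F t x θ₁ - gradTheta F t x θ₁ (θ₂ - θ₁)‖ ≤ A R * ‖θ₂ - θ₁‖ ^ 2 :=
  norm_sub_sub_le_of_lipschitz_fderiv convex_univ (g := fun θ => F t x θ)
    (fun θ _ => hF.hasFDerivAt_theta t x θ)
    (fun θ _ θ' _ => hF.gradTheta_lipschitz_theta R t x θ θ' hx) (mem_univ _) (mem_univ _)

end IsRegular

/-- The vector field on `ℝ²ᵈ` associated with a control. -/
def controlledField (F : ℝ → E d → E m → E d) (θ : ℝ → E m) (t : ℝ) (z : E d × E d) : E d × E d :=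
  (F t z.1 (θ t), 0)

/-- The spatial differential of `controlledField`. -/
noncomputable def controlledFieldDeriv (F : ℝ → E d → E m → E d) (θ : ℝ → E m) (t : ℝ)
    (z : E d × E d) : E d × E d →L[ℝ] E d × E d :=
  ((gradX F t z.1 (θ t)).comp (ContinuousLinearMap.fst ℝ (E d) (E d))).prod 0

theorem norm_prod_zero_le {V W : Type*} [NormedAddCommGroup V] [NormedAddCommGroup W] {x : V}
    {c : ℝ} (h : ‖x‖ ≤ c) : ‖(x, (0 : W))‖ ≤ c := by
  rw [Prod.norm_mk, norm_zero]
  exact max_le h ((norm_nonneg _).trans h)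

theorem norm_comp_fst_prod_zero_le {a : E d →L[ℝ] E d} {c : ℝ} (h : ‖a‖ ≤ c) :
    ‖(a.comp (ContinuousLinearMap.fst ℝ (E d) (E d))).prod (0 : E d × E d →L[ℝ] E d)‖ ≤ c := by
  refine ContinuousLinearMap.opNorm_le_bound _ ((norm_nonneg _).trans h) fun z => ?_
  have h0 := (norm_nonneg _).trans h
  refine norm_prod_zero_le (W := E d) ((a.le_opNorm z.1).trans ?_)
  gcongr
  exact norm_fst_le z

theorem controlledFieldDeriv_sub (F G : ℝ → E d → E m → E d) (θ θ' : ℝ → E m) (t : ℝ)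
    (z z' : E d × E d) : controlledFieldDeriv F θ t z - controlledFieldDeriv G θ' t z' =
      ((gradX F t z.1 (θ t) - gradX G t z'.1 (θ' t)).comp
        (ContinuousLinearMap.fst ℝ (E d) (E d))).prod 0 := by
  ext v <;> simp [controlledFieldDeriv]

/-- Continuous controls with values in the unit ball. -/
structure IsUnitControl (θ : ℝ → E m) : Prop where
  continuous : Continuous θ
  norm_le : ∀ t, ‖θ t‖ ≤ 1

namespace IsRegular

variable {F : ℝ → E d → E m → E d} {C L : ℝ} {A : ℝ → ℝ} (hF : IsRegular F C L A)
include hF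

theorem isC2Field {θ : ℝ → E m} (hθ : IsUnitControl θ) :
    IsC2Field (controlledField F θ) (controlledFieldDeriv F θ) (2 * L) C A where
  continuous := by
    have : Continuous fun q : ℝ × (E d × E d) => F q.1 q.2.1 (θ q.1) :=
      hF.continuous.comp (f := fun q : ℝ × (E d × E d) => (q.1, q.2.1, θ q.1))
        (by have := hθ.continuous; fun_prop)
    exact this.prodMk continuous_const
  lipschitz t z w := by
    have h1 := hF.lipschitz_x t z.1 w.1 (θ t)
    have h2 := hθ.norm_le t
    have hL := hF.L_nonneg
    have e : controlledField F θ t z - controlledField F θ t w =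
        (F t z.1 (θ t) - F t w.1 (θ t), 0) := by simp [controlledField]
    rw [e]
    refine norm_prod_zero_le (h1.trans ?_)
    have h3 : ‖z.1 - w.1‖ ≤ ‖z - w‖ := norm_fst_le (z - w)
    -- The restriction to the unit ball makes the Lipschitz constant in space uniform in the
    -- control, which is why `2 * L` appears throughout.
    have h4 : L * (1 + ‖θ t‖) ≤ 2 * L := by nlinarith
    gcongr
  bound t := by
    refine norm_prod_zero_le ?_
    simpa using hF.growth t 0 (θ t)
  nonneg := by have := hF.L_nonneg; positivity
  hasFDerivAt t z := by
    have h1 : HasFDerivAt (fun z : E d × E d => F t z.1 (θ t))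
        ((gradX F t z.1 (θ t)).comp (ContinuousLinearMap.fst ℝ (E d) (E d))) z :=
      HasFDerivAt.comp z (hF.hasFDerivAt_x t z.1 (θ t)) hasFDerivAt_fst
    exact h1.prodMk (hasFDerivAt_const _ _)
  continuous_fderiv := by
    have h1 : Continuous fun q : ℝ × (E d × E d) => gradX F q.1 q.2.1 (θ q.1) :=
      hF.continuousOn_gradX.comp_continuous
        (f := fun q : ℝ × (E d × E d) => (q.1, q.2.1, θ q.1))
        (by have := hθ.continuous; fun_prop) fun q => hθ.norm_le q.1
    have h2 : Continuous fun q : ℝ × (E d × E d) =>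
        (gradX F q.1 q.2.1 (θ q.1)).comp (ContinuousLinearMap.fst ℝ (E d) (E d)) :=
      h1.clm_comp continuous_const
    have h3 := (ContinuousLinearMap.prodₗᵢ ℝ : ((E d × E d →L[ℝ] E d) × (E d × E d →L[ℝ] E d)) ≃ₗᵢ[ℝ]
      (E d × E d →L[ℝ] E d × E d)).continuous
    exact h3.comp (h2.prodMk continuous_const)
  lipschitz_fderiv R t z w hz hw := by
    rw [controlledFieldDeriv_sub]
    refine norm_comp_fst_prod_zero_le ((hF.gradX_lipschitz_x R t _ _ _ ((norm_fst_le z).trans hz)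
      ((norm_fst_le w).trans hw) (hθ.norm_le t)).trans ?_)
    have := hF.A_nonneg R
    gcongr
    exact norm_fst_le (z - w)

theorem norm_controlledField_sub_le {θ θ' : ℝ → E m} {R t : ℝ} {z : E d × E d} (hz : ‖z‖ ≤ R) :
    ‖controlledField F θ t z - controlledField F θ' t z‖ ≤ A R * ‖θ t - θ' t‖ := by
  have e : controlledField F θ t z - controlledField F θ' t z =
      (F t z.1 (θ t) - F t z.1 (θ' t), 0) := by simp [controlledField]
  rw [e]
  exact norm_prod_zero_le (hF.lipschitz_theta R t z.1 _ _ ((norm_fst_le z).trans hz))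

theorem norm_controlledFieldDeriv_sub_le {θ θ' : ℝ → E m} {R t : ℝ} {z : E d × E d}
    (hz : ‖z‖ ≤ R) (hθ : ‖θ t‖ ≤ 1) (hθ' : ‖θ' t‖ ≤ 1) :
    ‖controlledFieldDeriv F θ t z - controlledFieldDeriv F θ' t z‖ ≤ A R * ‖θ t - θ' t‖ := by
  rw [controlledFieldDeriv_sub]
  exact norm_comp_fst_prod_zero_le
    (hF.gradX_lipschitz_theta R t z.1 _ _ ((norm_fst_le z).trans hz) hθ hθ')

end IsRegular

theorem exists_isC2Cost {V : Type*} [NormedAddCommGroup V] [NormedSpace ℝ V]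
    [FiniteDimensional ℝ V] {ℓ : V → ℝ} (hℓ : ContDiff ℝ 2 ℓ) : ∃ Λ, IsC2Cost ℓ Λ := by
  have h1 : ContDiff ℝ 1 (fderiv ℝ ℓ) := hℓ.fderiv_right (by norm_num)
  have hb : ∀ R : ℝ, ∃ a : ℝ, 0 ≤ a ∧ (∀ x, ‖x‖ ≤ R → ‖fderiv ℝ ℓ x‖ ≤ a) ∧
      ∀ x, ‖x‖ ≤ R → ‖fderiv ℝ (fderiv ℝ ℓ) x‖ ≤ a := by
    intro R
    have hc : IsCompact (Metric.closedBall (0 : V) R) := isCompact_closedBall _ _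
    obtain ⟨a, ha⟩ := hc.exists_bound_of_continuousOn h1.continuous.continuousOn
    obtain ⟨b, hb⟩ := hc.exists_bound_of_continuousOn
      (h1.continuous_fderiv (by norm_num)).continuousOn
    refine ⟨max 0 (max a b), le_max_left _ _, fun x hx => ?_, fun x hx => ?_⟩
    · exact (ha x (by simpa using hx)).trans ((le_max_left _ _).trans (le_max_right _ _))
    · exact (hb x (by simpa using hx)).trans ((le_max_right _ _).trans (le_max_right _ _))
  choose Λ h0 hΛ1 hΛ2 using hb
  refine ⟨Λ, hℓ.differentiable (by norm_num), fun R x y hx hy => ?_, fun R x hx => hΛ1 R x hx, h0⟩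
  exact (convex_closedBall (0 : V) R).norm_image_sub_le_of_norm_fderiv_le
    (fun z _ => h1.differentiable (by norm_num) z) (fun z hz => hΛ2 R z (by simpa using hz))
    (by simpa using hy) (by simpa using hx)

/-! ### Extension of the field to all times -/

/-- The field frozen outside the time interval `[0, T]`. -/
noncomputable def clampTime (F : ℝ → E d → E m → E d) {T : ℝ} (hT : 0 < T) (t : ℝ) :
    E d → E m → E d :=
  F (projIcc 0 T hT.le t)

/-- The growth and Lipschitz hypotheses hold off a null set of times that may depend on `θ`.
Continuity in time upgrades them to every time, removing that dependence. -/
theorem le_zero_of_ae_le {u : ℝ → ℝ} {T : ℝ} (hT : 0 < T) (hu : ContinuousOn u (Icc 0 T))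
    (h : ∀ᵐ t ∂(volume.restrict (Icc 0 T)), u t ≤ 0) : ∀ t ∈ Icc 0 T, u t ≤ 0 := by
  have h1 : (fun t => max (u t) 0) =ᵐ[volume.restrict (Icc 0 T)] fun _ => 0 := by
    filter_upwards [h] with t ht
    exact max_eq_right ht
  intro t ht
  have h2 := Measure.eqOn_Icc_of_ae_eq volume hT.ne h1 (hu.sup continuousOn_const)
    continuousOn_const ht
  exact (le_max_left _ _).trans h2.le

theorem exists_isRegular_clampTime {F : ℝ → E d → E m → E d} {T : ℝ} (hT : 0 < T)
    (h₁ : Assumption1 F T) (h₂ : Assumption2 F T) :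
    ∃ C L A, IsRegular (clampTime F hT) C L A := by
  set c : ℝ → ℝ := fun t => (projIcc 0 T hT.le t : ℝ) with hc
  have hcI : ∀ t, c t ∈ Icc 0 T := fun t => Subtype.coe_prop _
  have hcc : Continuous c := continuous_subtype_val.comp continuous_projIcc
  obtain ⟨C, hC0, hC⟩ := h₁.growth
  obtain ⟨L, hL0, hL⟩ := h₁.lipschitz
  have hct : ∀ x θ, ContinuousOn (fun t => F t x θ) (Icc 0 T) := fun x θ =>
    (h₁.continuousOn θ).comp (f := fun t => (t, x)) (by fun_prop) fun t ht => ⟨ht, mem_univ _⟩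
  have hgrow : ∀ t ∈ Icc 0 T, ∀ x θ, ‖F t x θ‖ ≤ C * (1 + ‖x‖) := by
    intro t ht x θ
    have := le_zero_of_ae_le hT ((hct x θ).norm.sub continuousOn_const)
      ((hC θ).mono fun t h => sub_nonpos.2 (h x)) t ht
    exact sub_nonpos.1 this
  have hlip : ∀ t ∈ Icc 0 T, ∀ x y θ, ‖F t x θ - F t y θ‖ ≤ L * (1 + ‖θ‖) * ‖x - y‖ := by
    intro t ht x y θ
    have := le_zero_of_ae_le hT (((hct x θ).sub (hct y θ)).norm.sub continuousOn_const)
      ((hL θ).mono fun t h => sub_nonpos.2 (h x y)) t ht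
    exact sub_nonpos.1 this
  -- The radius `R + 1` leaves a unit margin around the ball of radius `R`, so that derivatives at
  -- its points can be estimated from nearby increments.
  have hconst : ∀ R : ℝ, ∃ a : ℝ, 0 ≤ a ∧ ∀ t ∈ Icc 0 T,
      (∀ x, ‖x‖ ≤ R + 1 → ∀ θ, ‖gradTheta F t x θ‖ + ‖gradTheta2 F t x θ‖ ≤ a) ∧
      (∀ x, ‖x‖ ≤ R + 1 → ∀ θ, ‖θ‖ ≤ 1 → ‖gradX2 F t x θ‖ ≤ a) ∧
      (∀ s ∈ Icc 0 T, ∀ x, ‖x‖ ≤ R + 1 → ∀ θ₁ θ₂,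
        ‖F t x θ₁ - F s x θ₂‖ ≤ a * (|t - s| + ‖θ₁ - θ₂‖)) ∧
      ∀ x y, ‖x‖ ≤ R + 1 → ‖y‖ ≤ R + 1 → ∀ θ, ‖θ‖ ≤ 1 →
        ‖gradTheta F t x θ - gradTheta F t y θ‖ ≤ a * ‖x - y‖ := by
    intro R
    have hR : 0 < |R| + 1 := by positivity
    have hball : ∀ x : E d, ‖x‖ ≤ R + 1 → x ∈ Metric.closedBall (0 : E d) (|R| + 1) := by
      intro x hx
      rw [mem_closedBall_zero_iff]
      linarith [le_abs_self R]
    obtain ⟨a₁, ha₁⟩ := h₁.gradTheta_bound _ hR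
    obtain ⟨a₂, ha₂⟩ := h₂.x_bound _ 1 hR
    obtain ⟨a₃, ha₃⟩ := h₂.lipschitz_time_theta _ hR
    obtain ⟨a₄, ha₄⟩ := h₂.lipschitz_gradTheta _ 1 hR
    refine ⟨|a₁| + |a₂| + |a₃| + |a₄|, by positivity, fun t ht => ⟨fun x hx θ => ?_,
      fun x hx θ hθ => ?_, fun s hs x hx θ₁ θ₂ => ?_, fun x y hx hy θ hθ => ?_⟩⟩
    · have := ha₁ t ht x (hball x hx) θ
      linarith [le_abs_self a₁, abs_nonneg a₂, abs_nonneg a₃, abs_nonneg a₄]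
    · have := ha₂ t ht x (hball x hx) θ hθ 0 (by simp)
      linarith [le_abs_self a₂, abs_nonneg a₁, abs_nonneg a₃, abs_nonneg a₄,
        abs_nonneg (divGradTheta F t x θ 0), norm_nonneg (gradX F t x θ)]
    · refine (ha₃ t ht s hs x (hball x hx) θ₁ θ₂).trans ?_
      gcongr
      linarith [le_abs_self a₃, abs_nonneg a₁, abs_nonneg a₂, abs_nonneg a₄]
    · refine (ha₄ t ht x (hball x hx) y (hball y hy) θ hθ).trans ?_
      gcongr
      linarith [le_abs_self a₄, abs_nonneg a₁, abs_nonneg a₂, abs_nonneg a₃]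
  choose A hA0 hA using hconst
  have hdx : ∀ t ∈ Icc 0 T, ∀ x θ, HasFDerivAt (fun x => F t x θ) (gradX F t x θ) x :=
    fun t ht x θ => ((h₂.contDiff_x t ht θ).differentiable (by norm_num) x).hasFDerivAt
  have hdx2 : ∀ t ∈ Icc 0 T, ∀ θ, Differentiable ℝ fun x => gradX F t x θ := fun t ht θ => by
    have : ContDiff ℝ 1 (fderiv ℝ fun x => F t x θ) :=
      (h₂.contDiff_x t ht θ).fderiv_right (by norm_num)
    exact this.differentiable (by norm_num)
  have hgx : ∀ R, ∀ t ∈ Icc 0 T, ∀ x y θ, ‖x‖ ≤ R + 1 → ‖y‖ ≤ R + 1 → ‖θ‖ ≤ 1 →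
      ‖gradX F t x θ - gradX F t y θ‖ ≤ A R * ‖x - y‖ := by
    intro R t ht x y θ hx hy hθ
    exact (convex_closedBall (0 : E d) (R + 1)).norm_image_sub_le_of_norm_fderiv_le
      (f := fun x => gradX F t x θ) (fun z _ => hdx2 t ht θ z)
      (fun z hz => (hA R t ht).2.1 z (by simpa using hz) θ hθ)
      (by simpa using hy) (by simpa using hx)
  -- The mixed second difference of `F` in `(x, θ)` is symmetric. The Lipschitz bound of `∇_θ F` in
  -- `x` controls it, and dividing by `|ξ - x|` gives the Lipschitz bound of `∇ₓF` in `θ`.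
  have hgxθ : ∀ R, ∀ t ∈ Icc 0 T, ∀ x θ₁ θ₂, ‖x‖ ≤ R → ‖θ₁‖ ≤ 1 → ‖θ₂‖ ≤ 1 →
      ‖gradX F t x θ₁ - gradX F t x θ₂‖ ≤ A R * ‖θ₁ - θ₂‖ := by
    intro R t ht x θ₁ θ₂ hx hθ₁ hθ₂
    have hd : HasFDerivAt (fun ξ => F t ξ θ₁ - F t ξ θ₂) (gradX F t x θ₁ - gradX F t x θ₂) x :=
      (hdx t ht x θ₁).sub (hdx t ht x θ₂)
    have hA0R := hA0 R
    refine hd.le_of_lip' (by positivity) ?_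
    have hev : ∀ᶠ ξ in 𝓝 x, ‖ξ‖ < R + 1 :=
      continuous_norm.continuousAt.eventually_lt continuousAt_const (by linarith)
    filter_upwards [hev] with ξ hξ
    have h1 := (convex_closedBall (0 : E m) 1).norm_image_sub_le_of_norm_hasFDerivWithin_le
      (f := fun ϑ => F t ξ ϑ - F t x ϑ) (f' := fun ϑ => gradTheta F t ξ ϑ - gradTheta F t x ϑ)
      (C := A R * ‖ξ - x‖)
      (fun ϑ _ => (((h₁.differentiable t ht ξ).1 ϑ).hasFDerivAt.sub
        ((h₁.differentiable t ht x).1 ϑ).hasFDerivAt).hasFDerivWithinAt)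
      (fun ϑ hϑ => (hA R t ht).2.2.2 ξ x hξ.le (by linarith) ϑ (by simpa using hϑ))
      (x := θ₂) (y := θ₁) (by simpa using hθ₂) (by simpa using hθ₁)
    calc _ = ‖F t ξ θ₁ - F t x θ₁ - (F t ξ θ₂ - F t x θ₂)‖ := by congr 1; abel
      _ ≤ A R * ‖ξ - x‖ * ‖θ₁ - θ₂‖ := h1
      _ = _ := by ring
  -- Interpolation applied to `F(t, ·, θ) - F(t₀, ·, θ)`, which is of size `|t - t₀|` and has
  -- derivative with Lipschitz constant `2 * A R`: first `r` is fixed to make the second term small,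
  -- then `t → t₀`.
  have hgt : ∀ t₀ x θ, ‖θ‖ ≤ 1 → Tendsto (fun t => gradX F (c t) x θ) (𝓝 t₀)
      (𝓝 (gradX F (c t₀) x θ)) := by
    intro t₀ x θ hθ
    rw [Metric.tendsto_nhds]
    intro ε hε
    set R := ‖x‖ with hR
    have hA0R := hA0 R
    set r := min 1 (ε / (4 * (2 * A R + 1))) with hr
    have hr0 : 0 < r := by positivity
    have hr1 : r ≤ 1 := min_le_left _ _
    have hr2 : (2 * A R) * r ≤ ε / 4 := by
      calc (2 * A R) * r ≤ (2 * A R + 1) * (ε / (4 * (2 * A R + 1))) := by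
            gcongr; exacts [by linarith, min_le_right _ _]
        _ = ε / 4 := by field_simp
    have hlim : Tendsto (fun t => 2 * (A R * |c t - c t₀|) / r) (𝓝 t₀) (𝓝 0) := by
      have : Continuous fun t => 2 * (A R * |c t - c t₀|) / r := by fun_prop
      simpa using this.tendsto t₀
    filter_upwards [hlim.eventually_lt_const (by positivity : (0 : ℝ) < ε / 4)] with t ht
    have h1 := norm_fderiv_le_of_norm_le (g := fun ξ => F (c t) ξ θ - F (c t₀) ξ θ)
      (g' := fun ξ => gradX F (c t) ξ θ - gradX F (c t₀) ξ θ) (K := 2 * A R) (r := r)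
      (δ := A R * |c t - c t₀|) (x := x)
      (convex_closedBall (0 : E d) (R + 1))
      (fun ξ _ => (hdx _ (hcI t) ξ θ).sub (hdx _ (hcI t₀) ξ θ))
      (fun ξ hξ ζ hζ => by
        have e1 := hgx R _ (hcI t) ξ ζ θ (by simpa using hξ) (by simpa using hζ) hθ
        have e2 := hgx R _ (hcI t₀) ξ ζ θ (by simpa using hξ) (by simpa using hζ) hθ
        calc _ = ‖(gradX F (c t) ξ θ - gradX F (c t) ζ θ) -
              (gradX F (c t₀) ξ θ - gradX F (c t₀) ζ θ)‖ := by congr 1; abel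
          _ ≤ _ := (norm_sub_le _ _).trans (by linarith))
      (fun ξ hξ => by
        simpa using (hA R _ (hcI t)).2.2.1 _ (hcI t₀) ξ (by simpa using hξ) θ θ)
      hr0 (by positivity) (fun ξ hξ => by
        rw [Metric.mem_closedBall, dist_eq_norm] at hξ
        rw [mem_closedBall_zero_iff]
        linarith [norm_le_norm_add_norm_sub' ξ x])
    rw [dist_eq_norm]
    linarith
  have hcont : Continuous fun q : ℝ × E d × E m => clampTime F hT q.1 q.2.1 q.2.2 := by
    refine continuous_iff_continuousAt.2 fun ⟨t₀, x₀, θ₀⟩ => ?_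
    have hlim : Tendsto (fun q : ℝ × E d × E m => A ‖x₀‖ * (|c q.1 - c t₀| + ‖q.2.2 - θ₀‖) +
        L * (1 + ‖θ₀‖) * ‖q.2.1 - x₀‖) (𝓝 (t₀, x₀, θ₀)) (𝓝 0) := by
      have : Continuous fun q : ℝ × E d × E m => A ‖x₀‖ * (|c q.1 - c t₀| + ‖q.2.2 - θ₀‖) +
        L * (1 + ‖θ₀‖) * ‖q.2.1 - x₀‖ := by fun_prop
      simpa using this.tendsto (t₀, x₀, θ₀)
    have hev : ∀ᶠ q : ℝ × E d × E m in 𝓝 (t₀, x₀, θ₀), ‖q.2.1‖ < ‖x₀‖ + 1 :=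
      ContinuousAt.eventually_lt (by fun_prop) continuousAt_const (by simp)
    rw [ContinuousAt, tendsto_iff_norm_sub_tendsto_zero]
    refine squeeze_zero' (Eventually.of_forall fun _ => norm_nonneg _) ?_ hlim
    filter_upwards [hev] with q hq
    have e1 := (hA ‖x₀‖ _ (hcI q.1)).2.2.1 _ (hcI t₀) q.2.1 hq.le q.2.2 θ₀
    have e2 := hlip _ (hcI t₀) q.2.1 x₀ θ₀
    exact (norm_sub_le_norm_sub_add_norm_sub _ (F (c t₀) q.2.1 θ₀) _).trans (add_le_add e1 e2)
  have hgcont : Continuous fun q : ℝ × E d × E m => gradTheta F (c q.1) q.2.1 q.2.2 := by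
    refine continuous_iff_continuousAt.2 fun q₀ => ?_
    have hR : 0 < ‖q₀.2.1‖ + 1 := by positivity
    have h1 : ContinuousOn (fun q : ℝ × E d × E m => gradTheta F (c q.1) q.2.1 q.2.2)
        {q | ‖q.2.1‖ < ‖q₀.2.1‖ + 1} :=
      (h₁.gradTheta_continuousOn _ hR).comp (f := fun q : ℝ × E d × E m => (c q.1, q.2.1, q.2.2))
        (by fun_prop) fun q hq => ⟨hcI _, by simpa using (le_of_lt hq), mem_univ _⟩
    refine h1.continuousAt ((isOpen_lt (by fun_prop) continuous_const).mem_nhds ?_)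
    simp
  refine ⟨C, L, A, ⟨⟨hcont, fun t x θ => hgrow _ (hcI t) x θ, hC0.le⟩, hL0.le, hA0,
    fun t x y θ => hlip _ (hcI t) x y θ, fun t x θ => hdx _ (hcI t) x θ, ?_,
    fun t x θ => ((h₁.differentiable _ (hcI t) x).1 θ).hasFDerivAt, hgcont,
    fun R t x θ hx => ?_, fun R t x θ₁ θ₂ hx => ?_, fun R t x y θ hx hy hθ => ?_,
    fun R t x y θ hx hy hθ => ?_, fun R t x θ₁ θ₂ hx hθ₁ hθ₂ => hgxθ R _ (hcI t) x θ₁ θ₂ hx hθ₁ hθ₂⟩⟩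
  · rintro ⟨t₀, x₀, θ₀⟩ hθ₀
    have hθ₀' : ‖θ₀‖ ≤ 1 := hθ₀
    have hlim : Tendsto (fun q : ℝ × E d × E m => A ‖x₀‖ * ‖q.2.1 - x₀‖ + A ‖x₀‖ * ‖q.2.2 - θ₀‖ +
        ‖gradX F (c q.1) x₀ θ₀ - gradX F (c t₀) x₀ θ₀‖)
        (𝓝 (t₀, x₀, θ₀)) (𝓝 0) := by
      have e1 : Continuous fun q : ℝ × E d × E m =>
        A ‖x₀‖ * ‖q.2.1 - x₀‖ + A ‖x₀‖ * ‖q.2.2 - θ₀‖ := by fun_prop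
      have e2 : Tendsto (fun q : ℝ × E d × E m => q.1) (𝓝 (t₀, x₀, θ₀)) (𝓝 t₀) :=
        continuous_fst.continuousAt
      have e3 := ((tendsto_iff_norm_sub_tendsto_zero.1 (hgt t₀ x₀ θ₀ hθ₀')).comp e2)
      have e4 := (e1.tendsto (t₀, x₀, θ₀)).add e3
      simpa using e4
    have hev : ∀ᶠ q : ℝ × E d × E m in 𝓝 (t₀, x₀, θ₀), ‖q.2.1‖ < ‖x₀‖ + 1 :=
      ContinuousAt.eventually_lt (by fun_prop) continuousAt_const (by simp)
    rw [ContinuousWithinAt, tendsto_iff_norm_sub_tendsto_zero]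
    refine squeeze_zero' (Eventually.of_forall fun _ => norm_nonneg _) ?_
      (hlim.mono_left nhdsWithin_le_nhds)
    filter_upwards [nhdsWithin_le_nhds hev, self_mem_nhdsWithin] with q hq hqθ
    have e1 := hgx ‖x₀‖ _ (hcI q.1) q.2.1 x₀ q.2.2 hq.le (by linarith) hqθ
    have e2 := hgxθ ‖x₀‖ _ (hcI q.1) x₀ q.2.2 θ₀ le_rfl hqθ hθ₀'
    refine (norm_sub_le_norm_sub_add_norm_sub _ (gradX F (c q.1) x₀ θ₀) _).trans
      (add_le_add ?_ le_rfl)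
    exact (norm_sub_le_norm_sub_add_norm_sub _ (gradX F (c q.1) x₀ q.2.2) _).trans
      (add_le_add e1 e2)
  · have := (hA R _ (hcI t)).1 x (by linarith) θ
    show ‖gradTheta F (c t) x θ‖ ≤ A R
    linarith [norm_nonneg (gradTheta2 F (c t) x θ)]
  · refine convex_univ.norm_image_sub_le_of_norm_fderiv_le (𝕜 := ℝ)
      (f := fun θ => gradTheta F (c t) x θ)
      (fun θ _ => (h₁.differentiable _ (hcI t) x).2 θ) (fun θ _ => ?_) (mem_univ _) (mem_univ _)
    have := (hA R _ (hcI t)).1 x (by linarith) θ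
    show ‖gradTheta2 F (c t) x θ‖ ≤ A R
    linarith [norm_nonneg (gradTheta F (c t) x θ)]
  · exact (hA R _ (hcI t)).2.2.2 x y (by linarith) (by linarith) θ hθ
  · exact hgx R _ (hcI t) x y θ (by linarith) (by linarith) hθ

/-! ### Smooth approximation of Lipschitz functions -/

/-- Convolution with a probability density preserves the Lipschitz constant, and a bump of radius `ε
/ (κ + 1)` moves values by at most `ε`. It extends estimates for `C²` test functions to Lipschitz
ones with the same constant. -/
theorem exists_contDiff_approx {V : Type*} [NormedAddCommGroup V] [NormedSpace ℝ V]
    [FiniteDimensional ℝ V] [MeasurableSpace V] [BorelSpace V] {g : V → ℝ} {κ : ℝ≥0}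
    (hg : LipschitzWith κ g) {ε : ℝ} (hε : 0 < ε) :
    ∃ ζ : V → ℝ, ContDiff ℝ 2 ζ ∧ LipschitzWith κ ζ ∧ ∀ z, |ζ z - g z| ≤ ε := by
  let χ : ContDiffBump (0 : V) := ⟨ε / (2 * (κ + 1)), ε / (κ + 1), by positivity, by
    rw [div_lt_div_iff₀ (by positivity) (by positivity)]
    have : (0 : ℝ) ≤ κ := κ.2
    nlinarith⟩
  let μ : Measure V := Measure.addHaar
  have hgc : Continuous g := hg.continuous
  have hχc : Continuous (χ.normed μ) := χ.continuous_normed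
  have hχs : HasCompactSupport (χ.normed μ) := χ.hasCompactSupport_normed
  refine ⟨MeasureTheory.convolution (χ.normed μ) g (ContinuousLinearMap.lsmul ℝ ℝ) μ, ?_, ?_,
    fun z => ?_⟩
  · exact hχs.contDiff_convolution_left _ χ.contDiff_normed hgc.locallyIntegrable
  · refine LipschitzWith.of_dist_le_mul fun x y => ?_
    have hi : ∀ x, Integrable (fun t => χ.normed μ t * g (x - t)) μ := fun x =>
      (hχc.mul (hgc.comp (by fun_prop))).integrable_of_hasCompactSupport hχs.mul_right
    have e : ∀ x, MeasureTheory.convolution (χ.normed μ) g (ContinuousLinearMap.lsmul ℝ ℝ) μ x =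
        ∫ t, χ.normed μ t * g (x - t) ∂μ := fun x => rfl
    rw [dist_eq_norm, e, e, ← integral_sub (hi x) (hi y)]
    have h1 := norm_integral_le_of_norm_le (μ := μ)
      (f := fun t => χ.normed μ t * g (x - t) - χ.normed μ t * g (y - t))
      (g := fun t => χ.normed μ t * (κ * dist x y))
      ((hχc.mul continuous_const).integrable_of_hasCompactSupport hχs.mul_right)
      (Eventually.of_forall fun t => by
        rw [← mul_sub, norm_mul, Real.norm_of_nonneg (χ.nonneg_normed t)]
        have h2 := hg.dist_le_mul (x - t) (y - t)
        rw [dist_sub_right, dist_eq_norm] at h2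
        have := χ.nonneg_normed (μ := μ) t
        gcongr)
    rwa [integral_mul_const, χ.integral_normed, one_mul] at h1
  · have h1 := χ.dist_normed_convolution_le (μ := μ) (g := g) (x₀ := z) (ε := ε)
      hgc.aestronglyMeasurable (fun x hx => by
        refine (hg.dist_le_mul x z).trans ?_
        have h2 : dist x z ≤ ε / (κ + 1) := (Metric.mem_ball.1 hx).le
        calc (κ : ℝ) * dist x z ≤ (κ + 1) * (ε / (κ + 1)) := by gcongr; linarith
          _ = ε := by field_simp)
    rwa [Real.dist_eq] at h1

/-! ### Adjoint vectors -/

/-- The `x`-gradient of the adjoint state `(t, z) ↦ ℓ(Φ_{(t,T)}(z))`. -/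
noncomputable def adjointVector (F : ℝ → E d → E m → E d) (θ : ℝ → E m) (ℓ : E d × E d → ℝ)
    (T t : ℝ) (z : E d × E d) : E d :=
  (InnerProductSpace.toDual ℝ (E d)).symm
    ((adjointGrad (controlledField F θ) (controlledFieldDeriv F θ) ℓ T t z).comp
      (ContinuousLinearMap.inl ℝ (E d) (E d)))

/-- The integrand of the maximum principle. -/
noncomputable def controlGrad (F : ℝ → E d → E m → E d) (θ : ℝ → E m) (ℓ : E d × E d → ℝ) (T t : ℝ)
    (z : E d × E d) : E m :=
  ContinuousLinearMap.adjoint (gradTheta F t z.1 (θ t)) (adjointVector F θ ℓ T t z)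

theorem norm_comp_inl_le {W : Type*} [NormedAddCommGroup W] [NormedSpace ℝ W]
    (a : E d × E d →L[ℝ] W) : ‖a.comp (ContinuousLinearMap.inl ℝ (E d) (E d))‖ ≤ ‖a‖ := by
  refine ContinuousLinearMap.opNorm_le_bound _ (norm_nonneg _) fun v => ?_
  refine (a.le_opNorm _).trans ?_
  gcongr
  simp

theorem norm_adjointVector_sub_le (F : ℝ → E d → E m → E d) (θ θ' : ℝ → E m) (ℓ : E d × E d → ℝ)
    (T t t' : ℝ) (z z' : E d × E d) :
    ‖adjointVector F θ ℓ T t z - adjointVector F θ' ℓ T t' z'‖ ≤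
      ‖adjointGrad (controlledField F θ) (controlledFieldDeriv F θ) ℓ T t z -
        adjointGrad (controlledField F θ') (controlledFieldDeriv F θ') ℓ T t' z'‖ := by
  rw [adjointVector, adjointVector, ← map_sub, LinearIsometryEquiv.norm_map,
    ← ContinuousLinearMap.sub_comp]
  exact norm_comp_inl_le _

theorem norm_adjointVector_le (F : ℝ → E d → E m → E d) (θ : ℝ → E m) (ℓ : E d × E d → ℝ)
    (T t : ℝ) (z : E d × E d) : ‖adjointVector F θ ℓ T t z‖ ≤
      ‖adjointGrad (controlledField F θ) (controlledFieldDeriv F θ) ℓ T t z‖ := by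
  rw [adjointVector, LinearIsometryEquiv.norm_map]
  exact norm_comp_inl_le _

theorem inner_adjointVector (F : ℝ → E d → E m → E d) (θ : ℝ → E m) (ℓ : E d × E d → ℝ)
    (T t : ℝ) (z : E d × E d) (v : E d) : inner ℝ (adjointVector F θ ℓ T t z) v =
      adjointGrad (controlledField F θ) (controlledFieldDeriv F θ) ℓ T t z (v, 0) := by
  rw [adjointVector, InnerProductSpace.toDual_symm_apply]
  rfl

theorem inner_controlGrad (F : ℝ → E d → E m → E d) (θ : ℝ → E m) (ℓ : E d × E d → ℝ)
    (T t : ℝ) (z : E d × E d) (η : E m) : inner ℝ (controlGrad F θ ℓ T t z) η =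
      inner ℝ (adjointVector F θ ℓ T t z) (gradTheta F t z.1 (θ t) η) := by
  rw [controlGrad, ContinuousLinearMap.adjoint_inner_left]

theorem norm_adjoint_apply_sub_le {a b : E m →L[ℝ] E d} {p q : E d} {α β M : ℝ}
    (hab : ‖a - b‖ ≤ α) (hpq : ‖p - q‖ ≤ β) (hb : ‖b‖ ≤ M) (hp : ‖p‖ ≤ M) :
    ‖ContinuousLinearMap.adjoint a p - ContinuousLinearMap.adjoint b q‖ ≤ M * (α + β) := by
  have e : ContinuousLinearMap.adjoint a p - ContinuousLinearMap.adjoint b q =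
      ContinuousLinearMap.adjoint (a - b) p + ContinuousLinearMap.adjoint b (p - q) := by
    simp only [map_sub, sub_apply]
    abel
  have hα : 0 ≤ α := (norm_nonneg _).trans hab
  have hM : 0 ≤ M := (norm_nonneg _).trans hp
  rw [e]
  refine (norm_add_le _ _).trans ?_
  have h1 : ‖ContinuousLinearMap.adjoint (a - b) p‖ ≤ α * M := by
    refine (ContinuousLinearMap.le_opNorm _ _).trans ?_
    rw [LinearIsometryEquiv.norm_map]
    gcongr
  have h2 : ‖ContinuousLinearMap.adjoint b (p - q)‖ ≤ M * β := by
    refine (ContinuousLinearMap.le_opNorm _ _).trans ?_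
    rw [LinearIsometryEquiv.norm_map]
    gcongr
  linarith

/-- Bounds on a time interval `[0, T]` that are uniform among continuous controls with values in
the unit ball: trajectories start in the ball of radius `r` and stay in the ball of radius `R`. -/
structure UniformBounds (F : ℝ → E d → E m → E d) (ℓ : E d × E d → ℝ) (C T r R M : ℝ) : Prop where
  M_nonneg : 0 ≤ M
  R_nonneg : 0 ≤ R
  support_le : supportRadius C T r ≤ R
  flow_le : ∀ θ, IsUnitControl θ → ∀ t ∈ Icc 0 T, ∀ z, ‖z‖ ≤ r →
    ‖flow (controlledField F θ) 0 z t‖ ≤ R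
  flow_sub : ∀ θ θ', IsUnitControl θ → IsUnitControl θ' → ∀ t ∈ Icc 0 T, ∀ z z', ‖z‖ ≤ r →
    ‖z'‖ ≤ r → ‖flow (controlledField F θ) 0 z t - flow (controlledField F θ') 0 z' t‖ ≤
      M * (‖z - z'‖ + ∫ s in (0 : ℝ)..T, ‖θ s - θ' s‖)
  adjoint_le : ∀ θ, IsUnitControl θ → ∀ t ∈ Icc 0 T, ∀ z, ‖z‖ ≤ R → ‖adjointVector F θ ℓ T t z‖ ≤ M
  adjointGrad_sub : ∀ θ θ', IsUnitControl θ → IsUnitControl θ' → ∀ t ∈ Icc 0 T, ∀ z z',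
    ‖z‖ ≤ R + 1 → ‖z'‖ ≤ R + 1 →
    ‖adjointGrad (controlledField F θ) (controlledFieldDeriv F θ) ℓ T t z -
        adjointGrad (controlledField F θ') (controlledFieldDeriv F θ') ℓ T t z'‖ ≤
      M * (‖z - z'‖ + ∫ s in (0 : ℝ)..T, ‖θ s - θ' s‖)
  flow_time : ∀ θ, IsUnitControl θ → ∀ t ∈ Icc 0 T, ∀ s ∈ Icc 0 T, ∀ z, ‖z‖ ≤ r →
    ‖flow (controlledField F θ) 0 z t - flow (controlledField F θ) 0 z s‖ ≤ M * |t - s|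
  adjoint_time : ∀ θ, IsUnitControl θ → ∀ t ∈ Icc 0 T, ∀ s ∈ Icc 0 T, ∀ z, ‖z‖ ≤ r →
    ‖adjointVector F θ ℓ T t (flow (controlledField F θ) 0 z t) -
      adjointVector F θ ℓ T s (flow (controlledField F θ) 0 z s)‖ ≤ M * |t - s|
  gradTheta_le : ∀ t x θ, ‖x‖ ≤ R → ‖gradTheta F t x θ‖ ≤ M
  gradTheta_theta : ∀ t x θ₁ θ₂, ‖x‖ ≤ R → ‖gradTheta F t x θ₁ - gradTheta F t x θ₂‖ ≤ M * ‖θ₁ - θ₂‖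
  gradTheta_x : ∀ t x y θ, ‖x‖ ≤ R → ‖y‖ ≤ R → ‖θ‖ ≤ 1 →
    ‖gradTheta F t x θ - gradTheta F t y θ‖ ≤ M * ‖x - y‖
  transport : ∀ θ, IsUnitControl θ → ∀ ζ : E d × E d → ℝ, ∀ κ : ℝ≥0, LipschitzWith κ ζ →
    ∀ t ∈ Icc 0 T, ∀ s ∈ Icc 0 T, ∀ z,
    ‖adjointGrad (controlledField F θ) (controlledFieldDeriv F θ) ζ t s z‖ ≤ κ * M
  F_theta : ∀ t x θ₁ θ₂, ‖x‖ ≤ R → ‖F t x θ₁ - F t x θ₂‖ ≤ M * ‖θ₁ - θ₂‖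
  F_remainder : ∀ t x θ₁ θ₂, ‖x‖ ≤ R →
    ‖F t x θ₂ - F t x θ₁ - gradTheta F t x θ₁ (θ₂ - θ₁)‖ ≤ M * ‖θ₂ - θ₁‖ ^ 2

/-- The radius `R` must contain both the trajectories of unit controls and the supports of all weak
solutions, for arbitrary controls. Stability is used twice: from radius `r` for trajectories, and
from radius `R + 1` for adjoint gradients, with a margin for later difference quotients. One `M`
dominating every constant suffices, as `lam` is chosen afterwards. -/
theorem exists_uniformBounds {F : ℝ → E d → E m → E d} {C L : ℝ} {A : ℝ → ℝ}
    (hF : IsRegular F C L A) {ℓ : E d × E d → ℝ} {Λ : ℝ → ℝ} (hℓ : IsC2Cost ℓ Λ) {T : ℝ}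
    (hT : 0 < T) (r : ℝ) : ∃ R M, UniformBounds F ℓ C T r R M := by
  set R := max (flowRadius (2 * L) C T r) (supportRadius C T r) with hR
  have hC := hF.nonneg
  have hL := hF.L_nonneg
  have hR0 : 0 ≤ R := le_trans (by unfold supportRadius; positivity) (le_max_right _ _)
  have hsub0 : ∀ t ∈ Icc 0 T, uIcc 0 t ⊆ Icc 0 T := fun t ht => by
    rw [uIcc_of_le ht.1]; exact Icc_subset_Icc_right ht.2
  have hsubT : ∀ t ∈ Icc 0 T, uIcc t T ⊆ Icc 0 T := fun t ht => by
    rw [uIcc_of_le ht.2]; exact Icc_subset_Icc_left ht.1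
  have habs0 : ∀ t ∈ Icc 0 T, |t - 0| ≤ T := fun t ht => by
    rw [sub_zero, abs_of_nonneg ht.1]; exact ht.2
  have habsT : ∀ t ∈ Icc 0 T, |T - t| ≤ T := fun t ht => by
    rw [abs_of_nonneg (by linarith [ht.2])]; linarith [ht.1]
  have habs : ∀ t ∈ Icc 0 T, ∀ s ∈ Icc 0 T, |t - s| ≤ T := fun t ht s hs =>
    abs_le.2 ⟨by linarith [ht.1, hs.2], by linarith [ht.2, hs.1]⟩
  obtain ⟨K₁, hK₁0, hK₁⟩ := exists_stability hℓ (2 * L) C A T r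
  obtain ⟨K₂, hK₂0, hK₂⟩ := exists_stability hℓ (2 * L) C A T (R + 1)
  set a₁ := A (flowRadius (2 * L) C T r)
  set a₂ := A (flowRadius (2 * L) C T (R + 1))
  have ha₁ : 0 ≤ a₁ := hF.A_nonneg _
  have ha₂ : 0 ≤ a₂ := hF.A_nonneg _
  set P := Λ (flowRadius (2 * L) C T R) * Real.exp (2 * (2 * L * T)) with hP
  have hP0 : 0 ≤ P := mul_nonneg (hℓ.nonneg _) (Real.exp_pos _).le
  set Mv := C * (1 + R) with hMv
  have hMv0 : 0 ≤ Mv := by positivity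
  have hAR := hF.A_nonneg R
  set M := K₁ * (1 + a₁) + K₂ * (1 + a₂) + P + Mv + P * (2 * L) + A R +
    Real.exp (2 * (2 * L * T)) with hM
  have hexp := Real.exp_pos (2 * (2 * L * T))
  have m1 : 0 ≤ K₁ * (1 + a₁) := by positivity
  have m2 : 0 ≤ K₂ * (1 + a₂) := by positivity
  have m3 : 0 ≤ P * (2 * L) := by positivity
  have b1 : K₁ * (1 + a₁) ≤ M := by linarith
  have b2 : K₂ * (1 + a₂) ≤ M := by linarith
  have b3 : P ≤ M := by linarith
  have b4 : Mv ≤ M := by linarith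
  have b5 : P * (2 * L) ≤ M := by linarith
  have b6 : A R ≤ M := by linarith
  have b7 : Real.exp (2 * (2 * L * T)) ≤ M := by linarith
  have hflow : ∀ θ, IsUnitControl θ → ∀ t ∈ Icc 0 T, ∀ z, ‖z‖ ≤ r →
      ‖flow (controlledField F θ) 0 z t‖ ≤ R := fun θ hθ t ht z hz =>
    ((hF.isC2Field hθ).norm_flow_le_radius hz (habs0 t ht)).trans (le_max_left _ _)
  have hint : ∀ {θ θ' : ℝ → E m}, IsUnitControl θ → IsUnitControl θ' → ∀ (a : ℝ), 0 ≤ a →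
      ∀ t ∈ Icc 0 T, ∀ s ∈ Icc 0 T,
      |∫ q in t..s, ‖a * ‖θ q - θ' q‖‖| ≤ a * ∫ q in (0 : ℝ)..T, ‖θ q - θ' q‖ := by
    intro θ θ' hθ hθ' a ha t ht s hs
    have hc : Continuous fun q => ‖θ q - θ' q‖ := (hθ.continuous.sub hθ'.continuous).norm
    have e : ∀ q, ‖a * ‖θ q - θ' q‖‖ = a * ‖θ q - θ' q‖ := fun q =>
      Real.norm_of_nonneg (by positivity)
    simp only [e]
    rw [intervalIntegral.integral_const_mul, abs_mul, abs_of_nonneg ha]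
    gcongr
    have h1 := intervalIntegral.abs_integral_mono_interval (a := t) (b := s) (c := 0) (d := T)
      (f := fun q => ‖θ q - θ' q‖) (μ := volume)
      (uIoc_subset_uIoc_of_uIcc_subset_uIcc (uIcc_subset_uIcc
        (by rwa [uIcc_of_le hT.le]) (by rwa [uIcc_of_le hT.le])))
      (Eventually.of_forall fun _ => norm_nonneg _) (hc.intervalIntegrable _ _)
    rwa [abs_of_nonneg (intervalIntegral.integral_nonneg hT.le fun _ _ => norm_nonneg _)] at h1
  have hI0 : ∀ θ θ' : ℝ → E m, 0 ≤ ∫ q in (0 : ℝ)..T, ‖θ q - θ' q‖ := fun θ θ' =>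
    intervalIntegral.integral_nonneg hT.le fun _ _ => norm_nonneg _
  have hei : ∀ {θ θ' : ℝ → E m}, IsUnitControl θ → IsUnitControl θ' → ∀ a t s : ℝ,
      IntervalIntegrable (fun q => a * ‖θ q - θ' q‖) volume t s := fun hθ hθ' a t s =>
    (continuous_const.mul (hθ.continuous.sub hθ'.continuous).norm).intervalIntegrable _ _
  have h0I : (0 : ℝ) ∈ Icc 0 T := ⟨le_rfl, hT.le⟩
  have hTI : T ∈ Icc 0 T := ⟨hT.le, le_rfl⟩
  refine ⟨R, M, ⟨m1.trans b1, hR0, le_max_right _ _, hflow, ?_, ?_, ?_, ?_, ?_, ?_, ?_, ?_, ?_,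
    ?_, ?_⟩⟩
  · intro θ θ' hθ hθ' t ht z z' hz hz'
    have h1 := (hK₁ _ _ _ _ (hF.isC2Field hθ) (hF.isC2Field hθ') (fun q => a₁ * ‖θ q - θ' q‖) _ 0 T
      (habsT 0 h0I) (fun s _ w hw => ⟨hF.norm_controlledField_sub_le hw,
        hF.norm_controlledFieldDeriv_sub_le hw (hθ.norm_le s) (hθ'.norm_le s)⟩)
      (hei hθ hθ' _ _ _) (hint hθ hθ' a₁ ha₁ 0 h0I T hTI) z z' hz hz').1 t
      (by rwa [uIcc_of_le hT.le])
    refine h1.trans ?_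
    have := hI0 θ θ'
    have hn := norm_nonneg (z - z')
    calc _ ≤ K₁ * ((1 + a₁) * (‖z - z'‖ + ∫ q in (0 : ℝ)..T, ‖θ q - θ' q‖)) := by
          gcongr; nlinarith
      _ = K₁ * (1 + a₁) * (‖z - z'‖ + ∫ q in (0 : ℝ)..T, ‖θ q - θ' q‖) := by ring
      _ ≤ _ := by gcongr
  · intro θ hθ t ht z hz
    exact (norm_adjointVector_le _ _ _ _ _ _).trans
      (((hF.isC2Field hθ).norm_adjointGrad_le hℓ hz (habsT t ht)).trans b3)
  · intro θ θ' hθ hθ' t ht z z' hz hz'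
    have h1 := (hK₂ _ _ _ _ (hF.isC2Field hθ) (hF.isC2Field hθ') (fun q => a₂ * ‖θ q - θ' q‖) _ t T
      (habsT t ht) (fun s _ w hw => ⟨hF.norm_controlledField_sub_le hw,
        hF.norm_controlledFieldDeriv_sub_le hw (hθ.norm_le s) (hθ'.norm_le s)⟩)
      (hei hθ hθ' _ _ _) (hint hθ hθ' a₂ ha₂ t ht T hTI) z z' hz hz').2
    refine h1.trans ?_
    have := hI0 θ θ'
    have hn := norm_nonneg (z - z')
    calc _ ≤ K₂ * ((1 + a₂) * (‖z - z'‖ + ∫ q in (0 : ℝ)..T, ‖θ q - θ' q‖)) := by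
          gcongr; nlinarith
      _ = K₂ * (1 + a₂) * (‖z - z'‖ + ∫ q in (0 : ℝ)..T, ‖θ q - θ' q‖) := by ring
      _ ≤ _ := by gcongr
  · intro θ hθ t ht s hs z hz
    have hf := hF.isC2Field hθ
    refine ((convex_Icc (0 : ℝ) T).norm_image_sub_le_of_norm_hasDerivWithin_le
      (fun q _ => (hf.hasDerivAt_flow 0 z q).hasDerivWithinAt) (C := Mv) (fun q hq => ?_) hs
      ht).trans (by rw [Real.norm_eq_abs]; gcongr)
    refine norm_prod_zero_le ((hF.growth q _ _).trans ?_)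
    rw [hMv]
    gcongr
    exact (norm_fst_le _).trans (hflow θ hθ q hq z hz)
  · intro θ hθ t ht s hs z hz
    have hf := hF.isC2Field hθ
    refine (norm_adjointVector_sub_le _ _ _ _ _ _ _ _ _).trans ?_
    rw [hf.adjointGrad_flow, hf.adjointGrad_flow]
    refine ((convex_Icc (0 : ℝ) T).norm_image_sub_le_of_norm_hasDerivWithin_le
      (fun q _ => (hf.hasDerivAt_costate ℓ T (flow (controlledField F θ) 0 z T)
        q).hasDerivWithinAt) (C := P * (2 * L)) (fun q hq => ?_) hs
      ht).trans (by rw [Real.norm_eq_abs]; gcongr)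
    rw [norm_neg]
    refine (ContinuousLinearMap.opNorm_comp_le _ _).trans ?_
    have h1 := hf.norm_fderiv_le q (flow (controlledField F θ) T
      (flow (controlledField F θ) 0 z T) q)
    have h2 := hf.norm_adjointGrad_le hℓ (hflow θ hθ q hq z hz) (habsT q hq)
    rw [hf.adjointGrad_flow] at h2
    gcongr
  · intro t x θ hx
    exact (hF.norm_gradTheta_le R t x θ hx).trans b6
  · intro t x θ₁ θ₂ hx
    exact (hF.gradTheta_lipschitz_theta R t x θ₁ θ₂ hx).trans (by gcongr)
  · intro t x y θ hx hy hθ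
    exact (hF.gradTheta_lipschitz_x R t x y θ hx hy hθ).trans (by gcongr)
  · intro θ hθ ζ κ hζ t ht s hs z
    have hf := hF.isC2Field hθ
    refine (hf.norm_costate_le _ _ _ _).trans ?_
    have h1 := norm_fderiv_le_of_lipschitz ℝ hζ (x₀ := flow (controlledField F θ) s z t)
    have h2 := habs s hs t ht
    calc _ ≤ κ * Real.exp (2 * (2 * L * T)) := by gcongr
      _ ≤ _ := by gcongr
  · intro t x θ₁ θ₂ hx
    exact (hF.lipschitz_theta R t x θ₁ θ₂ hx).trans (by gcongr)
  · intro t x θ₁ θ₂ hx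
    exact (hF.remainder_theta R t x θ₁ θ₂ hx).trans (by gcongr)

/-! ### Comparison of a weak solution with the solution of a continuous control -/

/-- The pullback is transported by the field of `θ`, so in the direction `(1, v, 0)` only the
discrepancy `v - F(θ)` survives. -/
theorem fderiv_pullback_apply {F : ℝ → E d → E m → E d} {C L : ℝ} {A : ℝ → ℝ}
    (hF : IsRegular F C L A) {ℓ : E d × E d → ℝ} {Λ : ℝ → ℝ} (hℓ : IsC2Cost ℓ Λ) {θ : ℝ → E m}
    (hθ : IsUnitControl θ) (τ s : ℝ) (z : E d × E d) (v : E d) :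
    fderiv ℝ (fun q : ℝ × (E d × E d) => ℓ (flow (controlledField F θ) q.1 q.2 τ)) (s, z)
      (1, v, 0) = adjointGrad (controlledField F θ) (controlledFieldDeriv F θ) ℓ τ s z
        (v - F s z.1 (θ s), 0) := by
  rw [((hF.isC2Field hθ).hasFDerivAt_pullback_uncurry hℓ τ s z).fderiv]
  have e : ((v - F s z.1 (θ s), 0) : E d × E d) = (v, 0) - (F s z.1 (θ s), 0) := by simp
  rw [e, map_sub]
  simp [controlledField]

theorem integrable_of_continuous {W : Type*} [NormedAddCommGroup W] {μ : Measure (E d × E d)}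
    [IsFiniteMeasure μ] {R : ℝ} (hμ : μ (Metric.closedBall 0 R)ᶜ = 0) {g : E d × E d → W}
    (hg : Continuous g) : Integrable g μ := by
  have h1 : μ.restrict (Metric.closedBall 0 R) = μ :=
    Measure.restrict_eq_self_of_ae_mem (by rwa [ae_iff])
  rw [← h1]
  exact hg.continuousOn.integrableOn_compact (isCompact_closedBall 0 R)

theorem IsControl.aestronglyMeasurable {T : ℝ} {θ : ℝ → E m} (hθ : IsControl T θ) :
    AEStronglyMeasurable θ (volume.restrict (Icc 0 T)) := MemLp.aestronglyMeasurable hθ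

theorem IsUnitControl.isControl {T : ℝ} {θ : ℝ → E m} (hθ : IsUnitControl θ) : IsControl T θ :=
  MemLp.of_bound hθ.continuous.aestronglyMeasurable 1 (Eventually.of_forall hθ.norm_le)

theorem IsControl.sub {T : ℝ} {θ θ' : ℝ → E m} (hθ : IsControl T θ) (hθ' : IsControl T θ') :
    IsControl T fun t => θ t - θ' t := MemLp.sub hθ hθ'

theorem IsControl.intervalIntegrable {T : ℝ} {θ : ℝ → E m} (hθ : IsControl T θ) (hT : 0 < T) :
    IntervalIntegrable θ volume 0 T := by
  rw [intervalIntegrable_iff_integrableOn_Icc_of_le hT.le]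
  exact (MemLp.integrable (by norm_num) hθ)

theorem IsControl.intervalIntegrable_sq {T : ℝ} {θ : ℝ → E m} (hθ : IsControl T θ) (hT : 0 < T) :
    IntervalIntegrable (fun t => ‖θ t‖ ^ 2) volume 0 T := by
  rw [intervalIntegrable_iff_integrableOn_Icc_of_le hT.le]
  exact MemLp.integrable_norm_pow hθ (by norm_num)

section Comparison

variable {F : ℝ → E d → E m → E d} {C L : ℝ} {A : ℝ → ℝ} {ℓ : E d × E d → ℝ} {T r R M : ℝ}
  {θ θ' : ℝ → E m} {μ₀ : Measure (E d × E d)} {μ : ℝ → Measure (E d × E d)}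

theorem UniformBounds.support (hB : UniformBounds F ℓ C T r R M) (hF : IsRegular F C L A)
    (hT : 0 < T) (hμ₀ : μ₀ (Metric.closedBall 0 r)ᶜ = 0) (hθ' : IsControl T θ')
    (hμ : IsWeakSolution F T θ' μ₀ μ) {t : ℝ} (ht : t ∈ Icc 0 T) :
    μ t (Metric.closedBall 0 R)ᶜ = 0 :=
  measure_mono_null (compl_subset_compl.2 (Metric.closedBall_subset_closedBall hB.support_le))
    (hμ.support hF.toIsControlField hT hθ'.aestronglyMeasurable hμ₀ ht)

/-- Evolution of the integral of the pullback of `ζ` along the flow of the continuous control `θ`,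
against a weak solution for another control. -/
theorem UniformBounds.integral_pullback (hB : UniformBounds F ℓ C T r R M) (hF : IsRegular F C L A)
    (hT : 0 < T) (hμ₀ : μ₀ (Metric.closedBall 0 r)ᶜ = 0) (hθ : IsUnitControl θ)
    (hθ' : IsControl T θ') (hμ : IsWeakSolution F T θ' μ₀ μ) {ζ : E d × E d → ℝ} {Λ : ℝ → ℝ}
    (hζ : IsC2Cost ζ Λ) {t : ℝ} (ht : t ∈ Icc 0 T) :
    IntervalIntegrable (fun s => ∫ z, adjointGrad (controlledField F θ) (controlledFieldDeriv F θ)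
        ζ t s z (F s z.1 (θ' s) - F s z.1 (θ s), 0) ∂(μ s)) volume 0 T ∧
      ∫ z, ζ z ∂(μ t) - ∫ z, ζ (flow (controlledField F θ) 0 z t) ∂μ₀ =
      ∫ s in (0 : ℝ)..t, ∫ z, adjointGrad (controlledField F θ) (controlledFieldDeriv F θ)
        ζ t s z (F s z.1 (θ' s) - F s z.1 (θ s), 0) ∂(μ s) := by
  have hf := hF.isC2Field hθ
  have h1 := hμ.integral_sub_of_support hF.toIsControlField hT hθ'.aestronglyMeasurable
    (fun t ht => hB.support hF hT hμ₀ hθ' hμ ht) (hf.contDiff_pullback hζ t)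
  simp only [fderiv_pullback_apply hF hζ hθ] at h1
  refine ⟨h1.1, ?_⟩
  rw [← h1.2 0 ⟨le_rfl, hT.le⟩ t ht, hμ.initial]
  simp only [hf.flow_self]

/-- Stability by duality: the weak solution is tested with the pullback of `ζ` by the flow of `θ`.
One factor `M` bounds the expansion of gradients under this flow, the other the dependence of `F` on
the control. Only the Lipschitz constant of `ζ` enters, which permits approximation. -/
theorem UniformBounds.abs_integral_sub_le_of_contDiff (hB : UniformBounds F ℓ C T r R M)
    (hF : IsRegular F C L A) (hT : 0 < T) (hμ₀ : μ₀ (Metric.closedBall 0 r)ᶜ = 0)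
    (hθ : IsUnitControl θ) (hθ' : IsControl T θ') (hμ : IsWeakSolution F T θ' μ₀ μ)
    {ζ : E d × E d → ℝ} (hζ : ContDiff ℝ 2 ζ) {κ : ℝ≥0} (hκ : LipschitzWith κ ζ) {t : ℝ}
    (ht : t ∈ Icc 0 T) :
    |∫ z, ζ z ∂(μ t) - ∫ z, ζ (flow (controlledField F θ) 0 z t) ∂μ₀| ≤
      κ * M ^ 2 * ∫ s in (0 : ℝ)..T, ‖θ' s - θ s‖ := by
  obtain ⟨Λ, hΛ⟩ := exists_isC2Cost hζ
  have hη : IntervalIntegrable (fun s => ‖θ' s - θ s‖) volume 0 T :=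
    ((hθ'.sub hθ.isControl).intervalIntegrable hT).norm
  have hM := hB.M_nonneg
  rw [(hB.integral_pullback hF hT hμ₀ hθ hθ' hμ hΛ ht).2, ← Real.norm_eq_abs]
  have hsub : uIcc 0 t ⊆ uIcc 0 T := by
    rw [uIcc_of_le ht.1, uIcc_of_le hT.le]; exact Icc_subset_Icc_right ht.2
  have hη' := hη.mono_set hsub
  have h1 : ‖∫ s in (0 : ℝ)..t, ∫ z, adjointGrad (controlledField F θ) (controlledFieldDeriv F θ)
        ζ t s z (F s z.1 (θ' s) - F s z.1 (θ s), 0) ∂(μ s)‖ ≤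
      ∫ s in (0 : ℝ)..t, κ * M ^ 2 * ‖θ' s - θ s‖ := by
    refine intervalIntegral.norm_integral_le_of_norm_le ht.1 (ae_of_all _ fun s hs => ?_)
      (hη'.const_mul _)
    have hsT : s ∈ Icc 0 T := ⟨hs.1.le, hs.2.trans ht.2⟩
    have := (hμ.prob s hsT).1
    have h2 := norm_integral_le_of_norm_le_const (μ := μ s) (C := κ * M ^ 2 * ‖θ' s - θ s‖)
      (f := fun z => adjointGrad (controlledField F θ) (controlledFieldDeriv F θ)
        ζ t s z (F s z.1 (θ' s) - F s z.1 (θ s), 0)) (by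
        have h3 := hB.support hF hT hμ₀ hθ' hμ hsT
        rw [← mem_ae_iff] at h3
        filter_upwards [h3] with z hz
        have hz' : ‖z‖ ≤ R := by simpa using hz
        refine (ContinuousLinearMap.le_opNorm _ _).trans ?_
        have h4 := hB.transport θ hθ ζ κ hκ t ht s hsT z
        have h5 : ‖((F s z.1 (θ' s) - F s z.1 (θ s), 0) : E d × E d)‖ ≤ M * ‖θ' s - θ s‖ :=
          norm_prod_zero_le (hB.F_theta _ _ _ _ ((norm_fst_le z).trans hz'))
        calc _ ≤ κ * M * (M * ‖θ' s - θ s‖) := by gcongr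
          _ = _ := by ring)
    simpa using h2
  refine h1.trans ?_
  rw [intervalIntegral.integral_const_mul]
  gcongr
  exact intervalIntegral.integral_mono_interval le_rfl ht.1 ht.2
    (Eventually.of_forall fun _ => norm_nonneg _) hη

theorem UniformBounds.abs_integral_sub_le (hB : UniformBounds F ℓ C T r R M)
    (hF : IsRegular F C L A) (hT : 0 < T) (hμ₀ : μ₀ (Metric.closedBall 0 r)ᶜ = 0)
    (hθ : IsUnitControl θ) (hθ' : IsControl T θ') (hμ : IsWeakSolution F T θ' μ₀ μ)
    {g : E d × E d → ℝ} {κ : ℝ≥0} (hκ : LipschitzWith κ g) {t : ℝ} (ht : t ∈ Icc 0 T) :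
    |∫ z, g z ∂(μ t) - ∫ z, g (flow (controlledField F θ) 0 z t) ∂μ₀| ≤
      κ * M ^ 2 * ∫ s in (0 : ℝ)..T, ‖θ' s - θ s‖ := by
  have hp := (hμ.prob t ht).1
  have hp0 := (hμ.prob 0 ⟨le_rfl, hT.le⟩).1
  rw [hμ.initial] at hp0
  have hX : Continuous fun z => flow (controlledField F θ) 0 z t :=
    ((hF.isC2Field hθ).continuous_flow_uncurry 0).comp (f := fun z => (t, z)) (by fun_prop)
  have hsupp := hB.support hF hT hμ₀ hθ' hμ ht
  refine le_of_forall_pos_le_add fun ε hε => ?_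
  obtain ⟨ζ, hζ, hζκ, hζg⟩ := exists_contDiff_approx hκ (half_pos hε)
  have h1 := hB.abs_integral_sub_le_of_contDiff hF hT hμ₀ hθ hθ' hμ hζ hζκ ht
  have close : ∀ (ν : Measure (E d × E d)) [IsProbabilityMeasure ν] (ρ : ℝ)
      (_ : ν (Metric.closedBall 0 ρ)ᶜ = 0) (Y : E d × E d → E d × E d), Continuous Y →
      |∫ z, g (Y z) ∂ν - ∫ z, ζ (Y z) ∂ν| ≤ ε / 2 := by
    intro ν _ ρ hν Y hY
    have i1 : Integrable (fun z => g (Y z)) ν :=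
      integrable_of_continuous hν (hκ.continuous.comp hY)
    have i2 : Integrable (fun z => ζ (Y z)) ν :=
      integrable_of_continuous hν (hζ.continuous.comp hY)
    rw [← integral_sub i1 i2, ← Real.norm_eq_abs]
    have := norm_integral_le_of_norm_le_const (μ := ν) (C := ε / 2)
      (f := fun z => g (Y z) - ζ (Y z)) (Eventually.of_forall fun z => by
        rw [norm_sub_rev]; exact hζg _)
    simpa using this
  have h2 := close (μ t) R hsupp (fun z => z) continuous_id
  have h3 := close μ₀ r hμ₀ _ hX
  rw [abs_le] at *
  constructor <;> linarith

/-- The vector-valued case with the same constant: the scalar estimate is applied to `⟨D, g⟩`, where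
`D` is the difference to be bounded, giving `‖D‖² ≤ ‖D‖ · N M² ‖θ' - θ‖_{L¹}`. Since `g` is
Lipschitz only on the ball, `⟨D, g⟩` is first extended from it. -/
theorem UniformBounds.norm_integral_sub_le {W : Type*} [NormedAddCommGroup W]
    [InnerProductSpace ℝ W] [CompleteSpace W] (hB : UniformBounds F ℓ C T r R M)
    (hF : IsRegular F C L A) (hT : 0 < T) (hμ₀ : μ₀ (Metric.closedBall 0 r)ᶜ = 0)
    (hθ : IsUnitControl θ) (hθ' : IsControl T θ') (hμ : IsWeakSolution F T θ' μ₀ μ)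
    {g : E d × E d → W} (hg : Continuous g) {N : ℝ≥0}
    (hN : LipschitzOnWith N g (Metric.closedBall 0 R)) {t : ℝ} (ht : t ∈ Icc 0 T) :
    ‖∫ z, g z ∂(μ t) - ∫ z, g (flow (controlledField F θ) 0 z t) ∂μ₀‖ ≤
      N * M ^ 2 * ∫ s in (0 : ℝ)..T, ‖θ' s - θ s‖ := by
  have hp := (hμ.prob t ht).1
  have hp0 := (hμ.prob 0 ⟨le_rfl, hT.le⟩).1
  rw [hμ.initial] at hp0
  have hX : Continuous fun z => flow (controlledField F θ) 0 z t :=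
    ((hF.isC2Field hθ).continuous_flow_uncurry 0).comp (f := fun z => (t, z)) (by fun_prop)
  have hsupp := hB.support hF hT hμ₀ hθ' hμ ht
  set D := ∫ z, g z ∂(μ t) - ∫ z, g (flow (controlledField F θ) 0 z t) ∂μ₀ with hD
  have hLip : LipschitzOnWith (‖D‖₊ * N) (fun z => (inner ℝ D (g z) : ℝ))
      (Metric.closedBall 0 R) := by
    refine LipschitzOnWith.of_dist_le_mul fun x hx y hy => ?_
    have h1 := hN.dist_le_mul x hx y hy
    rw [Real.dist_eq, ← inner_sub_right]
    refine (abs_real_inner_le_norm _ _).trans ?_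
    rw [dist_eq_norm (g x)] at h1
    push_cast
    rw [mul_assoc]
    gcongr
  obtain ⟨G, hG, hGeq⟩ := hLip.extend_real
  have h1 := hB.abs_integral_sub_le hF hT hμ₀ hθ hθ' hμ hG ht
  have e1 : ∫ z, G z ∂(μ t) = inner ℝ D (∫ z, g z ∂(μ t)) := by
    rw [← integral_inner (integrable_of_continuous hsupp hg)]
    rw [← mem_ae_iff] at hsupp
    refine integral_congr_ae ?_
    filter_upwards [hsupp] with z hz using (hGeq hz).symm
  have e2 : ∫ z, G (flow (controlledField F θ) 0 z t) ∂μ₀ =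
      inner ℝ D (∫ z, g (flow (controlledField F θ) 0 z t) ∂μ₀) := by
    have i2 : Integrable (fun z => g (flow (controlledField F θ) 0 z t)) μ₀ :=
      integrable_of_continuous hμ₀ (hg.comp hX)
    rw [← integral_inner i2]
    rw [← mem_ae_iff] at hμ₀
    refine integral_congr_ae ?_
    filter_upwards [hμ₀] with z hz
    refine (hGeq ?_).symm
    have hz' : ‖z‖ ≤ r := by simpa using hz
    simpa using hB.flow_le θ hθ t ht z hz'
  rw [e1, e2, ← inner_sub_right, ← hD, real_inner_self_eq_norm_sq] at h1
  rw [abs_of_nonneg (by positivity)] at h1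
  push_cast at h1
  have hI : 0 ≤ ∫ s in (0 : ℝ)..T, ‖θ' s - θ s‖ :=
    intervalIntegral.integral_nonneg hT.le fun _ _ => norm_nonneg _
  rcases (norm_nonneg D).eq_or_lt with h0 | h0
  · rw [← h0]; positivity
  · nlinarith

end Comparison

/-- The right-hand side of the maximum principle, along the flow of the control. -/
noncomputable def meanControlGrad (F : ℝ → E d → E m → E d) (θ : ℝ → E m) (ℓ : E d × E d → ℝ)
    (T : ℝ) (μ₀ : Measure (E d × E d)) (t : ℝ) : E m :=
  ∫ z, controlGrad F θ ℓ T t (flow (controlledField F θ) 0 z t) ∂μ₀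

/-! ### Continuity of the integrand and of its mean over trajectories -/

section Continuity

variable {F : ℝ → E d → E m → E d} {C L : ℝ} {A : ℝ → ℝ} {ℓ : E d × E d → ℝ} {Λ : ℝ → ℝ}
  {T : ℝ} {θ : ℝ → E m}

theorem continuous_adjointVector (hF : IsRegular F C L A) (hℓ : IsC2Cost ℓ Λ)
    (hθ : IsUnitControl θ) :
    Continuous fun q : ℝ × (E d × E d) => adjointVector F θ ℓ T q.1 q.2 := by
  unfold adjointVector
  exact (LinearIsometryEquiv.continuous _).comp
    (((hF.isC2Field hθ).continuous_adjointGrad hℓ T).clm_comp continuous_const)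

theorem continuous_controlGrad (hF : IsRegular F C L A) (hℓ : IsC2Cost ℓ Λ)
    (hθ : IsUnitControl θ) :
    Continuous fun q : ℝ × (E d × E d) => controlGrad F θ ℓ T q.1 q.2 := by
  have h1 : Continuous fun q : ℝ × (E d × E d) => gradTheta F q.1 q.2.1 (θ q.1) :=
    hF.continuous_gradTheta.comp (f := fun q : ℝ × (E d × E d) => (q.1, q.2.1, θ q.1))
      (by have := hθ.continuous; fun_prop)
  exact ((LinearIsometryEquiv.continuous _).comp h1).clm_apply (continuous_adjointVector hF hℓ hθ)

theorem continuous_controlGrad_flow (hF : IsRegular F C L A) (hℓ : IsC2Cost ℓ Λ)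
    (hθ : IsUnitControl θ) : Continuous fun q : ℝ × (E d × E d) =>
      controlGrad F θ ℓ T q.1 (flow (controlledField F θ) 0 q.2 q.1) :=
  (continuous_controlGrad hF hℓ hθ).comp (f := fun q : ℝ × (E d × E d) =>
    (q.1, flow (controlledField F θ) 0 q.2 q.1))
    (continuous_fst.prodMk ((hF.isC2Field hθ).continuous_flow_uncurry 0))

theorem integrable_controlGrad_flow (hF : IsRegular F C L A) (hℓ : IsC2Cost ℓ Λ)
    (hθ : IsUnitControl θ) {μ₀ : Measure (E d × E d)} [IsProbabilityMeasure μ₀] {r : ℝ}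
    (hμ₀ : μ₀ (Metric.closedBall 0 r)ᶜ = 0) (t : ℝ) :
    Integrable (fun z => controlGrad F θ ℓ T t (flow (controlledField F θ) 0 z t)) μ₀ :=
  integrable_of_continuous hμ₀
    ((continuous_controlGrad_flow hF hℓ hθ).comp (f := fun z => (t, z)) (by fun_prop))

theorem continuous_meanControlGrad (hF : IsRegular F C L A) (hℓ : IsC2Cost ℓ Λ)
    (hθ : IsUnitControl θ) {μ₀ : Measure (E d × E d)} [IsProbabilityMeasure μ₀] {r : ℝ}
    (hμ₀ : μ₀ (Metric.closedBall 0 r)ᶜ = 0) : Continuous (meanControlGrad F θ ℓ T μ₀) := by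
  have h1 : μ₀.restrict (Metric.closedBall 0 r) = μ₀ :=
    Measure.restrict_eq_self_of_ae_mem (by rwa [ae_iff])
  have h2 := continuous_parametric_integral_of_continuous (μ := μ₀)
    (f := fun t z => controlGrad F θ ℓ T t (flow (controlledField F θ) 0 z t))
    (continuous_controlGrad_flow hF hℓ hθ) (isCompact_closedBall (0 : E d × E d) r)
  rwa [h1] at h2

end Continuity

/-! ### Contraction and quadratic optimality gap for large `lam` -/

namespace UniformBounds

variable {F : ℝ → E d → E m → E d} {C L : ℝ} {A : ℝ → ℝ} {ℓ : E d × E d → ℝ} {Λ : ℝ → ℝ}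
  {T r R M : ℝ} {θ θ' : ℝ → E m} {μ₀ : Measure (E d × E d)} {μ : ℝ → Measure (E d × E d)}

theorem norm_controlGrad_le (hB : UniformBounds F ℓ C T r R M) (hθ : IsUnitControl θ) {t : ℝ}
    (ht : t ∈ Icc 0 T) {z : E d × E d} (hz : ‖z‖ ≤ R) : ‖controlGrad F θ ℓ T t z‖ ≤ M ^ 2 := by
  have hM := hB.M_nonneg
  refine (ContinuousLinearMap.le_opNorm _ _).trans ?_
  rw [LinearIsometryEquiv.norm_map, sq]
  have h1 := hB.gradTheta_le t z.1 (θ t) ((norm_fst_le z).trans hz)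
  have h2 := hB.adjoint_le θ hθ t ht z hz
  gcongr

theorem norm_controlGrad_sub_le (hB : UniformBounds F ℓ C T r R M) (hθ : IsUnitControl θ)
    (hθ' : IsUnitControl θ') {t : ℝ} (ht : t ∈ Icc 0 T) {z z' : E d × E d} (hz : ‖z‖ ≤ R)
    (hz' : ‖z'‖ ≤ R) : ‖controlGrad F θ ℓ T t z - controlGrad F θ' ℓ T t z'‖ ≤
      M ^ 2 * (2 * ‖z - z'‖ + ‖θ t - θ' t‖ + ∫ s in (0 : ℝ)..T, ‖θ s - θ' s‖) := by
  have hM := hB.M_nonneg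
  have hx := (norm_fst_le z).trans hz
  have hx' := (norm_fst_le z').trans hz'
  have h1 : ‖gradTheta F t z.1 (θ t) - gradTheta F t z'.1 (θ' t)‖ ≤
      M * (‖z - z'‖ + ‖θ t - θ' t‖) := by
    have a1 := hB.gradTheta_x t z.1 z'.1 (θ t) hx hx' (hθ.norm_le t)
    have a2 := hB.gradTheta_theta t z'.1 (θ t) (θ' t) hx'
    have a3 : ‖z.1 - z'.1‖ ≤ ‖z - z'‖ := norm_fst_le (z - z')
    have a4 : M * ‖z.1 - z'.1‖ ≤ M * ‖z - z'‖ := by gcongr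
    have a5 := norm_sub_le_norm_sub_add_norm_sub (gradTheta F t z.1 (θ t))
      (gradTheta F t z'.1 (θ t)) (gradTheta F t z'.1 (θ' t))
    linarith
  have h2 : ‖adjointVector F θ ℓ T t z - adjointVector F θ' ℓ T t z'‖ ≤
      M * (‖z - z'‖ + ∫ s in (0 : ℝ)..T, ‖θ s - θ' s‖) :=
    (norm_adjointVector_sub_le _ _ _ _ _ _ _ _ _).trans
      (hB.adjointGrad_sub θ θ' hθ hθ' t ht z z' (by linarith) (by linarith))
  refine (norm_adjoint_apply_sub_le h1 h2 (hB.gradTheta_le _ _ _ hx')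
    (hB.adjoint_le θ hθ t ht z hz)).trans (le_of_eq ?_)
  ring

theorem lipschitzOnWith_controlGrad (hB : UniformBounds F ℓ C T r R M) (hθ : IsUnitControl θ)
    {t : ℝ} (ht : t ∈ Icc 0 T) : LipschitzOnWith (2 * M ^ 2).toNNReal
      (fun z => controlGrad F θ ℓ T t z) (Metric.closedBall 0 R) := by
  refine LipschitzOnWith.of_dist_le_mul fun x hx y hy => ?_
  have h2 := hB.norm_controlGrad_sub_le hθ hθ ht (z := x) (z' := y) (by simpa using hx)
    (by simpa using hy)
  simp only [sub_self, norm_zero, intervalIntegral.integral_zero, add_zero] at h2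
  rw [dist_eq_norm, dist_eq_norm, Real.coe_toNNReal _ (by positivity)]
  linarith

theorem norm_controlGrad_flow_sub_le (hB : UniformBounds F ℓ C T r R M) (hT : 0 < T)
    (hθ : IsUnitControl θ) (hθ' : IsUnitControl θ') {t : ℝ} (ht : t ∈ Icc 0 T)
    {z z' : E d × E d} (hz : ‖z‖ ≤ r) (hz' : ‖z'‖ ≤ r) :
    ‖controlGrad F θ ℓ T t (flow (controlledField F θ) 0 z t) -
      controlGrad F θ' ℓ T t (flow (controlledField F θ') 0 z' t)‖ ≤
      M ^ 2 * (2 * M + 1) * (‖z - z'‖ + (∫ s in (0 : ℝ)..T, ‖θ s - θ' s‖) + ‖θ t - θ' t‖) := by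
  have hM := hB.M_nonneg
  have h1 := hB.flow_sub θ θ' hθ hθ' t ht z z' hz hz'
  have h2 := hB.norm_controlGrad_sub_le hθ hθ' ht (hB.flow_le θ hθ t ht z hz)
    (hB.flow_le θ' hθ' t ht z' hz')
  have hI : 0 ≤ ∫ s in (0 : ℝ)..T, ‖θ s - θ' s‖ :=
    intervalIntegral.integral_nonneg hT.le fun _ _ => norm_nonneg _
  refine h2.trans ?_
  rw [mul_assoc]
  gcongr
  have := norm_nonneg (z - z')
  have := mul_nonneg hM (norm_nonneg (θ t - θ' t))
  nlinarith

theorem norm_meanControlGrad_sub_le (hB : UniformBounds F ℓ C T r R M) (hF : IsRegular F C L A)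
    (hℓ : IsC2Cost ℓ Λ) (hT : 0 < T) [IsProbabilityMeasure μ₀]
    (hμ₀ : μ₀ (Metric.closedBall 0 r)ᶜ = 0) (hθ : IsUnitControl θ) (hθ' : IsUnitControl θ')
    {t : ℝ} (ht : t ∈ Icc 0 T) :
    ‖meanControlGrad F θ ℓ T μ₀ t - meanControlGrad F θ' ℓ T μ₀ t‖ ≤
      M ^ 2 * (2 * M + 1) * ((∫ s in (0 : ℝ)..T, ‖θ s - θ' s‖) + ‖θ t - θ' t‖) := by
  rw [meanControlGrad, meanControlGrad, ← integral_sub (integrable_controlGrad_flow hF hℓ hθ hμ₀ t)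
    (integrable_controlGrad_flow hF hℓ hθ' hμ₀ t)]
  have h1 := norm_integral_le_of_norm_le_const (μ := μ₀) (C := M ^ 2 * (2 * M + 1) *
      ((∫ s in (0 : ℝ)..T, ‖θ s - θ' s‖) + ‖θ t - θ' t‖))
    (f := fun z => controlGrad F θ ℓ T t (flow (controlledField F θ) 0 z t) -
      controlGrad F θ' ℓ T t (flow (controlledField F θ') 0 z t)) (by
        rw [← mem_ae_iff] at hμ₀
        filter_upwards [hμ₀] with z hz
        have hz' : ‖z‖ ≤ r := by simpa using hz
        simpa using hB.norm_controlGrad_flow_sub_le hT hθ hθ' ht hz' hz')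
  simpa using h1

theorem norm_meanControlGrad_le (hB : UniformBounds F ℓ C T r R M) [IsProbabilityMeasure μ₀]
    (hμ₀ : μ₀ (Metric.closedBall 0 r)ᶜ = 0) (hθ : IsUnitControl θ) {t : ℝ} (ht : t ∈ Icc 0 T) :
    ‖meanControlGrad F θ ℓ T μ₀ t‖ ≤ M ^ 2 := by
  have h1 := norm_integral_le_of_norm_le_const (μ := μ₀) (C := M ^ 2)
    (f := fun z => controlGrad F θ ℓ T t (flow (controlledField F θ) 0 z t)) (by
        rw [← mem_ae_iff] at hμ₀
        filter_upwards [hμ₀] with z hz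
        have hz' : ‖z‖ ≤ r := by simpa using hz
        exact hB.norm_controlGrad_le hθ ht (hB.flow_le θ hθ t ht z hz'))
  simpa [meanControlGrad] using h1

/-- For a large regularization parameter, the maximum principle has a solution among continuous
controls. -/
theorem exists_fixedPoint (hB : UniformBounds F ℓ C T r R M) (hF : IsRegular F C L A)
    (hℓ : IsC2Cost ℓ Λ) (hT : 0 < T) [IsProbabilityMeasure μ₀]
    (hμ₀ : μ₀ (Metric.closedBall 0 r)ᶜ = 0) {lam : ℝ} (hlam : 0 < lam)
    (hM1 : M ^ 2 * (2 * M + 1) * (T + 1) ≤ lam) :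
    ∃ θ, IsUnitControl θ ∧ ∀ t ∈ Icc 0 T,
      θ t = -(1 / (2 * lam)) • meanControlGrad F θ ℓ T μ₀ t := by
  have hM := hB.M_nonneg
  have hM2 : M ^ 2 ≤ lam := by
    refine le_trans ?_ hM1
    rw [mul_assoc]
    exact le_mul_of_one_le_right (sq_nonneg M) (by nlinarith)
  -- The unit ball is complete, and on it the uniform bounds hold. Its elements are extended by
  -- constants outside `[0, T]`, so that the flow is defined on the whole line.
  let X := Metric.closedBall (0 : C(Icc (0 : ℝ) T, E m)) 1
  let ext : X → ℝ → E m := fun u t => u.1 (projIcc 0 T hT.le t)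
  have hext : ∀ u : X, IsUnitControl (ext u) := fun u => by
    refine ⟨u.1.continuous.comp continuous_projIcc, fun t => ?_⟩
    have h1 : ‖u.1‖ ≤ 1 := mem_closedBall_zero_iff.1 u.2
    exact (u.1.norm_coe_le_norm _).trans h1
  have hextT : ∀ (u : X) (t : Icc (0 : ℝ) T), ext u t = u.1 t := fun u t => by
    simp [ext]
  have hcont : ∀ u : X, Continuous fun t : Icc (0 : ℝ) T =>
      -(1 / (2 * lam)) • meanControlGrad F (ext u) ℓ T μ₀ t := fun u => by
    have := (continuous_meanControlGrad (T := T) hF hℓ (hext u) hμ₀).comp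
      (continuous_subtype_val (p := fun t => t ∈ Icc (0 : ℝ) T))
    exact this.const_smul (-(1 / (2 * lam)))
  let Ψ : X → X := fun u =>
    ⟨⟨fun t => -(1 / (2 * lam)) • meanControlGrad F (ext u) ℓ T μ₀ t, hcont u⟩, by
      rw [Metric.mem_closedBall, dist_zero_right, ContinuousMap.norm_le _ zero_le_one]
      intro t
      have h1 := hB.norm_meanControlGrad_le hμ₀ (hext u) t.2
      simp only [ContinuousMap.coe_mk, norm_smul, norm_neg]
      rw [Real.norm_of_nonneg (by positivity)]
      calc 1 / (2 * lam) * ‖meanControlGrad F (ext u) ℓ T μ₀ t‖ ≤ 1 / (2 * lam) * lam := by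
            gcongr; exact h1.trans hM2
        _ ≤ 1 := by field_simp; norm_num⟩
  have hΨ : ContractingWith 2⁻¹ Ψ := by
    refine ⟨by rw [← NNReal.coe_lt_coe]; norm_num, LipschitzWith.of_dist_le_mul fun u v => ?_⟩
    have hδ : 0 ≤ dist u.1 v.1 := dist_nonneg
    change dist (Ψ u).1 (Ψ v).1 ≤ _ * dist u.1 v.1
    rw [ContinuousMap.dist_le (by positivity)]
    intro t
    have hd : ∀ s, ‖ext u s - ext v s‖ ≤ dist u.1 v.1 := fun s => by
      rw [← dist_eq_norm]
      exact ContinuousMap.dist_apply_le_dist _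
    have hi : ∫ s in (0 : ℝ)..T, ‖ext u s - ext v s‖ ≤ T * dist u.1 v.1 := by
      have h2 := intervalIntegral.norm_integral_le_of_norm_le_const (a := 0) (b := T)
        (C := dist u.1 v.1) (f := fun s => ‖ext u s - ext v s‖)
        fun s _ => by rw [norm_norm]; exact hd s
      rw [sub_zero, abs_of_pos hT, mul_comm] at h2
      exact (Real.le_norm_self _).trans h2
    have h1 := hB.norm_meanControlGrad_sub_le hF hℓ hT hμ₀ (hext u) (hext v) t.2
    change dist (-(1 / (2 * lam)) • meanControlGrad F (ext u) ℓ T μ₀ t)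
      (-(1 / (2 * lam)) • meanControlGrad F (ext v) ℓ T μ₀ t) ≤ _
    rw [dist_eq_norm, ← smul_sub, norm_smul, norm_neg, Real.norm_of_nonneg (by positivity)]
    -- The Lipschitz constant is at most `lam`, so the prefactor `1 / (2 * lam)` yields the
    -- contraction ratio 1/2.
    have h3 : ‖meanControlGrad F (ext u) ℓ T μ₀ t - meanControlGrad F (ext v) ℓ T μ₀ t‖ ≤
        lam * dist u.1 v.1 := by
      refine h1.trans ?_
      calc _ ≤ M ^ 2 * (2 * M + 1) * (T * dist u.1 v.1 + dist u.1 v.1) := by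
            gcongr; exact hd t
        _ = M ^ 2 * (2 * M + 1) * (T + 1) * dist u.1 v.1 := by ring
        _ ≤ _ := by gcongr
    calc _ ≤ 1 / (2 * lam) * (lam * dist u.1 v.1) := by gcongr
      _ = _ := by push_cast; field_simp
  have : Nonempty X := ⟨⟨0, by simp [X]⟩⟩
  have : CompleteSpace X := Metric.isClosed_closedBall.completeSpace_coe
  refine ⟨ext (hΨ.fixedPoint Ψ), hext _, fun t ht => ?_⟩
  have h1 : Ψ (hΨ.fixedPoint Ψ) = hΨ.fixedPoint Ψ := hΨ.fixedPoint_isFixedPt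
  have h2 := hextT (hΨ.fixedPoint Ψ) ⟨t, ht⟩
  refine h2.trans ?_
  conv_lhs => rw [← h1]
  rfl

/-- Cauchy–Schwarz, obtained by integrating the square of `f` minus its mean. -/
theorem sq_integral_le {f : ℝ → ℝ} {T : ℝ} (hT : 0 < T) (hf : IntervalIntegrable f volume 0 T)
    (hf2 : IntervalIntegrable (fun t => f t ^ 2) volume 0 T) :
    (∫ t in (0 : ℝ)..T, f t) ^ 2 ≤ T * ∫ t in (0 : ℝ)..T, f t ^ 2 := by
  set I := ∫ t in (0 : ℝ)..T, f t with hI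
  have h1 : 0 ≤ ∫ t in (0 : ℝ)..T, (f t ^ 2 - 2 * (I / T) * f t + (I / T) ^ 2) :=
    intervalIntegral.integral_nonneg hT.le fun t _ => by
      have := sq_nonneg (f t - I / T)
      linarith
  have i1 : IntervalIntegrable (fun t => 2 * (I / T) * f t) volume 0 T := hf.const_mul _
  rw [intervalIntegral.integral_add (hf2.sub i1) intervalIntegrable_const,
    intervalIntegral.integral_sub hf2 i1, intervalIntegral.integral_const_mul,
    intervalIntegral.integral_const, ← hI] at h1
  simp only [sub_zero, smul_eq_mul] at h1
  have h2 : 0 ≤ T * ((∫ t in (0 : ℝ)..T, f t ^ 2) - 2 * (I / T) * I + T * (I / T) ^ 2) :=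
    mul_nonneg hT.le h1
  have h3 : T * ((∫ t in (0 : ℝ)..T, f t ^ 2) - 2 * (I / T) * I + T * (I / T) ^ 2) =
      T * (∫ t in (0 : ℝ)..T, f t ^ 2) - I ^ 2 := by
    field_simp
    ring
  linarith

/-- A continuous solution of the maximum principle beats all other controls. -/
theorem le_cost (hB : UniformBounds F ℓ C T r R M) (hF : IsRegular F C L A)
    (hℓ : IsC2Cost ℓ Λ) (hT : 0 < T)
    (hμ₀ : μ₀ (Metric.closedBall 0 r)ᶜ = 0) {lam : ℝ} (hlam : 0 < lam) (hθ : IsUnitControl θ)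
    (hfix : ∀ t ∈ Icc 0 T, θ t = -(1 / (2 * lam)) • meanControlGrad F θ ℓ T μ₀ t)
    (hθ' : IsControl T θ') (hμ : IsWeakSolution F T θ' μ₀ μ) :
    (∫ z, ℓ (flow (controlledField F θ) 0 z T) ∂μ₀ + lam * ∫ t in (0 : ℝ)..T, ‖θ t‖ ^ 2) +
      (lam - (M ^ 2 + 2 * M ^ 4 * T)) * ∫ t in (0 : ℝ)..T, ‖θ' t - θ t‖ ^ 2 ≤
      cost ℓ T lam θ' μ := by
  have hM := hB.M_nonneg
  have hη := (hθ'.sub (hθ.isControl (T := T)))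
  have hη1 : IntervalIntegrable (fun s => ‖θ' s - θ s‖) volume 0 T :=
    (hη.intervalIntegrable hT).norm
  have hη2 : IntervalIntegrable (fun s => ‖θ' s - θ s‖ ^ 2) volume 0 T :=
    hη.intervalIntegrable_sq hT
  have hθ2 : IntervalIntegrable (fun s => ‖θ s‖ ^ 2) volume 0 T :=
    (hθ.isControl (T := T)).intervalIntegrable_sq hT
  have hθ'2 := hθ'.intervalIntegrable_sq hT
  obtain ⟨hk, hkeq⟩ := hB.integral_pullback hF hT hμ₀ hθ hθ' hμ hℓ ⟨hT.le, le_rfl⟩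
  set k : ℝ → ℝ := fun s => ∫ z, adjointGrad (controlledField F θ) (controlledFieldDeriv F θ)
        ℓ T s z (F s z.1 (θ' s) - F s z.1 (θ s), 0) ∂(μ s) with hkdef
  set I := ∫ s in (0 : ℝ)..T, ‖θ' s - θ s‖ with hI
  have hI0 : 0 ≤ I := intervalIntegral.integral_nonneg hT.le fun _ _ => norm_nonneg _
  -- A pointwise lower bound for the excess cost density; its time integral is the excess cost of
  -- the competitor.
  have key : ∀ s ∈ Icc 0 T, (lam - M ^ 2) * ‖θ' s - θ s‖ ^ 2 - 2 * M ^ 4 * I * ‖θ' s - θ s‖ ≤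
      k s + lam * (‖θ' s‖ ^ 2 - ‖θ s‖ ^ 2) := by
    intro s hs
    have hp := (hμ.prob s hs).1
    have hsupp := hB.support hF hT hμ₀ hθ' hμ hs
    have hcg : Continuous fun z => controlGrad F θ ℓ T s z :=
      (continuous_controlGrad hF hℓ hθ).comp (f := fun z => (s, z)) (by fun_prop)
    have hca : Continuous fun z => adjointVector F θ ℓ T s z :=
      (continuous_adjointVector hF hℓ hθ).comp (f := fun z => (s, z)) (by fun_prop)
    have hcF : ∀ ϑ, Continuous fun z : E d × E d => F s z.1 ϑ := fun ϑ =>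
      hF.continuous.comp (f := fun z : E d × E d => (s, z.1, ϑ)) (by fun_prop)
    have e1 : k s = ∫ z, inner ℝ (adjointVector F θ ℓ T s z)
        (F s z.1 (θ' s) - F s z.1 (θ s)) ∂(μ s) := by
      simp only [hkdef, inner_adjointVector]
    have i1 : Integrable (fun z => inner ℝ (adjointVector F θ ℓ T s z)
        (F s z.1 (θ' s) - F s z.1 (θ s))) (μ s) :=
      integrable_of_continuous hsupp (hca.inner ((hcF _).sub (hcF _)))
    have i2 : Integrable (fun z => controlGrad F θ ℓ T s z) (μ s) :=
      integrable_of_continuous hsupp hcg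
    have i3 : Integrable (fun z => inner ℝ (θ' s - θ s) (controlGrad F θ ℓ T s z)) (μ s) :=
      integrable_of_continuous hsupp (continuous_const.inner hcg)
    -- Linearization of `F` in the control: one factor `M` bounds the adjoint vector, the other the
    -- quadratic remainder.
    have h1 : |k s - inner ℝ (θ' s - θ s) (∫ z, controlGrad F θ ℓ T s z ∂(μ s))| ≤
        M ^ 2 * ‖θ' s - θ s‖ ^ 2 := by
      rw [← integral_inner i2, e1, ← integral_sub i1 i3, ← Real.norm_eq_abs]
      have h2 := norm_integral_le_of_norm_le_const (μ := μ s) (C := M ^ 2 * ‖θ' s - θ s‖ ^ 2)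
        (f := fun z => inner ℝ (adjointVector F θ ℓ T s z) (F s z.1 (θ' s) - F s z.1 (θ s)) -
          inner ℝ (θ' s - θ s) (controlGrad F θ ℓ T s z)) (by
          rw [← mem_ae_iff] at hsupp
          filter_upwards [hsupp] with z hz
          have hz' : ‖z‖ ≤ R := by simpa using hz
          rw [real_inner_comm (controlGrad F θ ℓ T s z), inner_controlGrad, ← inner_sub_right]
          refine (norm_inner_le_norm _ _).trans ?_
          have a1 := hB.adjoint_le θ hθ s hs z hz'
          have a2 := hB.F_remainder s z.1 (θ s) (θ' s) ((norm_fst_le z).trans hz')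
          calc _ ≤ M * (M * ‖θ' s - θ s‖ ^ 2) := by gcongr
            _ = _ := by ring)
      simpa using h2
    have hLip := hB.lipschitzOnWith_controlGrad hθ hs
    have h3 := hB.norm_integral_sub_le hF hT hμ₀ hθ hθ' hμ hcg hLip hs
    -- After the competitor's measure has been exchanged for the push-forward by the flow of `θ`,
    -- the fixed-point equation evaluates the integral. The exchange costs `2 M² · M² · I`, from the
    -- Lipschitz constant of `controlGrad`.
    have h4 : ∫ z, controlGrad F θ ℓ T s (flow (controlledField F θ) 0 z s) ∂μ₀ =
        -(2 * lam) • θ s := by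
      rw [hfix s hs, smul_smul]
      have : -(2 * lam) * -(1 / (2 * lam)) = 1 := by field_simp
      rw [this, one_smul, meanControlGrad]
    rw [h4, ← hI, Real.coe_toNNReal _ (by positivity)] at h3
    have h5 : |inner ℝ (θ' s - θ s) (∫ z, controlGrad F θ ℓ T s z ∂(μ s) - -(2 * lam) • θ s)| ≤
        2 * M ^ 4 * I * ‖θ' s - θ s‖ := by
      refine (abs_real_inner_le_norm _ _).trans ?_
      calc _ ≤ ‖θ' s - θ s‖ * (2 * M ^ 2 * M ^ 2 * I) := by gcongr
        _ = _ := by ring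
    rw [inner_sub_right, inner_smul_right] at h5
    -- The cross term cancels the first-order term of the cost, leaving `lam` times the squared
    -- distance.
    have h6 : ‖θ' s‖ ^ 2 = ‖θ s‖ ^ 2 + 2 * inner ℝ (θ' s - θ s) (θ s) + ‖θ' s - θ s‖ ^ 2 := by
      have := norm_add_sq_real (θ s) (θ' s - θ s)
      rw [add_sub_cancel, real_inner_comm] at this
      exact this
    have h7 := (abs_le.1 h1).1
    have h8 := (abs_le.1 h5).1
    rw [h6]
    linarith
  have i4 : IntervalIntegrable (fun s => (lam - M ^ 2) * ‖θ' s - θ s‖ ^ 2) volume 0 T :=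
    hη2.const_mul _
  have i5 : IntervalIntegrable (fun s => 2 * M ^ 4 * I * ‖θ' s - θ s‖) volume 0 T :=
    hη1.const_mul _
  have i6 : IntervalIntegrable (fun s => lam * (‖θ' s‖ ^ 2 - ‖θ s‖ ^ 2)) volume 0 T :=
    (hθ'2.sub hθ2).const_mul _
  have hint := intervalIntegral.integral_mono_on hT.le (i4.sub i5) (hk.add i6) key
  rw [intervalIntegral.integral_sub i4 i5, intervalIntegral.integral_add hk i6,
    intervalIntegral.integral_const_mul, intervalIntegral.integral_const_mul,
    intervalIntegral.integral_const_mul, intervalIntegral.integral_sub hθ'2 hθ2, ← hkeq,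
    ← hI] at hint
  have h9 := sq_integral_le hT hη1 hη2
  rw [← hI] at h9
  -- The nonlocal error is quadratic in the `L¹` distance, hence dominated by the squared `L²`
  -- distance.
  have h10 : 2 * M ^ 4 * I ^ 2 ≤ 2 * M ^ 4 * (T * ∫ t in (0 : ℝ)..T, ‖θ' t - θ t‖ ^ 2) := by
    gcongr
  rw [cost]
  linarith

end UniformBounds

/-! ### Controls that agree almost everywhere -/

section Congr

variable {F : ℝ → E d → E m → E d} {ℓ : E d × E d → ℝ} {T lam : ℝ} {θ θ' : ℝ → E m}
  {μ₀ : Measure (E d × E d)} {μ : ℝ → Measure (E d × E d)}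

theorem integral_congr_of_ae_eq_control {W : Type*} [NormedAddCommGroup W] [NormedSpace ℝ W]
    (h : θ =ᵐ[volume.restrict (Icc 0 T)] θ') {a b : ℝ} (ha : a ∈ Icc 0 T) (hb : b ∈ Icc 0 T)
    (G : ℝ → E m → W) : ∫ s in a..b, G s (θ s) = ∫ s in a..b, G s (θ' s) := by
  refine intervalIntegral.integral_congr_ae ?_
  rw [EventuallyEq, ae_restrict_iff' measurableSet_Icc] at h
  filter_upwards [h] with s hs hsI
  rw [hs ((uIcc_subset_Icc ha hb) (uIoc_subset_uIcc hsI))]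

theorem IsControl.congr (hθ : IsControl T θ) (h : θ =ᵐ[volume.restrict (Icc 0 T)] θ') :
    IsControl T θ' := MemLp.ae_eq h hθ

theorem IsWeakSolution.congr (hμ : IsWeakSolution F T θ μ₀ μ) (hT : 0 < T)
    (h : θ =ᵐ[volume.restrict (Icc 0 T)] θ') : IsWeakSolution F T θ' μ₀ μ where
  prob := hμ.prob
  continuous := hμ.continuous
  initial := hμ.initial
  weak φ h₁ h₂ h₃ := by
    refine Eq.trans ?_ (hμ.weak φ h₁ h₂ h₃)
    exact (integral_congr_of_ae_eq_control h ⟨le_rfl, hT.le⟩ ⟨hT.le, le_rfl⟩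
      (fun t ϑ => ∫ z, fderiv ℝ φ (t, z) (1, F t z.1 ϑ, 0) ∂(μ t))).symm

theorem IsFlow.congr {Φ : ℝ → ℝ → E d → E d} (hΦ : IsFlow F T θ Φ)
    (h : θ =ᵐ[volume.restrict (Icc 0 T)] θ') : IsFlow F T θ' Φ := fun τ hτ x =>
  ⟨(hΦ τ hτ x).1, fun t ht => by
    rw [(hΦ τ hτ x).2 t ht]
    congr 1
    exact integral_congr_of_ae_eq_control h hτ ht fun s ϑ => F s (Φ τ s x) ϑ⟩

theorem IsAdjointState.congr {ψ : ℝ → E d × E d → ℝ} (hψ : IsAdjointState F ℓ T θ ψ) (hT : 0 < T)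
    (h : θ =ᵐ[volume.restrict (Icc 0 T)] θ') : IsAdjointState F ℓ T θ' ψ where
  contDiff := hψ.contDiff
  equation t ht z := by
    rw [hψ.equation t ht z]
    congr 1
    exact integral_congr_of_ae_eq_control h ht ⟨hT.le, le_rfl⟩ fun s ϑ =>
      inner ℝ (gradPsi ψ s z) (F s z.1 ϑ)
  characteristic := hψ.characteristic.imp fun _ hΦ => ⟨hΦ.1.congr h, hΦ.2⟩

theorem SatisfiesPMP.congr (hθ : SatisfiesPMP F ℓ T lam μ₀ θ) (hT : 0 < T)
    (h : θ =ᵐ[volume.restrict (Icc 0 T)] θ') : SatisfiesPMP F ℓ T lam μ₀ θ' := by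
  obtain ⟨μ, ψ, hμ, hψ, hp⟩ := hθ
  refine ⟨μ, ψ, hμ.congr hT h, hψ.congr hT h, ?_⟩
  filter_upwards [h, hp] with t h1 h2
  rw [← h1]
  exact h2

theorem cost_congr (hT : 0 < T) (h : θ =ᵐ[volume.restrict (Icc 0 T)] θ') :
    cost ℓ T lam θ μ = cost ℓ T lam θ' μ := by
  rw [cost, cost, integral_congr_of_ae_eq_control h ⟨le_rfl, hT.le⟩ ⟨hT.le, le_rfl⟩
    fun _ ϑ => ‖ϑ‖ ^ 2]

theorem IsOptimal.congr (hθ : IsOptimal F ℓ T lam μ₀ θ) (hT : 0 < T)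
    (h : θ =ᵐ[volume.restrict (Icc 0 T)] θ') : IsOptimal F ℓ T lam μ₀ θ' := by
  obtain ⟨h1, μ, hμ, hmin⟩ := hθ
  refine ⟨h1.congr h, μ, hμ.congr hT h, fun θ₁ μ₁ a1 a2 => ?_⟩
  rw [← cost_congr hT h]
  exact hmin θ₁ μ₁ a1 a2

end Congr

/-! ### The maximum principle for continuous controls -/

section Continuous

variable {F : ℝ → E d → E m → E d} {C L : ℝ} {A : ℝ → ℝ} {ℓ : E d × E d → ℝ} {Λ : ℝ → ℝ}
  {T : ℝ} {θ : ℝ → E m}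

/-- The label `y` is frozen and does not influence `x`. This links the flow on pairs with the flow
in `x` alone that the definition of the adjoint state requires. -/
theorem flow_controlledField_mk (hF : IsRegular F C L A) (hθ : IsUnitControl θ) (τ t : ℝ)
    (x y : E d) : flow (controlledField F θ) τ (x, y) t =
      ((flow (controlledField F θ) τ (x, 0) t).1, y) := by
  have hf := hF.isC2Field hθ
  refine hf.curve_eq (τ := τ) (hf.hasDerivAt_flow τ (x, y))
    (Y := fun t => ((flow (controlledField F θ) τ (x, 0) t).1, y)) (fun s => ?_) ?_ t
  · exact ((hasFDerivAt_fst.comp_hasDerivAt s (hf.hasDerivAt_flow τ (x, 0) s)).prodMk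
      (hasDerivAt_const s y))
  · simp only [hf.flow_self]

theorem hasGradientAt_pullback (hF : IsRegular F C L A) (hℓ : IsC2Cost ℓ Λ)
    (hθ : IsUnitControl θ) (t : ℝ) (z : E d × E d) :
    HasGradientAt (fun x => ℓ (flow (controlledField F θ) t (x, z.2) T))
      (adjointVector F θ ℓ T t z) z.1 := by
  rw [hasGradientAt_iff_hasFDerivAt, adjointVector, LinearIsometryEquiv.apply_symm_apply]
  have h1 := (hF.isC2Field hθ).hasFDerivAt_pullback hℓ T t z
  exact HasFDerivAt.comp (f := fun x => (x, z.2)) z.1 h1 (hasFDerivAt_prodMk_left z.1 z.2)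

theorem gradPsi_pullback (hF : IsRegular F C L A) (hℓ : IsC2Cost ℓ Λ)
    (hθ : IsUnitControl θ) (t : ℝ) (z : E d × E d) :
    gradPsi (fun t z => ℓ (flow (controlledField F θ) t z T)) t z = adjointVector F θ ℓ T t z :=
  (hasGradientAt_pullback hF hℓ hθ t z).gradient

theorem isFlow_controlledField (hF : IsRegular F C L A) (hθ : IsUnitControl θ) :
    IsFlow F T θ fun τ t x => (flow (controlledField F θ) τ (x, 0) t).1 := by
  have hf := hF.isC2Field hθ
  refine fun τ _ x => ⟨(continuous_fst.comp (hf.continuous_flow τ (x, 0))).continuousOn,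
    fun t _ => ?_⟩
  have h1 := hf.flow_eq_integral τ (x, 0) τ t
  rw [hf.flow_self] at h1
  have hc : IntervalIntegrable
      (fun r => controlledField F θ r (flow (controlledField F θ) τ (x, 0) r)) volume τ t :=
    (hf.continuous_velocity τ (x, 0)).intervalIntegrable _ _
  have h2 := (ContinuousLinearMap.fst ℝ (E d) (E d)).intervalIntegral_comp_comm hc
  have h3 := congrArg Prod.fst h1
  rw [Prod.fst_add] at h3
  refine h3.trans ?_
  congr 1
  exact h2.symm

theorem isAdjointState_pullback (hF : IsRegular F C L A) (hℓ : IsC2Cost ℓ Λ)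
    (hθ : IsUnitControl θ) :
    IsAdjointState F ℓ T θ fun t z => ℓ (flow (controlledField F θ) t z T) where
  contDiff t _ := ((hF.isC2Field hθ).contDiff_pullback hℓ T).comp
    (f := fun z => (t, z)) (by fun_prop)
  equation t _ z := by
    simp only [gradPsi_pullback hF hℓ hθ, inner_adjointVector]
    exact (hF.isC2Field hθ).pullback_eq_integral hℓ T t z
  characteristic := ⟨_, isFlow_controlledField hF hθ, fun t _ x y => by
    rw [flow_controlledField_mk hF hθ]⟩

theorem continuous_flow_right (hF : IsRegular F C L A) (hθ : IsUnitControl θ) (t : ℝ) :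
    Continuous fun z => flow (controlledField F θ) 0 z t :=
  ((hF.isC2Field hθ).continuous_flow_uncurry 0).comp (f := fun z => (t, z)) (by fun_prop)

variable {μ₀ : Measure (E d × E d)}

theorem isWeakSolution_controlledField [IsProbabilityMeasure μ₀] (hF : IsRegular F C L A)
    (hθ : IsUnitControl θ)
    (hT : 0 < T) {r : ℝ} (hμ₀ : μ₀ (Metric.closedBall 0 r)ᶜ = 0) :
    IsWeakSolution F T θ μ₀ fun t => μ₀.map fun z => flow (controlledField F θ) 0 z t :=
  isWeakSolution_map_flow (hF.isC2Field hθ).toIsLipField (fun _ _ _ => rfl) hT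
    (isCompact_closedBall 0 r) hμ₀

theorem satisfiesPMP_of_fixedPoint [IsProbabilityMeasure μ₀] (hF : IsRegular F C L A)
    (hℓ : IsC2Cost ℓ Λ)
    (hθ : IsUnitControl θ) (hT : 0 < T) {r : ℝ} (hμ₀ : μ₀ (Metric.closedBall 0 r)ᶜ = 0) {lam : ℝ}
    (hfix : ∀ t ∈ Icc 0 T, θ t = -(1 / (2 * lam)) • meanControlGrad F θ ℓ T μ₀ t) :
    SatisfiesPMP F ℓ T lam μ₀ θ := by
  refine ⟨_, _, isWeakSolution_controlledField hF hθ hT hμ₀, isAdjointState_pullback hF hℓ hθ, ?_⟩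
  refine (ae_restrict_iff' measurableSet_Icc).2 (ae_of_all _ fun t ht => ?_)
  refine (hfix t ht).trans ?_
  congr 1
  simp only [gradPsi_pullback hF hℓ hθ]
  exact (integral_map (continuous_flow_right hF hθ t).aemeasurable
    ((continuous_controlGrad (T := T) hF hℓ hθ).comp (f := fun z => (t, z))
      (by fun_prop)).aestronglyMeasurable).symm

theorem cost_controlledField (hF : IsRegular F C L A) (hℓ : IsC2Cost ℓ Λ)
    (hθ : IsUnitControl θ) (lam : ℝ) :
    cost ℓ T lam θ (fun t => μ₀.map fun z => flow (controlledField F θ) 0 z t) =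
      ∫ z, ℓ (flow (controlledField F θ) 0 z T) ∂μ₀ + lam * ∫ t in (0 : ℝ)..T, ‖θ t‖ ^ 2 := by
  have hc : Continuous ℓ := continuous_iff_continuousAt.2 fun z =>
    (hℓ.differentiable z).continuousAt
  rw [cost, integral_map (continuous_flow_right hF hθ T).aemeasurable hc.aestronglyMeasurable]

end Continuous

/-! ### Optimality and uniqueness from the quadratic gap -/

section Optimal

variable {F : ℝ → E d → E m → E d} {C L : ℝ} {A : ℝ → ℝ} {ℓ : E d × E d → ℝ} {Λ : ℝ → ℝ}
  {T r R M lam : ℝ} {θ θ' : ℝ → E m} {μ₀ : Measure (E d × E d)} [IsProbabilityMeasure μ₀]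

theorem UniformBounds.isOptimal (hB : UniformBounds F ℓ C T r R M) (hF : IsRegular F C L A)
    (hℓ : IsC2Cost ℓ Λ) (hT : 0 < T) (hμ₀ : μ₀ (Metric.closedBall 0 r)ᶜ = 0) (hlam : 0 < lam)
    (hM2 : M ^ 2 + 2 * M ^ 4 * T < lam) (hθ : IsUnitControl θ)
    (hfix : ∀ t ∈ Icc 0 T, θ t = -(1 / (2 * lam)) • meanControlGrad F θ ℓ T μ₀ t) :
    IsOptimal F ℓ T lam μ₀ θ := by
  refine ⟨hθ.isControl, _, isWeakSolution_controlledField hF hθ hT hμ₀, fun θ' μ' h1 h2 => ?_⟩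
  rw [cost_controlledField hF hℓ hθ]
  refine le_trans ?_ (hB.le_cost hF hℓ hT hμ₀ hlam hθ hfix h1 h2)
  have : 0 ≤ ∫ t in (0 : ℝ)..T, ‖θ' t - θ t‖ ^ 2 :=
    intervalIntegral.integral_nonneg hT.le fun _ _ => by positivity
  nlinarith

theorem UniformBounds.ae_eq_of_isOptimal (hB : UniformBounds F ℓ C T r R M)
    (hF : IsRegular F C L A) (hℓ : IsC2Cost ℓ Λ) (hT : 0 < T)
    (hμ₀ : μ₀ (Metric.closedBall 0 r)ᶜ = 0) (hlam : 0 < lam)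
    (hM2 : M ^ 2 + 2 * M ^ 4 * T < lam) (hθ : IsUnitControl θ)
    (hfix : ∀ t ∈ Icc 0 T, θ t = -(1 / (2 * lam)) • meanControlGrad F θ ℓ T μ₀ t)
    (hθ' : IsOptimal F ℓ T lam μ₀ θ') : θ' =ᵐ[volume.restrict (Icc 0 T)] θ := by
  obtain ⟨h1, μ, hμ, hmin⟩ := hθ'
  have h2 := hB.le_cost hF hℓ hT hμ₀ hlam hθ hfix h1 hμ
  have h3 := hmin θ _ hθ.isControl (isWeakSolution_controlledField hF hθ hT hμ₀)
  rw [cost_controlledField hF hℓ hθ] at h3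
  have h4 : 0 ≤ ∫ t in (0 : ℝ)..T, ‖θ' t - θ t‖ ^ 2 :=
    intervalIntegral.integral_nonneg hT.le fun _ _ => by positivity
  have h5 : ∫ t in (0 : ℝ)..T, ‖θ' t - θ t‖ ^ 2 = 0 := by nlinarith
  have hi := (h1.sub (hθ.isControl (T := T))).intervalIntegrable_sq hT
  rw [intervalIntegral.integral_of_le hT.le, ← integral_Icc_eq_integral_Ioc,
    integral_eq_zero_iff_of_nonneg (fun _ => by positivity)
      ((intervalIntegrable_iff_integrableOn_Icc_of_le hT.le).1 hi)] at h5
  filter_upwards [h5] with t ht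
  have : ‖θ' t - θ t‖ ^ 2 = 0 := ht
  exact sub_eq_zero.1 (norm_eq_zero.1 (by nlinarith [norm_nonneg (θ' t - θ t)]))

end Optimal

/-! ### Flows of measurable controls -/

section MeasurableFlow

variable {F : ℝ → E d → E m → E d} {C L T : ℝ} {A : ℝ → ℝ} {θ : ℝ → E m} {Φ : ℝ → ℝ → E d → E d}

theorem IsFlow.intervalIntegrable (hΦ : IsFlow F T θ Φ) (hF : IsControlField F C)
    (hθ : AEStronglyMeasurable θ (volume.restrict (Icc 0 T))) {τ : ℝ} (hτ : τ ∈ Icc 0 T) (x : E d)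
    {a b : ℝ} (ha : a ∈ Icc 0 T) (hb : b ∈ Icc 0 T) :
    IntervalIntegrable (fun s => F s (Φ τ s x) (θ s)) volume a b := by
  have hc := (hΦ τ hτ x).1
  obtain ⟨B, hB⟩ := isCompact_Icc.exists_bound_of_continuousOn hc
  have hm : AEStronglyMeasurable (fun s => F s (Φ τ s x) (θ s)) (volume.restrict (Icc 0 T)) :=
    hF.continuous.comp_aestronglyMeasurable (g := fun q : ℝ × E d × E m => F q.1 q.2.1 q.2.2)
      (f := fun s => (s, Φ τ s x, θ s)) (aestronglyMeasurable_id.prodMk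
      ((hc.aestronglyMeasurable measurableSet_Icc).prodMk hθ))
  have hi : IntegrableOn (fun s => F s (Φ τ s x) (θ s)) (Icc 0 T) := by
    refine Integrable.of_bound hm (C * (1 + B)) ?_
    refine (ae_restrict_iff' measurableSet_Icc).2 (ae_of_all _ fun s hs => ?_)
    refine (hF.growth _ _ _).trans ?_
    have := hF.nonneg
    have := hB s hs
    gcongr
  exact (hi.mono_set (uIcc_subset_Icc ha hb)).intervalIntegrable

/-- Only linear growth enters, so the bound is the same for every control, bounded or not. -/
theorem IsFlow.norm_le (hΦ : IsFlow F T θ Φ) (hF : IsControlField F C) {t s : ℝ}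
    (ht : t ∈ Icc 0 T) (hs : s ∈ Icc 0 T) (hts : t ≤ s) (x : E d) :
    ‖Φ t s x‖ ≤ (‖x‖ + C * T) * Real.exp (2 * (C * T)) := by
  have hC := hF.nonneg
  have hsub : Icc t s ⊆ Icc 0 T := Icc_subset_Icc ht.1 hs.2
  have hc := ((hΦ t ht x).1.mono hsub).norm
  have hCT : 0 ≤ C * T := mul_nonneg hC (ht.1.trans ht.2)
  refine (gronwall_Icc (κ := fun _ => C) (c := ‖x‖ + C * T) hts hc (fun _ _ => norm_nonneg _)
    intervalIntegrable_const (fun _ => hC) (by positivity) fun r hr => ?_).trans ?_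
  · rw [(hΦ t ht x).2 r (hsub hr)]
    refine (norm_add_le _ _).trans ?_
    have hcr : IntervalIntegrable (fun q => C * ‖Φ t q x‖) volume t r :=
      ((hc.mono (Icc_subset_Icc_right hr.2)).intervalIntegrable_of_Icc hr.1).const_mul _
    have h1 : ‖∫ q in t..r, F q (Φ t q x) (θ q)‖ ≤ ∫ q in t..r, (C + C * ‖Φ t q x‖) :=
      intervalIntegral.norm_integral_le_of_norm_le hr.1
        (ae_of_all _ fun q _ => (hF.growth _ _ _).trans (le_of_eq (by ring)))
        (intervalIntegrable_const.add hcr)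
    rw [intervalIntegral.integral_add intervalIntegrable_const hcr,
      intervalIntegral.integral_const, smul_eq_mul] at h1
    have h2 : (r - t) * C ≤ C * T := by
      rw [mul_comm]; gcongr; linarith [(hsub hr).2, ht.1]
    linarith
  · rw [intervalIntegral.integral_const, smul_eq_mul, mul_comm (s - t)]
    gcongr
    linarith [hs.2, ht.1]

/-- No bound on the control is available yet, so the exponent retains the integral of `|θ|`; this is
the quantity on which the bootstrap works. -/
theorem IsFlow.dist_le (hΦ : IsFlow F T θ Φ) (hF : IsRegular F C L A) (hθ : IsControl T θ)
    (hT : 0 < T) {t : ℝ} (ht : t ∈ Icc 0 T) (x y : E d) :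
    ‖Φ t T x - Φ t T y‖ ≤ ‖x - y‖ * Real.exp (2 * ∫ s in t..T, L * (1 + ‖θ s‖)) := by
  have hL := hF.L_nonneg
  have hsub : Icc t T ⊆ Icc 0 T := Icc_subset_Icc_left ht.1
  have hTI : T ∈ Icc 0 T := ⟨hT.le, le_rfl⟩
  have hc := (((hΦ t ht x).1.sub (hΦ t ht y).1).mono hsub).norm
  have hκ0 : IntervalIntegrable (fun s => L * (1 + ‖θ s‖)) volume 0 T :=
    (intervalIntegrable_const.add (hθ.intervalIntegrable hT).norm).const_mul _
  have hκ : ∀ r ∈ Icc t T, IntervalIntegrable (fun s => L * (1 + ‖θ s‖)) volume t r := fun r hr =>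
    hκ0.mono_set (by rw [uIcc_of_le hr.1, uIcc_of_le hT.le]; exact Icc_subset_Icc ht.1 hr.2)
  refine gronwall_Icc (u := fun s => ‖Φ t s x - Φ t s y‖) (κ := fun s => L * (1 + ‖θ s‖)) ht.2 hc
    (fun _ _ => norm_nonneg _) (hκ T ⟨ht.2, le_rfl⟩) (fun s => by positivity) (norm_nonneg _)
    fun r hr => ?_
  have i1 := hΦ.intervalIntegrable hF.toIsControlField hθ.aestronglyMeasurable ht x ht (hsub hr)
  have i2 := hΦ.intervalIntegrable hF.toIsControlField hθ.aestronglyMeasurable ht y ht (hsub hr)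
  have e : Φ t r x - Φ t r y =
      x - y + ∫ s in t..r, (F s (Φ t s x) (θ s) - F s (Φ t s y) (θ s)) := by
    rw [intervalIntegral.integral_sub i1 i2, (hΦ t ht x).2 r (hsub hr), (hΦ t ht y).2 r (hsub hr)]
    abel
  rw [e]
  refine (norm_add_le _ _).trans (add_le_add_right ?_ _)
  refine intervalIntegral.norm_integral_le_of_norm_le hr.1
    (ae_of_all _ fun q _ => hF.lipschitz_x _ _ _ _) ?_
  refine (hκ r hr).mul_continuousOn ?_
  rw [uIcc_of_le hr.1]
  exact hc.mono (Icc_subset_Icc_right hr.2)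

/-- The flow of a measurable control is approached by flows of continuous ones, with an error linear
in the `L¹` distance. Differentiable flows thereby become available in the limit. -/
theorem IsFlow.dist_flow_controlledField_le (hΦ : IsFlow F T θ Φ) (hF : IsRegular F C L A)
    (hθ : IsControl T θ) (hT : 0 < T) {ϑ : ℝ → E m} (hϑ : IsUnitControl ϑ) {t : ℝ}
    (ht : t ∈ Icc 0 T) {ρ : ℝ} (z : E d × E d) (hz : ‖z.1‖ ≤ ρ) :
    ‖flow (controlledField F ϑ) t z T - (Φ t T z.1, z.2)‖ ≤
      A ((ρ + C * T) * Real.exp (2 * (C * T))) * (∫ s in (0 : ℝ)..T, ‖ϑ s - θ s‖) *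
        Real.exp (2 * (2 * L * T)) := by
  have hf := hF.isC2Field hϑ
  have hL := hF.L_nonneg
  have hC := hF.nonneg
  have hTI : T ∈ Icc 0 T := ⟨hT.le, le_rfl⟩
  have hsub : Icc t T ⊆ Icc 0 T := Icc_subset_Icc_left ht.1
  set a := A ((ρ + C * T) * Real.exp (2 * (C * T))) with ha
  have ha0 : 0 ≤ a := hF.A_nonneg _
  have hη : IntervalIntegrable (fun s => ‖ϑ s - θ s‖) volume 0 T :=
    (((hϑ.isControl (T := T)).sub hθ).intervalIntegrable hT).norm
  have hηt := hη.mono_set (c := t) (d := T) (by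
    rw [uIcc_of_le ht.2, uIcc_of_le hT.le]; exact hsub)
  have i1 := hΦ.intervalIntegrable hF.toIsControlField hθ.aestronglyMeasurable ht z.1 ht hTI
  have hfs : ∀ s ∈ Icc t T, ((Φ t s z.1, z.2) : E d × E d) =
      z + ∫ r in t..s, (F r (Φ t r z.1) (θ r), (0 : E d)) := fun s hs => by
    have j1 := hΦ.intervalIntegrable hF.toIsControlField hθ.aestronglyMeasurable ht z.1 ht (hsub hs)
    have h3 := (ContinuousLinearMap.inl ℝ (E d) (E d)).intervalIntegral_comp_comm j1
    have h4 : ∫ r in t..s, (F r (Φ t r z.1) (θ r), (0 : E d)) =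
        (∫ r in t..s, F r (Φ t r z.1) (θ r), 0) := h3
    rw [h4, (hΦ t ht z.1).2 s (hsub hs)]
    ext1 <;> simp
  have h1 := hf.dist_le (X := fun s => flow (controlledField F ϑ) t z s)
    (Y := fun s => (Φ t s z.1, z.2)) (v := fun s => (F s (Φ t s z.1) (θ s), 0))
    (e := fun s => a * ‖ϑ s - θ s‖) (τ := t) (t := T) (y := z)
    (c := a * ∫ s in (0 : ℝ)..T, ‖ϑ s - θ s‖)
    (hf.hasDerivAt_flow t z) (by
      rw [uIcc_of_le ht.2]
      exact ((hΦ t ht z.1).1.mono hsub).prodMk continuousOn_const)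
    ⟨i1.1.prodMk (integrable_zero _ _ _), i1.2.prodMk (integrable_zero _ _ _)⟩ (by
      rw [uIcc_of_le ht.2]
      exact hfs) (by
      rw [uIcc_of_le ht.2]
      refine (ae_restrict_iff' measurableSet_Icc).2 (ae_of_all _ fun s hs => ?_)
      have e : controlledField F ϑ s (Φ t s z.1, z.2) - (F s (Φ t s z.1) (θ s), 0) =
          (F s (Φ t s z.1) (ϑ s) - F s (Φ t s z.1) (θ s), 0) := by simp [controlledField]
      rw [e]
      refine norm_prod_zero_le (hF.lipschitz_theta _ _ _ _ _ ?_)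
      refine (hΦ.norm_le hF.toIsControlField ht (hsub hs) hs.1 z.1).trans ?_
      gcongr) (hηt.const_mul _) (by
      have e : ∀ s, ‖a * ‖ϑ s - θ s‖‖ = a * ‖ϑ s - θ s‖ := fun s =>
        Real.norm_of_nonneg (by positivity)
      simp only [e]
      rw [intervalIntegral.integral_const_mul, abs_mul, abs_of_nonneg ha0,
        abs_of_nonneg (intervalIntegral.integral_nonneg ht.2 fun _ _ => norm_nonneg _)]
      gcongr
      exact intervalIntegral.integral_mono_interval ht.1 ht.2 le_rfl
        (Eventually.of_forall fun _ => norm_nonneg _) hη)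
  refine h1.trans ?_
  rw [hf.flow_self, sub_self, norm_zero, zero_add]
  have hI : 0 ≤ ∫ s in (0 : ℝ)..T, ‖ϑ s - θ s‖ :=
    intervalIntegral.integral_nonneg hT.le fun _ _ => norm_nonneg _
  rw [abs_of_nonneg (by linarith [ht.2])]
  gcongr
  linarith [ht.1]

end MeasurableFlow

/-! ### A priori bounds for solutions of the maximum principle -/

theorem IsC2Cost.abs_sub_le {V : Type*} [NormedAddCommGroup V] [NormedSpace ℝ V] {ℓ : V → ℝ}
    {Λ : ℝ → ℝ} (hℓ : IsC2Cost ℓ Λ) {ρ : ℝ} {x y : V} (hx : ‖x‖ ≤ ρ) (hy : ‖y‖ ≤ ρ) :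
    |ℓ x - ℓ y| ≤ Λ ρ * ‖x - y‖ :=
  (convex_closedBall (0 : V) ρ).norm_image_sub_le_of_norm_hasFDerivWithin_le
    (f := ℓ) (fun z _ => (hℓ.differentiable z).hasFDerivAt.hasFDerivWithinAt)
    (fun z hz => hℓ.bound ρ z (by simpa using hz)) (by simpa using hy) (by simpa using hx)

/-- The gradient of a difference at `z` is bounded by its Lipschitz constant in `x` on the unit ball
around `z.1`. Thus estimates on values of flows yield estimates on gradients of `ψ`, without
differentiating the flow of a measurable control. -/
theorem norm_gradPsi_sub_le {ψ : ℝ → E d × E d → ℝ} {t R κ : ℝ} (hκ : 0 ≤ κ) {z : E d × E d}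
    {ψ' : E d → ℝ} {p : E d} (hψ' : HasGradientAt ψ' p z.1)
    (hψ : DifferentiableAt ℝ (fun x => ψ t (x, z.2)) z.1) (hz : ‖z‖ ≤ R)
    (h : ∀ x y : E d, ‖x‖ ≤ R + 1 → ‖y‖ ≤ R + 1 →
      |(ψ t (x, z.2) - ψ' x) - (ψ t (y, z.2) - ψ' y)| ≤ κ * ‖x - y‖) :
    ‖gradPsi ψ t z - p‖ ≤ κ := by
  have h1 : HasFDerivAt (fun x => ψ t (x, z.2) - ψ' x)
      (InnerProductSpace.toDual ℝ (E d) (gradPsi ψ t z - p)) z.1 := by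
    rw [map_sub]
    exact hψ.hasGradientAt.hasFDerivAt.sub hψ'.hasFDerivAt
  rw [← LinearIsometryEquiv.norm_map (InnerProductSpace.toDual ℝ (E d)), ← h1.fderiv]
  have h2 : Metric.closedBall z.1 1 ∈ 𝓝 z.1 := Metric.closedBall_mem_nhds _ one_pos
  have h3 : LipschitzOnWith κ.toNNReal (fun x => ψ t (x, z.2) - ψ' x) (Metric.closedBall z.1 1) := by
    have hb : ∀ x ∈ Metric.closedBall z.1 1, ‖x‖ ≤ R + 1 := fun x hx => by
      have a1 := norm_le_norm_add_norm_sub' x z.1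
      have a2 : ‖x - z.1‖ ≤ 1 := by simpa [dist_eq_norm] using hx
      have a3 := (norm_fst_le z).trans hz
      linarith
    refine LipschitzOnWith.of_dist_le_mul fun x hx y hy => ?_
    rw [Real.dist_eq, dist_eq_norm, Real.coe_toNNReal _ hκ]
    exact h x y (hb x hx) (hb y hy)
  exact (norm_fderiv_le_of_lipschitzOn ℝ h2 h3).trans (Real.coe_toNNReal _ hκ).le

theorem IsAdjointState.differentiableAt {F : ℝ → E d → E m → E d} {ℓ : E d × E d → ℝ} {T : ℝ}
    {θ : ℝ → E m} {ψ : ℝ → E d × E d → ℝ} (hψ : IsAdjointState F ℓ T θ ψ) {t : ℝ}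
    (ht : t ∈ Icc 0 T) (z : E d × E d) : DifferentiableAt ℝ (fun x => ψ t (x, z.2)) z.1 :=
  (((hψ.contDiff t ht).differentiable (by norm_num)).comp (g := ψ t) (f := fun x => (x, z.2))
    (by fun_prop)).differentiableAt

section APriori

variable {F : ℝ → E d → E m → E d} {C L : ℝ} {A : ℝ → ℝ} {ℓ : E d × E d → ℝ} {Λ : ℝ → ℝ}
  {T r R M lam : ℝ} {θ : ℝ → E m} {ψ : ℝ → E d × E d → ℝ}

theorem IsAdjointState.norm_gradPsi_le (hψ : IsAdjointState F ℓ T θ ψ) (hF : IsRegular F C L A)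
    (hℓ : IsC2Cost ℓ Λ) (hθ : IsControl T θ) (hT : 0 < T) {t : ℝ} (ht : t ∈ Icc 0 T)
    {z : E d × E d} (hz : ‖z‖ ≤ R) :
    ‖gradPsi ψ t z‖ ≤ Λ ((R + 1 + C * T) * Real.exp (2 * (C * T))) *
      Real.exp (2 * (L * T)) * Real.exp (2 * (L * ∫ s in t..T, ‖θ s‖)) := by
  obtain ⟨Φ, hΦ, hψΦ⟩ := hψ.characteristic
  have hC := hF.nonneg
  have hL := hF.L_nonneg
  have hR : 0 ≤ R := (norm_nonneg z).trans hz
  have hTI : T ∈ Icc 0 T := ⟨hT.le, le_rfl⟩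
  have hCT : 0 ≤ C * T := by positivity
  set ρ := (R + 1 + C * T) * Real.exp (2 * (C * T)) with hρ
  have hΛ : 0 ≤ Λ ρ := hℓ.nonneg _
  have hρR : R ≤ ρ := by
    have : 1 ≤ Real.exp (2 * (C * T)) := Real.one_le_exp (by positivity)
    nlinarith
  have hi : IntervalIntegrable (fun s => ‖θ s‖) volume t T :=
    (hθ.intervalIntegrable hT).norm.mono_set
      (by rw [uIcc_of_le ht.2, uIcc_of_le hT.le]; exact Icc_subset_Icc_left ht.1)
  have key := norm_gradPsi_sub_le (ψ := ψ) (t := t) (R := R)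
    (κ := Λ ρ * Real.exp (2 * (L * T)) * Real.exp (2 * (L * ∫ s in t..T, ‖θ s‖)))
    (by positivity) (z := z) (ψ' := fun _ => 0) (p := 0)
    (by rw [hasGradientAt_iff_hasFDerivAt, map_zero]; exact hasFDerivAt_const _ _)
    (hψ.differentiableAt ht z) hz fun x y hx hy => by
      have hb : ∀ x : E d, ‖x‖ ≤ R + 1 → ‖((Φ t T x, z.2) : E d × E d)‖ ≤ ρ := fun x hx => by
        rw [Prod.norm_mk]
        refine max_le ?_ (((norm_snd_le z).trans hz).trans hρR)
        refine (hΦ.norm_le hF.toIsControlField ht hTI ht.2 x).trans ?_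
        rw [hρ]
        gcongr
      rw [sub_zero, sub_zero, hψΦ t ht, hψΦ t ht]
      refine (hℓ.abs_sub_le (hb x hx) (hb y hy)).trans ?_
      have e : ((Φ t T x, z.2) : E d × E d) - (Φ t T y, z.2) = (Φ t T x - Φ t T y, 0) := by simp
      rw [e]
      have h1 : ‖((Φ t T x - Φ t T y, 0) : E d × E d)‖ ≤ ‖x - y‖ * (Real.exp (2 * (L * T)) *
          Real.exp (2 * (L * ∫ s in t..T, ‖θ s‖))) := by
        refine norm_prod_zero_le ((hΦ.dist_le hF hθ hT ht x y).trans ?_)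
        rw [← Real.exp_add, intervalIntegral.integral_const_mul,
          intervalIntegral.integral_add intervalIntegrable_const hi,
          intervalIntegral.integral_const, smul_eq_mul, mul_one]
        gcongr
        have : L * (T - t) ≤ L * T := by gcongr; linarith [ht.1]
        linarith
      calc _ ≤ Λ ρ * (‖x - y‖ * (Real.exp (2 * (L * T)) *
          Real.exp (2 * (L * ∫ s in t..T, ‖θ s‖)))) := by gcongr
        _ = _ := by ring
  simpa using key

/-- A bootstrap from the final time. If the tail integral exceeded 1, by continuity it would equal 1
at some `t₁` and be at most 1 on `[t₁, T]`; there `v ≤ b e^a`, so the tail integral at `t₁` would be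
at most `b e^a T < 1`. -/
theorem le_one_of_le_mul_exp {v : ℝ → ℝ} {T b a : ℝ} (hT : 0 < T)
    (hv : IntervalIntegrable v volume 0 T) (hv0 : ∀ t, 0 ≤ v t) (ha : 0 ≤ a) (hb0 : 0 ≤ b)
    (hb : b * Real.exp a * T < 1)
    (h : ∀ᵐ t ∂(volume.restrict (Icc 0 T)), v t ≤ b * Real.exp (a * ∫ s in t..T, v s)) :
    ∀ t ∈ Icc 0 T, ∫ s in t..T, v s ≤ 1 := by
  have hsub : ∀ t ∈ Icc 0 T, uIcc t T ⊆ uIcc 0 T := fun t ht => by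
    rw [uIcc_of_le ht.2, uIcc_of_le hT.le]; exact Icc_subset_Icc_left ht.1
  have hanti : ∀ t ∈ Icc 0 T, ∀ s ∈ Icc t T, ∫ q in s..T, v q ≤ ∫ q in t..T, v q :=
    fun t ht s hs => intervalIntegral.integral_mono_interval hs.1 hs.2 le_rfl
      (Eventually.of_forall hv0) (hv.mono_set (hsub t ht))
  have hcont : ContinuousOn (fun t => ∫ s in t..T, v s) (Icc 0 T) := by
    have h1 := intervalIntegral.continuousOn_primitive_interval_left (a := 0) (b := T)
      (f := v) (μ := volume) (by
        rw [uIcc_of_le hT.le]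
        exact (intervalIntegrable_iff_integrableOn_Icc_of_le hT.le).1 hv)
    rwa [uIcc_of_le hT.le] at h1
  intro t ht
  by_contra! hlt
  have h1 : (1 : ℝ) ∈ (fun t => ∫ s in t..T, v s) '' Icc t T := by
    refine intermediate_value_Icc' ht.2 (hcont.mono (Icc_subset_Icc_left ht.1)) ⟨?_, hlt.le⟩
    simp
  obtain ⟨t₁, ht₁, h2⟩ := h1
  have ht₁' : t₁ ∈ Icc 0 T := ⟨ht.1.trans ht₁.1, ht₁.2⟩
  have h2' : ∫ s in t₁..T, v s = 1 := h2
  have h3 : ∫ s in t₁..T, v s ≤ ∫ _ in t₁..T, b * Real.exp a := by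
    refine intervalIntegral.integral_mono_ae_restrict ht₁.2 (hv.mono_set (hsub t₁ ht₁'))
      intervalIntegrable_const ?_
    have h4 := ae_restrict_of_ae_restrict_of_subset (Icc_subset_Icc_left ht₁'.1) h
    filter_upwards [h4, ae_restrict_mem measurableSet_Icc] with s hs hsI
    refine hs.trans ?_
    have := hanti t₁ ht₁' s hsI
    rw [h2'] at this
    gcongr
    nlinarith
  rw [h2', intervalIntegral.integral_const, smul_eq_mul] at h3
  have h5 : (T - t₁) * (b * Real.exp a) ≤ T * (b * Real.exp a) := by
    gcongr
    linarith [ht₁'.1]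
  linarith

/-- Controls fulfilling the maximum principle are bounded by `1` if the regularization parameter
is large. -/
theorem UniformBounds.norm_le_one_of_satisfiesPMP (hB : UniformBounds F ℓ C T r R M)
    (hF : IsRegular F C L A) (hℓ : IsC2Cost ℓ Λ) (hT : 0 < T) (hlam : 0 < lam)
    (hM3 : M * (Λ ((R + 1 + C * T) * Real.exp (2 * (C * T))) * Real.exp (2 * (L * T))) *
      Real.exp (2 * L) * (T + 1) ≤ lam) {μ₀ : Measure (E d × E d)}
    (hμ₀ : μ₀ (Metric.closedBall 0 r)ᶜ = 0) {μ : ℝ → Measure (E d × E d)} (hθ : IsControl T θ)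
    (hμ : IsWeakSolution F T θ μ₀ μ) (hψ : IsAdjointState F ℓ T θ ψ)
    (hp : ∀ᵐ t ∂(volume.restrict (Icc (0 : ℝ) T)), θ t = -(1 / (2 * lam)) •
        ∫ z, ContinuousLinearMap.adjoint (gradTheta F t z.1 (θ t)) (gradPsi ψ t z) ∂(μ t)) :
    ∀ᵐ t ∂(volume.restrict (Icc (0 : ℝ) T)), ‖θ t‖ ≤ 1 := by
  have hM := hB.M_nonneg
  have hL := hF.L_nonneg
  set P := Λ ((R + 1 + C * T) * Real.exp (2 * (C * T))) * Real.exp (2 * (L * T)) with hP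
  have hP0 : 0 ≤ P := mul_nonneg (hℓ.nonneg _) (Real.exp_pos _).le
  have hi := (hθ.intervalIntegrable hT).norm
  have h1 : ∀ᵐ t ∂(volume.restrict (Icc (0 : ℝ) T)),
      ‖θ t‖ ≤ 1 / (2 * lam) * (M * P) * Real.exp (2 * L * ∫ s in t..T, ‖θ s‖) := by
    filter_upwards [hp, ae_restrict_mem measurableSet_Icc] with t ht htI
    have hpr := (hμ.prob t htI).1
    have hsupp := hB.support hF hT hμ₀ hθ hμ htI
    have h2 := norm_integral_le_of_norm_le_const (μ := μ t)
      (C := M * (P * Real.exp (2 * (L * ∫ s in t..T, ‖θ s‖))))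
      (f := fun z => ContinuousLinearMap.adjoint (gradTheta F t z.1 (θ t)) (gradPsi ψ t z)) (by
        rw [← mem_ae_iff] at hsupp
        filter_upwards [hsupp] with z hz
        have hz' : ‖z‖ ≤ R := by simpa using hz
        refine (ContinuousLinearMap.le_opNorm _ _).trans ?_
        rw [LinearIsometryEquiv.norm_map]
        have a1 := hB.gradTheta_le t z.1 (θ t) ((norm_fst_le z).trans hz')
        have a2 := hψ.norm_gradPsi_le hF hℓ hθ hT htI hz'
        gcongr)
    rw [probReal_univ, mul_one] at h2
    have h3 := congrArg norm ht
    rw [norm_smul, norm_neg, Real.norm_of_nonneg (by positivity)] at h3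
    rw [h3]
    calc _ ≤ 1 / (2 * lam) * (M * (P * Real.exp (2 * (L * ∫ s in t..T, ‖θ s‖)))) := by gcongr
      _ = _ := by rw [← mul_assoc 2 L]; ring
  have he := Real.exp_pos (2 * L)
  -- The factor `T + 1` serves two purposes: the smallness required by the bootstrap, and the
  -- pointwise bound by 1 deduced from it.
  have hb : 1 / (2 * lam) * (M * P) * Real.exp (2 * L) * (T + 1) ≤ 1 / 2 := by
    calc _ = 1 / (2 * lam) * (M * P * Real.exp (2 * L) * (T + 1)) := by ring
      _ ≤ 1 / (2 * lam) * lam := by gcongr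
      _ = 1 / 2 := by field_simp
  have hb0 : 0 ≤ 1 / (2 * lam) * (M * P) * Real.exp (2 * L) := by positivity
  have h4 := le_one_of_le_mul_exp (v := fun t => ‖θ t‖) hT hi (fun _ => norm_nonneg _)
    (a := 2 * L) (by positivity) (by positivity) (by nlinarith) h1
  filter_upwards [h1, ae_restrict_mem measurableSet_Icc] with t ht htI
  refine ht.trans ?_
  calc _ ≤ 1 / (2 * lam) * (M * P) * Real.exp (2 * L) := by
        exact mul_le_mul_of_nonneg_left (Real.exp_le_exp.2
          (mul_le_of_le_one_right (by positivity) (h4 t htI))) (by positivity)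
    _ ≤ 1 := by nlinarith

end APriori

/-! ### Uniqueness for the maximum principle -/

theorem norm_smul_inv_max_sub_le {W : Type*} [NormedAddCommGroup W] [NormedSpace ℝ W] (x y : W)
    (hy : ‖y‖ ≤ 1) : ‖(max 1 ‖x‖)⁻¹ • x - y‖ ≤ 2 * ‖x - y‖ := by
  have h1 : ‖(max 1 ‖x‖)⁻¹ • x - x‖ ≤ ‖x - y‖ := by
    rcases le_total ‖x‖ 1 with h | h
    · simp [max_eq_left h]
    · rw [max_eq_right h]
      have h0 : 0 < ‖x‖ := one_pos.trans_le h
      have e : ‖x‖⁻¹ • x - x = -((1 - ‖x‖⁻¹) • x) := by rw [sub_smul, one_smul]; abel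
      rw [e, norm_neg, norm_smul, Real.norm_of_nonneg (by
        rw [sub_nonneg]; exact inv_le_one_of_one_le₀ h), sub_mul, inv_mul_cancel₀ h0.ne']
      have := norm_sub_norm_le x y
      linarith
  have h2 := norm_sub_le_norm_sub_add_norm_sub ((max 1 ‖x‖)⁻¹ • x) x y
  linarith

/-- Continuous functions are dense in `L¹`; radial truncation to the unit ball at most doubles the
distance to a control bounded by 1, whence the approximation within `ε / 2`. -/
theorem exists_isUnitControl_approx {T : ℝ} {θ : ℝ → E m} (hT : 0 < T) (hθ : IsControl T θ)
    (h1 : ∀ᵐ t ∂(volume.restrict (Icc (0 : ℝ) T)), ‖θ t‖ ≤ 1) {ε : ℝ} (hε : 0 < ε) :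
    ∃ ϑ, IsUnitControl ϑ ∧ ∫ s in (0 : ℝ)..T, ‖ϑ s - θ s‖ ≤ ε := by
  have hi : Integrable θ (volume.restrict (Icc 0 T)) := MemLp.integrable (by norm_num) hθ
  obtain ⟨g, -, hg, hgc, hgi⟩ := hi.exists_hasCompactSupport_integral_sub_le (half_pos hε)
  have hu : IsUnitControl fun t => (max 1 ‖g t‖)⁻¹ • g t := by
    refine ⟨((continuous_const.max hgc.norm).inv₀ fun t =>
      (one_pos.trans_le (le_max_left _ _)).ne').smul hgc, fun t => ?_⟩
    have h0 : 0 < max 1 ‖g t‖ := one_pos.trans_le (le_max_left _ _)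
    rw [norm_smul, norm_inv, Real.norm_of_nonneg h0.le, inv_mul_le_iff₀ h0, mul_one]
    exact le_max_right _ _
  refine ⟨_, hu, ?_⟩
  rw [intervalIntegral.integral_of_le hT.le, ← integral_Icc_eq_integral_Ioc]
  calc ∫ s in Icc 0 T, ‖(max 1 ‖g s‖)⁻¹ • g s - θ s‖ ≤ ∫ s in Icc 0 T, 2 * ‖θ s - g s‖ := by
        refine integral_mono_ae (((hu.isControl (T := T)).integrable (by norm_num)).sub hi).norm
          ((hi.sub hgi).norm.const_mul 2) ?_
        filter_upwards [h1] with s hs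
        rw [norm_sub_rev (θ s)]
        exact norm_smul_inv_max_sub_le _ _ hs
    _ ≤ ε := by rw [integral_const_mul]; linarith

section Uniqueness

variable {F : ℝ → E d → E m → E d} {C L : ℝ} {A : ℝ → ℝ} {ℓ : E d × E d → ℝ} {Λ : ℝ → ℝ}
  {T r R M lam : ℝ} {θ θ' : ℝ → E m} {ψ : ℝ → E d × E d → ℝ}

/-- The adjoint state of a measurable control is compared with the one of a continuous control. -/
theorem UniformBounds.norm_gradPsi_sub_adjointVector_le (hB : UniformBounds F ℓ C T r R M)
    (hF : IsRegular F C L A) (hℓ : IsC2Cost ℓ Λ) (hT : 0 < T) (hθ : IsUnitControl θ)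
    (hθ' : IsControl T θ') (hle : ∀ᵐ t ∂(volume.restrict (Icc (0 : ℝ) T)), ‖θ' t‖ ≤ 1)
    (hψ : IsAdjointState F ℓ T θ' ψ) {t : ℝ} (ht : t ∈ Icc 0 T) {z : E d × E d} (hz : ‖z‖ ≤ R) :
    ‖gradPsi ψ t z - adjointVector F θ ℓ T t z‖ ≤ M * ∫ s in (0 : ℝ)..T, ‖θ' s - θ s‖ := by
  obtain ⟨Φ, hΦ, hψΦ⟩ := hψ.characteristic
  have hM := hB.M_nonneg
  have hC := hF.nonneg
  have hL := hF.L_nonneg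
  have hTI : T ∈ Icc 0 T := ⟨hT.le, le_rfl⟩
  have hI : 0 ≤ ∫ s in (0 : ℝ)..T, ‖θ' s - θ s‖ :=
    intervalIntegral.integral_nonneg hT.le fun _ _ => norm_nonneg _
  have hR1 : 0 ≤ R + 1 := by linarith [hB.R_nonneg]
  refine norm_gradPsi_sub_le (mul_nonneg hM hI) (hasGradientAt_pullback hF hℓ hθ t z)
    (hψ.differentiableAt ht z) hz fun x y hx hy => ?_
  have hmem : ∀ x : E d, ‖x‖ ≤ R + 1 → ‖((x, z.2) : E d × E d)‖ ≤ R + 1 := fun x hx => by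
    rw [Prod.norm_mk]
    exact max_le hx ((norm_snd_le z).trans (hz.trans (by linarith)))
  set S := (R + 1 + C * T) * Real.exp (2 * (C * T)) with hS
  set S' := max (flowRadius (2 * L) C T (R + 1)) (max S (R + 1)) with hS'
  set c := Λ S' * (A S * Real.exp (2 * (2 * L * T))) with hc
  have hc0 : 0 ≤ c := mul_nonneg (hℓ.nonneg _) (mul_nonneg (hF.A_nonneg _) (Real.exp_pos _).le)
  -- Replacing `θ'` by a continuous `ϑ` introduces an error `2cε` not proportional to `|x - y|`;
  -- this is harmless, since `ε → 0` with `x` and `y` fixed.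
  have approx : ∀ ε > 0, |(ψ t (x, z.2) - ℓ (flow (controlledField F θ) t (x, z.2) T)) -
      (ψ t (y, z.2) - ℓ (flow (controlledField F θ) t (y, z.2) T))| ≤
      M * (∫ s in (0 : ℝ)..T, ‖θ' s - θ s‖) * ‖x - y‖ + (M * ‖x - y‖ + 2 * c) * ε := by
    intro ε hε
    obtain ⟨ϑ, hϑ, hϑε⟩ := exists_isUnitControl_approx hT hθ' hle hε
    have close : ∀ x : E d, ‖x‖ ≤ R + 1 →
        |ψ t (x, z.2) - ℓ (flow (controlledField F ϑ) t (x, z.2) T)| ≤ c * ε := by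
      intro x hx
      have hf := hF.isC2Field hϑ
      rw [hψΦ t ht, abs_sub_comm]
      have b1 : ‖flow (controlledField F ϑ) t (x, z.2) T‖ ≤ S' :=
        (hf.norm_flow_le_radius (hmem x hx) (T := T) (by
          rw [abs_of_nonneg (by linarith [ht.2])]; linarith [ht.1])).trans (le_max_left _ _)
      have b2 : ‖((Φ t T x, z.2) : E d × E d)‖ ≤ S' := by
        rw [Prod.norm_mk]
        refine max_le ?_ ?_
        · refine (hΦ.norm_le hF.toIsControlField ht hTI ht.2 x).trans ?_
          refine le_trans ?_ ((le_max_left S (R + 1)).trans (le_max_right _ _))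
          rw [hS]
          gcongr
        · exact ((norm_snd_le z).trans (hz.trans (by linarith))).trans
            ((le_max_right S (R + 1)).trans (le_max_right _ _))
      refine (hℓ.abs_sub_le b1 b2).trans ?_
      have h1 := hΦ.dist_flow_controlledField_le hF hθ' hT hϑ ht (x, z.2) (ρ := R + 1) hx
      have h2 := hℓ.nonneg S'
      have h3 := hF.A_nonneg S
      calc _ ≤ Λ S' * (A S * (∫ s in (0 : ℝ)..T, ‖ϑ s - θ' s‖) *
            Real.exp (2 * (2 * L * T))) := by gcongr
        _ ≤ Λ S' * (A S * ε * Real.exp (2 * (2 * L * T))) := by gcongr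
        _ = c * ε := by rw [hc]; ring
    -- For two continuous unit controls the pullbacks are differentiable, and `adjointGrad_sub`
    -- bounds the Lipschitz constant of their difference by the `L¹` distance of the controls.
    have hdiff : |(ℓ (flow (controlledField F ϑ) t (x, z.2) T) -
          ℓ (flow (controlledField F θ) t (x, z.2) T)) -
        (ℓ (flow (controlledField F ϑ) t (y, z.2) T) -
          ℓ (flow (controlledField F θ) t (y, z.2) T))| ≤
        M * (∫ s in (0 : ℝ)..T, ‖ϑ s - θ s‖) * ‖((x, z.2) : E d × E d) - (y, z.2)‖ := by
      refine (convex_closedBall (0 : E d × E d) (R + 1)).norm_image_sub_le_of_norm_hasFDerivWithin_le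
        (f := fun w => ℓ (flow (controlledField F ϑ) t w T) -
          ℓ (flow (controlledField F θ) t w T)) (fun w _ =>
          (((hF.isC2Field hϑ).hasFDerivAt_pullback hℓ T t w).sub
            ((hF.isC2Field hθ).hasFDerivAt_pullback hℓ T t w)).hasFDerivWithinAt)
        (fun w hw => ?_) (by simpa using hmem y hy) (by simpa using hmem x hx)
      have hw' : ‖w‖ ≤ R + 1 := by simpa using hw
      simpa using hB.adjointGrad_sub ϑ θ hϑ hθ t ht w w hw' hw'
    have hxy : ‖((x, z.2) : E d × E d) - (y, z.2)‖ ≤ ‖x - y‖ := by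
      have e : ((x, z.2) : E d × E d) - (y, z.2) = (x - y, 0) := by simp
      rw [e]
      exact norm_prod_zero_le le_rfl
    have hIε : ∫ s in (0 : ℝ)..T, ‖ϑ s - θ s‖ ≤ ε + ∫ s in (0 : ℝ)..T, ‖θ' s - θ s‖ := by
      have i1 : IntervalIntegrable (fun s => ‖ϑ s - θ' s‖) volume 0 T :=
        (((hϑ.isControl (T := T)).sub hθ').intervalIntegrable hT).norm
      have i2 : IntervalIntegrable (fun s => ‖θ' s - θ s‖) volume 0 T :=
        ((hθ'.sub (hθ.isControl (T := T))).intervalIntegrable hT).norm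
      have i3 : IntervalIntegrable (fun s => ‖ϑ s - θ s‖) volume 0 T :=
        (((hϑ.isControl (T := T)).sub (hθ.isControl (T := T))).intervalIntegrable hT).norm
      have h1 := intervalIntegral.integral_mono_on hT.le i3 (i1.add i2) fun s _ =>
        norm_sub_le_norm_sub_add_norm_sub (ϑ s) (θ' s) (θ s)
      rw [intervalIntegral.integral_add i1 i2] at h1
      linarith
    have h1 := close x hx
    have h2 := close y hy
    have h3 : M * (∫ s in (0 : ℝ)..T, ‖ϑ s - θ s‖) * ‖((x, z.2) : E d × E d) - (y, z.2)‖ ≤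
        M * (ε + ∫ s in (0 : ℝ)..T, ‖θ' s - θ s‖) * ‖x - y‖ := by gcongr
    have h4 := hdiff.trans h3
    rw [abs_le] at h1 h2 h4 ⊢
    constructor <;> linarith [h1.1, h1.2, h2.1, h2.2, h4.1, h4.2]
  have hlim : Tendsto (fun ε : ℝ => M * (∫ s in (0 : ℝ)..T, ‖θ' s - θ s‖) * ‖x - y‖ +
      (M * ‖x - y‖ + 2 * c) * ε) (𝓝[>] 0)
      (𝓝 (M * (∫ s in (0 : ℝ)..T, ‖θ' s - θ s‖) * ‖x - y‖ + (M * ‖x - y‖ + 2 * c) * 0)) :=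
    (Continuous.tendsto (by fun_prop) 0).mono_left nhdsWithin_le_nhds
  rw [mul_zero, add_zero] at hlim
  refine ge_of_tendsto hlim ?_
  filter_upwards [self_mem_nhdsWithin] with ε hε using approx ε hε

/-- The maximum principle has only one solution, up to null sets. -/
theorem UniformBounds.ae_eq_of_satisfiesPMP (hB : UniformBounds F ℓ C T r R M)
    (hF : IsRegular F C L A) (hℓ : IsC2Cost ℓ Λ) (hT : 0 < T) (hlam : 0 < lam)
    (hM3 : M * (Λ ((R + 1 + C * T) * Real.exp (2 * (C * T))) * Real.exp (2 * (L * T))) *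
      Real.exp (2 * L) * (T + 1) ≤ lam) (hM4 : M ^ 2 + (M ^ 2 + 2 * M ^ 4) * T < 2 * lam)
    {μ₀ : Measure (E d × E d)} (hμ₀ : μ₀ (Metric.closedBall 0 r)ᶜ = 0) (hθ : IsUnitControl θ)
    (hfix : ∀ t ∈ Icc 0 T, θ t = -(1 / (2 * lam)) • meanControlGrad F θ ℓ T μ₀ t)
    (hθ' : IsControl T θ') (hPMP : SatisfiesPMP F ℓ T lam μ₀ θ') :
    θ' =ᵐ[volume.restrict (Icc 0 T)] θ := by
  obtain ⟨μ, ψ, hμ, hψ, hp⟩ := hPMP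
  have hM := hB.M_nonneg
  have hle := hB.norm_le_one_of_satisfiesPMP hF hℓ hT hlam hM3 hμ₀ hθ' hμ hψ hp
  have hη : IntervalIntegrable (fun s => ‖θ' s - θ s‖) volume 0 T :=
    ((hθ'.sub (hθ.isControl (T := T))).intervalIntegrable hT).norm
  set I := ∫ s in (0 : ℝ)..T, ‖θ' s - θ s‖ with hI
  have hI0 : 0 ≤ I := intervalIntegral.integral_nonneg hT.le fun _ _ => norm_nonneg _
  -- The two fixed-point equations are subtracted. The control inside `∇_θ F` gives the local term,
  -- the adjoint states give `M² I`, and the exchange of the measures gives `2 M⁴ I`.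
  have key : ∀ᵐ t ∂(volume.restrict (Icc (0 : ℝ) T)),
      ‖θ' t - θ t‖ ≤ 1 / (2 * lam) * (M ^ 2 * ‖θ' t - θ t‖ + (M ^ 2 + 2 * M ^ 4) * I) := by
    filter_upwards [hp, ae_restrict_mem measurableSet_Icc] with t ht htI
    have hpr := (hμ.prob t htI).1
    have hsupp := hB.support hF hT hμ₀ hθ' hμ htI
    have hcg : Continuous fun z => controlGrad F θ ℓ T t z :=
      (continuous_controlGrad hF hℓ hθ).comp (f := fun z => (t, z)) (by fun_prop)
    have hcψ : Continuous fun z => gradPsi ψ t z := by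
      have h1 : ∀ z, gradPsi ψ t z = (InnerProductSpace.toDual ℝ (E d)).symm
          ((fderiv ℝ (ψ t) z).comp (ContinuousLinearMap.inl ℝ (E d) (E d))) := fun z => by
        rw [gradPsi, gradient]
        congr 1
        have h2 := (((hψ.contDiff t htI).differentiable (by norm_num)) z).hasFDerivAt
        exact (HasFDerivAt.comp (f := fun x => (x, z.2)) z.1 h2
          (hasFDerivAt_prodMk_left z.1 z.2)).fderiv
      simp only [h1]
      exact (LinearIsometryEquiv.continuous _).comp
        (((hψ.contDiff t htI).continuous_fderiv (by norm_num)).clm_comp continuous_const)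
    have hca : Continuous fun z : E d × E d =>
        ContinuousLinearMap.adjoint (gradTheta F t z.1 (θ' t)) (gradPsi ψ t z) := by
      have h1 : Continuous fun z : E d × E d => gradTheta F t z.1 (θ' t) :=
        hF.continuous_gradTheta.comp (f := fun z : E d × E d => (t, z.1, θ' t)) (by fun_prop)
      exact ((LinearIsometryEquiv.continuous _).comp h1).clm_apply hcψ
    have h1 : ‖∫ z, ContinuousLinearMap.adjoint (gradTheta F t z.1 (θ' t)) (gradPsi ψ t z) ∂(μ t) -
        ∫ z, controlGrad F θ ℓ T t z ∂(μ t)‖ ≤ M * (M * ‖θ' t - θ t‖ + M * I) := by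
      rw [← integral_sub (integrable_of_continuous hsupp hca)
        (integrable_of_continuous hsupp hcg)]
      have h2 := norm_integral_le_of_norm_le_const (μ := μ t) (C := M * (M * ‖θ' t - θ t‖ + M * I))
        (f := fun z => ContinuousLinearMap.adjoint (gradTheta F t z.1 (θ' t)) (gradPsi ψ t z) -
          controlGrad F θ ℓ T t z) (by
          rw [← mem_ae_iff] at hsupp
          filter_upwards [hsupp] with z hz
          have hz' : ‖z‖ ≤ R := by simpa using hz
          have hx := (norm_fst_le z).trans hz'
          rw [norm_sub_rev]
          refine norm_adjoint_apply_sub_le ?_ ?_ (hB.gradTheta_le _ _ _ hx)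
            (hB.adjoint_le θ hθ t htI z hz')
          · rw [norm_sub_rev]
            exact hB.gradTheta_theta _ _ _ _ hx
          · rw [norm_sub_rev]
            exact hB.norm_gradPsi_sub_adjointVector_le hF hℓ hT hθ hθ' hle hψ htI hz')
      simpa using h2
    have hLip : LipschitzOnWith (2 * M ^ 2).toNNReal (fun z => controlGrad F θ ℓ T t z)
        (Metric.closedBall 0 R) := hB.lipschitzOnWith_controlGrad hθ htI
    have h3 := hB.norm_integral_sub_le hF hT hμ₀ hθ hθ' hμ hcg hLip htI
    rw [← hI, Real.coe_toNNReal _ (by positivity)] at h3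
    have h4 : θ' t - θ t = -(1 / (2 * lam)) • (∫ z, ContinuousLinearMap.adjoint
        (gradTheta F t z.1 (θ' t)) (gradPsi ψ t z) ∂(μ t) - meanControlGrad F θ ℓ T μ₀ t) := by
      rw [smul_sub, ← ht, ← hfix t htI]
    have h6 := congrArg norm h4
    rw [norm_smul, norm_neg, Real.norm_of_nonneg (by positivity)] at h6
    refine h6.trans_le ?_
    gcongr
    have h5 := norm_sub_le_norm_sub_add_norm_sub (∫ z, ContinuousLinearMap.adjoint
      (gradTheta F t z.1 (θ' t)) (gradPsi ψ t z) ∂(μ t)) (∫ z, controlGrad F θ ℓ T t z ∂(μ t))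
      (meanControlGrad F θ ℓ T μ₀ t)
    rw [meanControlGrad] at h5 ⊢
    linarith
  have hrhs : IntervalIntegrable (fun t => 1 / (2 * lam) * (M ^ 2 * ‖θ' t - θ t‖ +
      (M ^ 2 + 2 * M ^ 4) * I)) volume 0 T :=
    ((hη.const_mul _).add intervalIntegrable_const).const_mul _
  have h6 := intervalIntegral.integral_mono_ae_restrict hT.le hη hrhs key
  rw [intervalIntegral.integral_const_mul, intervalIntegral.integral_add (hη.const_mul _)
    intervalIntegrable_const, intervalIntegral.integral_const_mul, intervalIntegral.integral_const,
    ← hI, smul_eq_mul, sub_zero] at h6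
  -- Time integration closes the estimate on `I` alone; `hM4` then forces `I = 0`.
  have h7 : 2 * lam * I ≤ (M ^ 2 + (M ^ 2 + 2 * M ^ 4) * T) * I := by
    calc 2 * lam * I ≤ 2 * lam * (1 / (2 * lam) *
          (M ^ 2 * I + T * ((M ^ 2 + 2 * M ^ 4) * I))) := by gcongr
      _ = _ := by field_simp
  have h8 : I = 0 := by nlinarith
  rw [hI, intervalIntegral.integral_of_le hT.le, ← integral_Icc_eq_integral_Ioc,
    integral_eq_zero_iff_of_nonneg (fun _ => norm_nonneg _)
      ((intervalIntegrable_iff_integrableOn_Icc_of_le hT.le).1 hη)] at h8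
  filter_upwards [h8] with t ht
  exact sub_eq_zero.1 (norm_eq_zero.1 ht)

end Uniqueness

/-! ### Regularity of the optimal control -/

namespace UniformBounds

variable {F : ℝ → E d → E m → E d} {C L : ℝ} {A : ℝ → ℝ} {ℓ : E d × E d → ℝ} {Λ : ℝ → ℝ}
  {T r R M lam : ℝ} {θ θ' : ℝ → E m} {μ₀ μ₀' : Measure (E d × E d)}

/-- In the fixed-point equation the trajectories, the costates along them, and by hypothesis `∇_θ F`
are Lipschitz in time. The increment of `θ` itself also occurs on the right, with coefficient `M² ≤
lam` against `2 * lam` on the left, and is absorbed. -/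
theorem exists_lipschitzOnWith (hB : UniformBounds F ℓ C T r R M) (hF : IsRegular F C L A)
    (hℓ : IsC2Cost ℓ Λ) [IsProbabilityMeasure μ₀] (hT : 0 < T)
    (hμ₀ : μ₀ (Metric.closedBall 0 r)ᶜ = 0) (hlam : 0 < lam)
    (hM1 : M ^ 2 * (2 * M + 1) * (T + 1) ≤ lam) (hθ : IsUnitControl θ)
    (hfix : ∀ t ∈ Icc 0 T, θ t = -(1 / (2 * lam)) • meanControlGrad F θ ℓ T μ₀ t)
    (hFT : GradThetaTimeLipschitz F T) : ∃ K, LipschitzOnWith K θ (Icc 0 T) := by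
  have hM := hB.M_nonneg
  have hR := hB.R_nonneg
  obtain ⟨C₁, hC₁⟩ := hFT (R + 1) 1 (by linarith)
  have hM2 : M ^ 2 ≤ lam := by
    refine le_trans ?_ hM1
    rw [mul_assoc]
    exact le_mul_of_one_le_right (sq_nonneg M) (by nlinarith)
  refine ⟨(M * (C₁ + M ^ 2 + M) / lam).toNNReal, LipschitzOnWith.of_dist_le_mul
    fun t ht s hs => ?_⟩
  rw [dist_eq_norm, Real.dist_eq]
  have key : ‖meanControlGrad F θ ℓ T μ₀ t - meanControlGrad F θ ℓ T μ₀ s‖ ≤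
      M * ((C₁ + M ^ 2 + M) * |t - s| + M * ‖θ t - θ s‖) := by
    rw [meanControlGrad, meanControlGrad, ← integral_sub
      (integrable_controlGrad_flow hF hℓ hθ hμ₀ t) (integrable_controlGrad_flow hF hℓ hθ hμ₀ s)]
    have h1 := norm_integral_le_of_norm_le_const (μ := μ₀)
      (C := M * ((C₁ + M ^ 2 + M) * |t - s| + M * ‖θ t - θ s‖))
      (f := fun z => controlGrad F θ ℓ T t (flow (controlledField F θ) 0 z t) -
        controlGrad F θ ℓ T s (flow (controlledField F θ) 0 z s)) (by
        rw [← mem_ae_iff] at hμ₀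
        filter_upwards [hμ₀] with z hz
        have hz' : ‖z‖ ≤ r := by simpa using hz
        have hx := (norm_fst_le _).trans (hB.flow_le θ hθ t ht z hz')
        have hy := (norm_fst_le _).trans (hB.flow_le θ hθ s hs z hz')
        have h2 : ‖gradTheta F t (flow (controlledField F θ) 0 z t).1 (θ t) -
            gradTheta F s (flow (controlledField F θ) 0 z s).1 (θ s)‖ ≤
            (C₁ + M ^ 2) * |t - s| + M * ‖θ t - θ s‖ := by
          have a1 := hC₁ t ht s hs (flow (controlledField F θ) 0 z t).1
            (by simpa using hx.trans (by linarith)) (θ t) (hθ.norm_le t)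
          have a2 := hB.gradTheta_x s _ _ (θ t) hx hy (hθ.norm_le t)
          have a3 := hB.gradTheta_theta s _ (θ t) (θ s) hy
          have a4 : ‖(flow (controlledField F θ) 0 z t).1 - (flow (controlledField F θ) 0 z s).1‖ ≤
            M * |t - s| := (norm_fst_le (_ - _)).trans (hB.flow_time θ hθ t ht s hs z hz')
          have a5 := mul_le_mul_of_nonneg_left a4 hM
          have a6 := norm_sub_le_norm_sub_add_norm_sub
            (gradTheta F t (flow (controlledField F θ) 0 z t).1 (θ t))
            (gradTheta F s (flow (controlledField F θ) 0 z t).1 (θ t))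
            (gradTheta F s (flow (controlledField F θ) 0 z s).1 (θ s))
          have a7 := norm_sub_le_norm_sub_add_norm_sub
            (gradTheta F s (flow (controlledField F θ) 0 z t).1 (θ t))
            (gradTheta F s (flow (controlledField F θ) 0 z s).1 (θ t))
            (gradTheta F s (flow (controlledField F θ) 0 z s).1 (θ s))
          linarith
        refine (norm_adjoint_apply_sub_le h2 (hB.adjoint_time θ hθ t ht s hs z hz')
          (hB.gradTheta_le _ _ _ hy)
          (hB.adjoint_le θ hθ t ht _ (hB.flow_le θ hθ t ht z hz'))).trans (le_of_eq ?_)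
        ring)
    simpa using h1
  have h3 : ‖θ t - θ s‖ ≤ 1 / (2 * lam) *
      (M * ((C₁ + M ^ 2 + M) * |t - s| + M * ‖θ t - θ s‖)) := by
    have h4 : θ t - θ s = -(1 / (2 * lam)) •
        (meanControlGrad F θ ℓ T μ₀ t - meanControlGrad F θ ℓ T μ₀ s) := by
      rw [smul_sub, ← hfix t ht, ← hfix s hs]
    have h5 := congrArg norm h4
    rw [norm_smul, norm_neg, Real.norm_of_nonneg (by positivity)] at h5
    refine h5.trans_le ?_
    gcongr
  have h6 : 2 * lam * ‖θ t - θ s‖ ≤ M * ((C₁ + M ^ 2 + M) * |t - s| + M * ‖θ t - θ s‖) := by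
    calc _ ≤ 2 * lam * (1 / (2 * lam) *
          (M * ((C₁ + M ^ 2 + M) * |t - s| + M * ‖θ t - θ s‖))) := by gcongr
      _ = _ := by field_simp
  have h7 : M ^ 2 * ‖θ t - θ s‖ ≤ lam * ‖θ t - θ s‖ := by gcongr
  have h8 : ‖θ t - θ s‖ ≤ M * (C₁ + M ^ 2 + M) / lam * |t - s| := by
    rw [div_mul_eq_mul_div, le_div_iff₀ hlam]
    linarith
  exact h8.trans (by gcongr; exact Real.le_coe_toNNReal _)

/-- The two equations are compared at a time `t₀` where `|θ - θ'|` is maximal. A change of control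
at fixed measure costs at most `lam * D`, absorbed by `2 * lam * D`; a change of measure at fixed
control costs a multiple of `W1`, the integrand being Lipschitz in the initial point. -/
theorem norm_sub_le_W1 (hB : UniformBounds F ℓ C T r R M) (hF : IsRegular F C L A)
    (hℓ : IsC2Cost ℓ Λ) (hT : 0 < T) [IsProbabilityMeasure μ₀] [IsProbabilityMeasure μ₀']
    (hμ₀ : μ₀ (Metric.closedBall 0 r)ᶜ = 0) (hμ₀' : μ₀' (Metric.closedBall 0 r)ᶜ = 0)
    (hlam : 0 < lam) (hM1 : M ^ 2 * (2 * M + 1) * (T + 1) ≤ lam) (hθ : IsUnitControl θ)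
    (hθ' : IsUnitControl θ')
    (hfix : ∀ t ∈ Icc 0 T, θ t = -(1 / (2 * lam)) • meanControlGrad F θ ℓ T μ₀ t)
    (hfix' : ∀ t ∈ Icc 0 T, θ' t = -(1 / (2 * lam)) • meanControlGrad F θ' ℓ T μ₀' t)
    (hW : W1 μ₀ μ₀' ≠ ∞) {t : ℝ} (ht : t ∈ Icc 0 T) :
    ‖θ t - θ' t‖ ≤ (M ^ 2 * (2 * M + 1) + 1) / lam * (W1 μ₀ μ₀').toReal := by
  have hM := hB.M_nonneg
  set N := M ^ 2 * (2 * M + 1) with hN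
  have hN0 : 0 ≤ N := by positivity
  set W := (W1 μ₀ μ₀').toReal
  obtain ⟨t₀, ht₀, hmax⟩ := isCompact_Icc.exists_isMaxOn (nonempty_Icc.2 hT.le)
    (hθ.continuous.sub hθ'.continuous).norm.continuousOn (s := Icc 0 T)
  set D := ‖θ t₀ - θ' t₀‖ with hD
  have hD0 : 0 ≤ D := norm_nonneg _
  have hle : ∀ s ∈ Icc 0 T, ‖θ s - θ' s‖ ≤ D := fun s hs => hmax hs
  refine (hle t ht).trans ?_
  have hI : ∫ s in (0 : ℝ)..T, ‖θ s - θ' s‖ ≤ T * D := by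
    have h1 := intervalIntegral.integral_mono_on (μ := volume) (g := fun _ => D) hT.le
      ((hθ.continuous.sub hθ'.continuous).norm.intervalIntegrable 0 T) intervalIntegrable_const hle
    simpa using h1
  have h1 : ‖meanControlGrad F θ ℓ T μ₀' t₀ - meanControlGrad F θ' ℓ T μ₀' t₀‖ ≤
      N * (T + 1) * D := by
    refine (hB.norm_meanControlGrad_sub_le hF hℓ hT hμ₀' hθ hθ' ht₀).trans ?_
    rw [mul_assoc N]
    exact mul_le_mul_of_nonneg_left (by linarith) hN0
  have h2 : ‖meanControlGrad F θ ℓ T μ₀ t₀ - meanControlGrad F θ ℓ T μ₀' t₀‖ ≤ (N + 1) * W := by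
    have h3 := norm_integral_sub_le_W1 hμ₀ hμ₀' (integrable_controlGrad_flow hF hℓ hθ hμ₀ t₀)
      -- The constant is `N + 1` rather than `N` because it must be positive and `N` may vanish.
      (integrable_controlGrad_flow hF hℓ hθ hμ₀' t₀) (ε := 0) (κ := N + 1) (by positivity)
      fun p hp q hq => by
        have h4 := hB.norm_controlGrad_flow_sub_le hT hθ hθ ht₀ (z := p) (z' := q)
          (by simpa using hp) (by simpa using hq)
        simp only [sub_self, norm_zero, intervalIntegral.integral_zero, add_zero] at h4
        have := norm_nonneg (p - q)
        linarith
    rw [ENNReal.ofReal_zero, zero_add, ← ENNReal.ofReal_toReal hW,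
      ← ENNReal.ofReal_mul (by positivity), ENNReal.ofReal_le_ofReal_iff (by positivity)] at h3
    exact h3
  have h4 : θ t₀ - θ' t₀ = -(1 / (2 * lam)) •
      (meanControlGrad F θ ℓ T μ₀ t₀ - meanControlGrad F θ' ℓ T μ₀' t₀) := by
    rw [smul_sub, ← hfix t₀ ht₀, ← hfix' t₀ ht₀]
  have h5 := congrArg norm h4
  rw [norm_smul, norm_neg, Real.norm_of_nonneg (by positivity), ← hD] at h5
  have h6 := norm_sub_le_norm_sub_add_norm_sub (meanControlGrad F θ ℓ T μ₀ t₀)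
    (meanControlGrad F θ ℓ T μ₀' t₀) (meanControlGrad F θ' ℓ T μ₀' t₀)
  have h7 : D ≤ 1 / (2 * lam) * ((N + 1) * W + lam * D) := by
    refine h5.trans_le ?_
    gcongr
    have : N * (T + 1) * D ≤ lam * D := by gcongr
    linarith
  have h8 : 2 * lam * D ≤ (N + 1) * W + lam * D := by
    calc _ ≤ 2 * lam * (1 / (2 * lam) * ((N + 1) * W + lam * D)) := by gcongr
      _ = _ := by field_simp
  rw [div_mul_eq_mul_div, le_div_iff₀ hlam]
  linarith

end UniformBounds

/-! ### Fields that agree on the time interval -/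

section CongrField

variable {F G : ℝ → E d → E m → E d} {ℓ : E d × E d → ℝ} {T lam : ℝ} {θ : ℝ → E m}
  {μ₀ : Measure (E d × E d)} {μ : ℝ → Measure (E d × E d)}

theorem integral_congr_field {W : Type*} [NormedAddCommGroup W] [NormedSpace ℝ W]
    (h : ∀ t ∈ Icc 0 T, F t = G t) {a b : ℝ} (ha : a ∈ Icc 0 T) (hb : b ∈ Icc 0 T)
    (g : ℝ → (E d → E m → E d) → W) : ∫ s in a..b, g s (F s) = ∫ s in a..b, g s (G s) :=
  intervalIntegral.integral_congr fun s hs => by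
    rw [h s ((uIcc_subset_Icc ha hb) hs)]

theorem gradTheta_congr_field {t : ℝ} (h : F t = G t) (x : E d) (ϑ : E m) :
    gradTheta F t x ϑ = gradTheta G t x ϑ := by
  rw [gradTheta, gradTheta, h]

theorem IsWeakSolution.congr_field (hT : 0 < T) (h : ∀ t ∈ Icc 0 T, F t = G t)
    (hμ : IsWeakSolution F T θ μ₀ μ) : IsWeakSolution G T θ μ₀ μ where
  prob := hμ.prob
  continuous := hμ.continuous
  initial := hμ.initial
  weak φ h₁ h₂ h₃ := (integral_congr_field h ⟨le_rfl, hT.le⟩ ⟨hT.le, le_rfl⟩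
    fun t f => ∫ z, fderiv ℝ φ (t, z) (1, f z.1 (θ t), 0) ∂(μ t)).symm.trans
      (hμ.weak φ h₁ h₂ h₃)

theorem IsFlow.congr_field {Φ : ℝ → ℝ → E d → E d} (h : ∀ t ∈ Icc 0 T, F t = G t)
    (hΦ : IsFlow F T θ Φ) : IsFlow G T θ Φ := fun τ hτ x =>
  ⟨(hΦ τ hτ x).1, fun t ht => by
    rw [(hΦ τ hτ x).2 t ht]
    congr 1
    exact integral_congr_field h hτ ht fun s f => f (Φ τ s x) (θ s)⟩

theorem IsAdjointState.congr_field {ψ : ℝ → E d × E d → ℝ} (hT : 0 < T)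
    (h : ∀ t ∈ Icc 0 T, F t = G t) (hψ : IsAdjointState F ℓ T θ ψ) :
    IsAdjointState G ℓ T θ ψ where
  contDiff := hψ.contDiff
  equation t ht z := by
    rw [hψ.equation t ht z]
    congr 1
    exact integral_congr_field h ht ⟨hT.le, le_rfl⟩ fun s f =>
      inner ℝ (gradPsi ψ s z) (f z.1 (θ s))
  characteristic := hψ.characteristic.imp fun _ hΦ => ⟨hΦ.1.congr_field h, hΦ.2⟩

theorem SatisfiesPMP.congr_field (hT : 0 < T) (h : ∀ t ∈ Icc 0 T, F t = G t)
    (hθ : SatisfiesPMP F ℓ T lam μ₀ θ) : SatisfiesPMP G ℓ T lam μ₀ θ := by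
  obtain ⟨μ, ψ, hμ, hψ, hp⟩ := hθ
  refine ⟨μ, ψ, hμ.congr_field hT h, hψ.congr_field hT h, ?_⟩
  filter_upwards [hp, ae_restrict_mem measurableSet_Icc] with t ht htI
  simpa only [gradTheta_congr_field (h t htI)] using ht

theorem satisfiesPMP_congr_field (hT : 0 < T) (h : ∀ t ∈ Icc 0 T, F t = G t) :
    SatisfiesPMP F ℓ T lam μ₀ θ ↔ SatisfiesPMP G ℓ T lam μ₀ θ :=
  ⟨fun hθ => hθ.congr_field hT h, fun hθ => hθ.congr_field hT fun t ht => (h t ht).symm⟩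

theorem IsOptimal.congr_field (hT : 0 < T) (h : ∀ t ∈ Icc 0 T, F t = G t)
    (hθ : IsOptimal F ℓ T lam μ₀ θ) : IsOptimal G ℓ T lam μ₀ θ := by
  obtain ⟨h1, μ, hμ, hmin⟩ := hθ
  exact ⟨h1, μ, hμ.congr_field hT h, fun θ' μ' h2 h3 =>
    hmin θ' μ' h2 (h3.congr_field hT fun t ht => (h t ht).symm)⟩

theorem isOptimal_congr_field (hT : 0 < T) (h : ∀ t ∈ Icc 0 T, F t = G t) :
    IsOptimal F ℓ T lam μ₀ θ ↔ IsOptimal G ℓ T lam μ₀ θ :=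
  ⟨fun hθ => hθ.congr_field hT h, fun hθ => hθ.congr_field hT fun t ht => (h t ht).symm⟩

theorem GradThetaTimeLipschitz.congr_field (h : ∀ t ∈ Icc 0 T, F t = G t)
    (hF : GradThetaTimeLipschitz F T) : GradThetaTimeLipschitz G T := fun R M hR =>
  (hF R M hR).imp fun C hC t ht s hs x hx ϑ hϑ => by
    rw [← gradTheta_congr_field (h t ht), ← gradTheta_congr_field (h s hs)]
    exact hC t ht s hs x hx ϑ hϑ

end CongrField

end NeurODE

/-! ### The main theorem -/

theorem theorem1p1 {d m : ℕ} (T : ℝ) (hT : 0 < T)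
    (F : ℝ → E d → E m → E d) (hF₁ : Assumption1 F T) (hF₂ : Assumption2 F T)
    (ℓ : E d × E d → ℝ) (hℓ : ContDiff ℝ 2 ℓ)
    (K : Set (E d × E d)) (hK : IsCompact K) :
    ∃ lam₀ : ℝ, 0 < lam₀ ∧ ∀ lam : ℝ, lam₀ ≤ lam →
      (∀ μ₀ : Measure (E d × E d), IsProbabilityMeasure μ₀ → μ₀ Kᶜ = 0 →
        -- existence of an optimal control
        (∃ θ, IsOptimal F ℓ T lam μ₀ θ) ∧
        -- the maximum principle characterizes optimality
        (∀ θ, IsControl T θ → (SatisfiesPMP F ℓ T lam μ₀ θ ↔ IsOptimal F ℓ T lam μ₀ θ)) ∧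
        -- uniqueness
        (∀ θ θ', IsOptimal F ℓ T lam μ₀ θ → IsOptimal F ℓ T lam μ₀ θ' →
          θ =ᵐ[volume.restrict (Icc 0 T)] θ') ∧
        -- Lipschitz regularity in time
        (GradThetaTimeLipschitz F T → ∀ θ, IsOptimal F ℓ T lam μ₀ θ →
          ∃ (L : ℝ≥0) (g : ℝ → E m), LipschitzOnWith L g (Icc 0 T) ∧
            θ =ᵐ[volume.restrict (Icc 0 T)] g)) ∧
      -- (Lipschitz) continuous dependence on the initial distribution
      (∃ C : ℝ≥0, ∀ μ₀ μ₀' : Measure (E d × E d),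
        IsProbabilityMeasure μ₀ → IsProbabilityMeasure μ₀' → μ₀ Kᶜ = 0 → μ₀' Kᶜ = 0 →
        ∀ θ θ', IsOptimal F ℓ T lam μ₀ θ → IsOptimal F ℓ T lam μ₀' θ' →
          eLpNorm (fun t => θ t - θ' t) ∞ (volume.restrict (Icc 0 T)) ≤ C * W1 μ₀ μ₀') := by
  obtain ⟨C, L, A, hF⟩ := exists_isRegular_clampTime hT hF₁ hF₂
  obtain ⟨Λ, hΛ⟩ := exists_isC2Cost hℓ
  obtain ⟨r, hr⟩ := hK.isBounded.subset_closedBall (0 : E d × E d)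
  obtain ⟨R, M, hB⟩ := exists_uniformBounds hF hΛ hT r
  have hG : ∀ t ∈ Icc 0 T, F t = clampTime F hT t := fun t ht => by
    rw [clampTime, projIcc_of_mem hT.le ht]
  have hM := hB.M_nonneg
  have hsupp : ∀ μ₀ : Measure (E d × E d), μ₀ Kᶜ = 0 → μ₀ (Metric.closedBall 0 r)ᶜ = 0 :=
    fun μ₀ h => measure_mono_null (compl_subset_compl.2 hr) h
  set P := M * (Λ ((R + 1 + C * T) * Real.exp (2 * (C * T))) * Real.exp (2 * (L * T))) *
    Real.exp (2 * L) * (T + 1) with hP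
  have hP0 : 0 ≤ P := by
    have := hΛ.nonneg ((R + 1 + C * T) * Real.exp (2 * (C * T)))
    positivity
  have hN0 : 0 ≤ M ^ 2 * (2 * M + 1) * (T + 1) := by positivity
  have hQ0 : 0 ≤ M ^ 2 + (M ^ 2 + 2 * M ^ 4) * T := by positivity
  -- The summands ensure, in order, the contraction, the a priori bound for the maximum principle,
  -- and both the optimality gap and the uniqueness for the maximum principle; the final 1 makes the
  -- inequalities strict. All depend on `K` only through the radius `r`, not on `μ₀`.
  refine ⟨M ^ 2 * (2 * M + 1) * (T + 1) + P + (M ^ 2 + (M ^ 2 + 2 * M ^ 4) * T) + 1,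
    by positivity, fun lam hlam₀ => ?_⟩
  have hlam : 0 < lam := by linarith
  have hM1 : M ^ 2 * (2 * M + 1) * (T + 1) ≤ lam := by linarith
  have hM2 : M ^ 2 + 2 * M ^ 4 * T < lam := by
    have : 0 ≤ M ^ 2 * T := by positivity
    linarith
  have hM3 : P ≤ lam := by linarith
  have hM4 : M ^ 2 + (M ^ 2 + 2 * M ^ 4) * T < 2 * lam := by linarith
  simp only [isOptimal_congr_field hT hG, satisfiesPMP_congr_field hT hG]
  refine ⟨fun μ₀ hμ₀ hμ₀K => ?_, ((M ^ 2 * (2 * M + 1) + 1) / lam).toNNReal,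
    fun μ₀ μ₀' hμ₀ hμ₀' hμ₀K hμ₀K' θ θ' hθ hθ' => ?_⟩
  · obtain ⟨ϑ, hϑ, hfix⟩ := hB.exists_fixedPoint hF hΛ hT (hsupp μ₀ hμ₀K) hlam hM1
    have hopt := hB.isOptimal hF hΛ hT (hsupp μ₀ hμ₀K) hlam hM2 hϑ hfix
    have huniq : ∀ θ, IsOptimal (clampTime F hT) ℓ T lam μ₀ θ →
        θ =ᵐ[volume.restrict (Icc 0 T)] ϑ := fun θ hθ =>
      hB.ae_eq_of_isOptimal hF hΛ hT (hsupp μ₀ hμ₀K) hlam hM2 hϑ hfix hθ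
    refine ⟨⟨ϑ, hopt⟩, fun θ hθ => ⟨fun h => ?_, fun h => ?_⟩,
      fun θ θ' hθ hθ' => (huniq θ hθ).trans (huniq θ' hθ').symm, fun hFT θ hθ => ?_⟩
    · exact hopt.congr hT (hB.ae_eq_of_satisfiesPMP hF hΛ hT hlam hM3 hM4 (hsupp μ₀ hμ₀K) hϑ hfix
        hθ h).symm
    · exact (satisfiesPMP_of_fixedPoint hF hΛ hϑ hT (hsupp μ₀ hμ₀K) hfix).congr hT
        (huniq θ h).symm
    · obtain ⟨N, hN⟩ := hB.exists_lipschitzOnWith hF hΛ hT (hsupp μ₀ hμ₀K) hlam hM1 hϑ hfix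
        (hFT.congr_field hG)
      exact ⟨N, ϑ, hN, huniq θ hθ⟩
  · obtain ⟨ϑ, hϑ, hfix⟩ := hB.exists_fixedPoint hF hΛ hT (hsupp μ₀ hμ₀K) hlam hM1
    obtain ⟨ϑ', hϑ', hfix'⟩ := hB.exists_fixedPoint hF hΛ hT (hsupp μ₀' hμ₀K') hlam hM1
    have h1 := hB.ae_eq_of_isOptimal hF hΛ hT (hsupp μ₀ hμ₀K) hlam hM2 hϑ hfix hθ
    have h2 := hB.ae_eq_of_isOptimal hF hΛ hT (hsupp μ₀' hμ₀K') hlam hM2 hϑ' hfix' hθ'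
    have hC : 0 < (M ^ 2 * (2 * M + 1) + 1) / lam := by positivity
    -- Since the constant is positive, the infinite case is trivial, and no finite-cost coupling has
    -- to be exhibited.
    rcases eq_or_ne (W1 μ₀ μ₀') ∞ with hW | hW
    · rw [hW, ENNReal.mul_top (by simpa using hC)]
      exact le_top
    · rw [eLpNorm_exponent_top, ← ENNReal.ofReal_toReal hW]
      change _ ≤ ENNReal.ofReal ((M ^ 2 * (2 * M + 1) + 1) / lam) * _
      rw [← ENNReal.ofReal_mul hC.le]
      refine eLpNormEssSup_le_of_ae_bound ?_
      filter_upwards [h1, h2, ae_restrict_mem measurableSet_Icc] with t ht ht' htI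
      rw [ht, ht']
      exact hB.norm_sub_le_W1 hF hΛ hT (hsupp μ₀ hμ₀K) (hsupp μ₀' hμ₀K') hlam hM1 hϑ hϑ' hfix hfix'
        hW htI
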